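/- Let $\Sigma=\{0,1\}$. For strings over $\Sigma$, let $\leq_{\rm lex}$ be the lexicographical order in which shorter strings come first, and let $a\prec_{\rm lex}b$ mean that $b$ is the immediate successor of $a$ in this order. An NPTM is a nondeterministic polynomial-time Turing machine; its computation paths on an input $x$ are named by their sequences of binary nondeterministic guesses (not every step needs to be a guess), and ${\rm acc}_M(x)$ is the set of accepting paths of $M$ on $x$. For a polynomial $p$ (with $p(n)\in\mathbb{N}$ for all $n\in\mathbb{N}$), $M$ is $p$-balanced if on each input $x$ the set of the guess sequences of the computation paths is precisely $\Sigma^{p(|x|)}$. ${\rm FP_t}$ is the class of total polynomial-time computable functions $\Sigma^*\to\Sigma^*$. ${\rm UP}$ is the class of the languages $L\subseteq\Sigma^*$ for which there is an NPTM that has at most one accepting path on each input, and has one exactly on the inputs in $L$; ${\rm coUP}=\{L\subseteq\Sigma^* \mid \Sigma^*\setminus L\in{\rm UP}\}$. A total function $f:\Sigma^*\to\mathbb{N}$ belongs to ${\rm CLU\#P_{free}}$ if there are a polynomial $p$, a $p$-balanced NPTM $M$, and a 3-argument polynomial-time computable predicate $\prec$ such that for every $x\in\Sigma^*$ there is a bijection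 $h_x$ from $\Sigma^{p(|x|)}$ to $\Sigma^{p(|x|)}$ with: (1) for all $y,z\in\Sigma^{p(|x|)}$: $\prec(x,y,z)\iff h_x(y)\prec_{\rm lex}h_x(z)$; (2) if $f(x)\neq 0$, then there are $\ell,u\in\Sigma^{p(|x|)}$ such that ${\rm acc}_M(x)=\{w\in\Sigma^{p(|x|)} \mid h_x(\ell)\leq_{\rm lex}h_x(w)\leq_{\rm lex}h_x(u)\}$; (3) $f(x)=\|{\rm acc}_M(x)\|$. ${\rm CLU\#P}$ is defined in the same way, except that in addition there must be functions $b,\top\in{\rm FP_t}$, chosen before $x$ (like $p$, $M$, and $\prec$), such that for every $x$: $|b(x)|=|\top(x)|=p(|x|)$, $h_x(b(x))=0^{p(|x|)}$, and $h_x(\top(x))=1^{p(|x|)}$. ${\rm CLU\#P_{circular}}$ is defined as ${\rm CLU\#P_{free}}$, except that (1) is replaced by: for all $y,z\in\Sigma^{p(|x|)}$, $\prec(x,y,z)\iff\big(h_x(y)\prec_{\rm lex}h_x(z)\ \lor\ (h_x(y)=1^{p(|x|)}\land h_x(z)=0^{p(|x|)})\big)$. Theorem. If ${\rm UP}={\rm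 coUP}$, then ${\rm CLU\#P}={\rm CLU\#P_{free}}={\rm CLU\#P_{circular}}$. -/

import Mathlib

namespace ClusterComputing

/-! ### Nondeterministic Turing machines

The machines are Mathlib's finite multi-stack Turing machines (the model `Turing.TM2`, with the
finiteness conditions of `Turing.FinTM2`), to which guessing steps are added. -/

/-- The instruction at a label: either a deterministic statement, or a binary nondeterministic
guess, after which the first statement is executed if the guessed bit is `0` and the second one if
it is `1`. -/
inductive Instr {K : Type} (Γ : K → Type) (Λ σ : Type) : Type
  | det (q : Turing.TM2.Stmt Γ Λ σ) : Instr Γ Λ σ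
  | guess (q₀ q₁ : Turing.TM2.Stmt Γ Λ σ) : Instr Γ Λ σ

/-- A nondeterministic Turing machine (acceptor) over the input alphabet `{0,1}`. -/
structure NTM where
  /-- the finite index set of the stacks -/
  {K : Type}
  [kDecidableEq : DecidableEq K]
  [kFin : Fintype K]
  /-- the input stack -/
  k₀ : K
  /-- the stack alphabets -/
  Γ : K → Type
  [ΓFin : ∀ k, Fintype (Γ k)]
  /-- the symbols of the input stack are the bits -/
  inputAlphabet : Γ k₀ ≃ Bool
  /-- the finite set of labels -/
  Λ : Type
  [ΛFin : Fintype Λ]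
  /-- the label at which the computation starts -/
  main : Λ
  /-- the finite set of internal states -/
  σ : Type
  [σFin : Fintype σ]
  /-- the initial internal state -/
  initialState : σ
  /-- whether halting in a given internal state means acceptance or rejection -/
  accepting : σ → Bool
  /-- the program -/
  prog : Λ → Instr Γ Λ σ

attribute [instance] NTM.kDecidableEq NTM.kFin NTM.ΓFin NTM.ΛFin NTM.σFin

namespace NTM

/-- Configurations; the label is `none` exactly if the machine has halted. -/
abbrev Cfg (M : NTM) : Type := Turing.TM2.Cfg M.Γ M.Λ M.σ

/-- The initial configuration on input `x`: `x` is on the input stack, the others are empty. -/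
def init (M : NTM) (x : List Bool) : M.Cfg where
  l := some M.main
  var := M.initialState
  stk := Function.update (fun _ => []) M.k₀ (x.map M.inputAlphabet.symm)

/-- `M.Run c y n c'`: from `c`, the machine can reach `c'` in exactly `n` steps, along which the
sequence of guessed bits is `y`. -/
inductive Run (M : NTM) : M.Cfg → List Bool → ℕ → M.Cfg → Prop
  | refl (c : M.Cfg) : Run M c [] 0 c
  | det {l : M.Λ} {v : M.σ} {S : ∀ k, List (M.Γ k)} {q : Turing.TM2.Stmt M.Γ M.Λ M.σ}
      {y : List Bool} {n : ℕ} {c' : M.Cfg} (hl : M.prog l = Instr.det q)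
      (h : Run M (Turing.TM2.stepAux q v S) y n c') :
      Run M ⟨some l, v, S⟩ y (n + 1) c'
  | guess {l : M.Λ} {v : M.σ} {S : ∀ k, List (M.Γ k)} {q₀ q₁ : Turing.TM2.Stmt M.Γ M.Λ M.σ}
      {y : List Bool} {n : ℕ} {c' : M.Cfg} (b : Bool) (hl : M.prog l = Instr.guess q₀ q₁)
      (h : Run M (Turing.TM2.stepAux (if b then q₁ else q₀) v S) y n c') :
      Run M ⟨some l, v, S⟩ (b :: y) (n + 1) c'

/-- The machine is an NPTM: some polynomial in the input length bounds the number of steps on all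
computation paths (so all of them halt). -/
def IsPolyTime (M : NTM) : Prop :=
  ∃ T : Polynomial ℕ, ∀ (x y : List Bool) (n : ℕ) (c : M.Cfg),
    M.Run (M.init x) y n c → n ≤ T.eval x.length

/-- The computation paths of `M` on `x`, each one named by its sequence of guessed bits. -/
def paths (M : NTM) (x : List Bool) : Set (List Bool) :=
  {y | ∃ (n : ℕ) (c : M.Cfg), M.Run (M.init x) y n c ∧ c.l = none}

/-- The accepting computation paths of `M` on `x`. -/
def acc (M : NTM) (x : List Bool) : Set (List Bool) :=
  {y | ∃ (n : ℕ) (c : M.Cfg), M.Run (M.init x) y n c ∧ c.l = none ∧ M.accepting c.var = true}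

/-- `M` is `p`-balanced: on each input `x`, the sequences of guesses along the computation paths are
precisely the strings of length `p(|x|)`. -/
def IsBalanced (M : NTM) (p : ℕ → ℕ) : Prop :=
  ∀ x : List Bool, M.paths x = {y | y.length = p x.length}

end NTM

/-! ### UP and coUP -/

/-- The class UP. -/
def UP : Set (Set (List Bool)) :=
  {L | ∃ M : NTM, M.IsPolyTime ∧
    ∀ x, (M.acc x).Subsingleton ∧ (x ∈ L ↔ (M.acc x).Nonempty)}

/-- The class coUP of the complements of the languages in UP. -/
def coUP : Set (Set (List Bool)) := {L | Lᶜ ∈ UP}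

/-! ### Deterministic polynomial time -/

/-- The total, polynomial-time computable functions from strings to strings. -/
def FPt : Set (List Bool → List Bool) :=
  {g | Nonempty (Turing.TM2ComputableInPolyTime
    (Computability.encodingList Bool).encode (Computability.encodingList Bool).encode g)}

/-- The encoding of triples of strings for machine input: the three strings are written one after
the other, each bit being marked with the component that it belongs to. -/
def encodingTriple : Computability.Encoding (List Bool × List Bool × List Bool)
    (Bool ⊕ (Bool ⊕ Bool)) :=
  Computability.encodingProd (Computability.encodingList Bool)
    (Computability.encodingProd (Computability.encodingList Bool)
      (Computability.encodingList Bool))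

/-- The three-argument, polynomial-time computable predicates on strings. -/
def PolyPred₃ : Set (List Bool → List Bool → List Bool → Bool) :=
  {r | Nonempty (Turing.TM2ComputableInPolyTime encodingTriple.encode Computability.encodeBool
    (fun t => r t.1 t.2.1 t.2.2))}

/-- `p` is (the restriction to the natural numbers of) a polynomial. Rational coefficients are the
general case, since a real polynomial with integer values on the naturals has rational ones. -/
def IsPolynomial (p : ℕ → ℕ) : Prop :=
  ∃ P : Polynomial ℚ, ∀ n : ℕ, P.eval (n : ℚ) = (p n : ℚ)

/-! ### Lexicographical order on strings (shorter strings come first) -/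

/-- `a` is lexicographically smaller than `b`. -/
def LexLT (a b : List Bool) : Prop := List.Shortlex (· < ·) a b

/-- `a` is lexicographically at most `b`. -/
def LexLE (a b : List Bool) : Prop := LexLT a b ∨ a = b

/-- `b` is the lexicographical successor of `a`. -/
def LexSucc (a b : List Bool) : Prop := LexLT a b ∧ ∀ c, ¬ (LexLT a c ∧ LexLT c b)

/-! ### The cluster classes -/

/-- The set of accepting paths of `M` on `x` is a contiguous block in the order that
is transported from the lexicographical order by the bijection `h`. -/
def Clustered (M : NTM) (x : List Bool) {n : ℕ}
    (h : List.Vector Bool n ≃ List.Vector Bool n) : Prop :=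
  ∃ l u : List.Vector Bool n,
    M.acc x = {w | ∃ hw : w.length = n,
      LexLE (h l).toList (h ⟨w, hw⟩).toList ∧ LexLE (h ⟨w, hw⟩).toList (h u).toList}

/-- The class CLU#P. -/
def CLUSharpP : Set (List Bool → ℕ) :=
  {f | ∃ p : ℕ → ℕ, IsPolynomial p ∧
    ∃ M : NTM, M.IsPolyTime ∧ M.IsBalanced p ∧
    ∃ b ∈ FPt, ∃ t ∈ FPt, ∃ adj ∈ PolyPred₃,
    ∀ x : List Bool,
    ∃ h : List.Vector Bool (p x.length) ≃ List.Vector Bool (p x.length),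
      (∃ (hb : (b x).length = p x.length) (ht : (t x).length = p x.length),
        (h ⟨b x, hb⟩).toList = List.replicate (p x.length) false ∧
        (h ⟨t x, ht⟩).toList = List.replicate (p x.length) true) ∧
      (∀ y z : List.Vector Bool (p x.length),
        adj x y.toList z.toList = true ↔ LexSucc (h y).toList (h z).toList) ∧
      (f x ≠ 0 → Clustered M x h) ∧
      (M.acc x).encard = f x}

/-- The class CLU#P_free: no requirement on bottom and top elements. -/
def CLUSharpPFree : Set (List Bool → ℕ) :=
  {f | ∃ p : ℕ → ℕ, IsPolynomial p ∧
    ∃ M : NTM, M.IsPolyTime ∧ M.IsBalanced p ∧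
    ∃ adj ∈ PolyPred₃,
    ∀ x : List Bool,
    ∃ h : List.Vector Bool (p x.length) ≃ List.Vector Bool (p x.length),
      (∀ y z : List.Vector Bool (p x.length),
        adj x y.toList z.toList = true ↔ LexSucc (h y).toList (h z).toList) ∧
      (f x ≠ 0 → Clustered M x h) ∧
      (M.acc x).encard = f x}

/-- The class CLU#P_circular: the last string is also left-adjacent to the first one. -/
def CLUSharpPCircular : Set (List Bool → ℕ) :=
  {f | ∃ p : ℕ → ℕ, IsPolynomial p ∧
    ∃ M : NTM, M.IsPolyTime ∧ M.IsBalanced p ∧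
    ∃ adj ∈ PolyPred₃,
    ∀ x : List Bool,
    ∃ h : List.Vector Bool (p x.length) ≃ List.Vector Bool (p x.length),
      (∀ y z : List.Vector Bool (p x.length),
        adj x y.toList z.toList = true ↔
          (LexSucc (h y).toList (h z).toList ∨
            ((h y).toList = List.replicate (p x.length) true ∧
              (h z).toList = List.replicate (p x.length) false))) ∧
      (f x ≠ 0 → Clustered M x h) ∧
      (M.acc x).encard = f x}

end ClusterComputing

/-! CLU#P is contained in the other two classes almost by definition. The content is the converse: a
bottom and a top must be computable from `x`, although in the given order they are at best
characterized uniquely.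

Unrestricted orders. The bottom is the only string without a predecessor, the top the only one
without a successor. Predecessors and successors are unique if they exist, so having one is a UP
property. Under UP = coUP its failure also has a unique witness that is checkable in polynomial time
(`exists_refutation`). Hence the top, the bottom and two such witnesses form a certificate `c₀` that
is the only string of its length passing a polynomial-time test `V`.

Nobody needs to find `c₀` deterministically, because it can be guessed
(`mem_cluSharpP_of_certificate`). The new paths are the strings `c ++ y`, accepting if `c` passes
`V` and `y` is an accepting path of the old machine. They are arranged in blocks: lexicographically
by `c`, inside the block of `c₀` by the given order, and inside every other block lexicographically.
Each block has a bottom and a top that can be computed from `x` and `c`: a valid certificate names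
them, and otherwise they are all zeros and all ones. So adjacency across blocks is decidable, and
the global bottom and top are found in the blocks of `0…0` and `1…1`. All accepting paths lie in the
block of `c₀` in their old order, so their number and contiguity are kept.

Circular orders. Here the wrap-around is not visible, so the circle is cut where the cluster begins:
between a rejecting path and its accepting successor. There is at most one such boundary, since the
cluster is an interval. If there is none, the accepting set is empty or everything, and any cut will
do; the one in front of `0…0` is taken, certified by the unique refutation of the existence of a
boundary. The certificate construction is then applied to the rotated order.

As the classes refer to concrete machines, polynomial time is handled through the predicate `PT`,
which is closed under composition, pairing and length-bounded iteration (`PT.comp`, `PT.pair`,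
`PT.iterate`) and agrees with the notion in the definitions (`pt_iff_tm2`). Nondeterminism enters
and leaves by `exists_ntm` (guess and check) and `NTM.pt_acc` (accepting paths are verifiable);
`NTM.IsBalanced.pt` makes the path length computable. -/

namespace ClusterComputing

set_option linter.unusedSectionVars false

open Turing Function

/-! ### Runs of guessing stack programs -/

section Programs

variable {K : Type} [DecidableEq K] {Γ : K → Type} {Λ Λ' σ : Type}

/-- The statement that an instruction executes, given the guessed bit. -/
def Instr.stmt : Instr Γ Λ σ → Bool → TM2.Stmt Γ Λ σ
  | .det q, _ => q
  | .guess q₀ q₁, b => if b then q₁ else q₀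

/-- The bits that an instruction consumes, given the guessed bit. -/
def Instr.bits : Instr Γ Λ σ → Bool → List Bool
  | .det _, _ => []
  | .guess _ _, b => [b]

/-- `Steps P c y n c'`: from `c`, the program `P` can reach `c'` in exactly `n` steps, along which
the sequence of guessed bits is `y`. -/
inductive Steps (P : Λ → Instr Γ Λ σ) :
    TM2.Cfg Γ Λ σ → List Bool → ℕ → TM2.Cfg Γ Λ σ → Prop
  | refl (c) : Steps P c [] 0 c
  | step {l v S y n c'} (b : Bool) (h : Steps P (TM2.stepAux ((P l).stmt b) v S) y n c') :
      Steps P ⟨some l, v, S⟩ ((P l).bits b ++ y) (n + 1) c'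

variable {P : Λ → Instr Γ Λ σ}

theorem Steps.trans {c₁ c₂ c₃ : TM2.Cfg Γ Λ σ} {y y' n n'} (h : Steps P c₁ y n c₂)
    (h' : Steps P c₂ y' n' c₃) : Steps P c₁ (y ++ y') (n + n') c₃ := by
  induction h with
  | refl => simpa using h'
  | step b _ ih =>
    have := Steps.step b (ih h')
    rwa [List.append_assoc, Nat.add_right_comm]

theorem Steps.of_halted {c c' : TM2.Cfg Γ Λ σ} {y n} (h : Steps P c y n c') (hc : c.l = none) :
    y = [] ∧ n = 0 ∧ c' = c := by
  cases h with
  | refl => simp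
  | step b h => simp at hc

/-- A computation is determined by its guesses. -/
theorem Steps.deterministic {c d d' : TM2.Cfg Γ Λ σ} {y y' r r' : List Bool} {n n' : ℕ}
    (h : Steps P c y n d) (hd : d.l = none) (h' : Steps P c y' n' d') (hy : y ++ r = y' ++ r') :
    n' ≤ n ∧ y' <+: y ∧ (d'.l = none → y' = y ∧ n' = n ∧ d' = d) := by
  induction h generalizing y' n' r r' with
  | refl c =>
    obtain ⟨rfl, rfl, rfl⟩ := h'.of_halted hd
    simp
  | @step l v S y n c' b h ih =>
    cases h' with
    | refl => simp
    | @step _ _ _ y'' n'' _ b' h' =>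
      -- A guess consumes the first bit of the common padded string, so both runs take the same
      -- branch. The paddings allow the two guess sequences to differ in length.
      have key : (P l).stmt b = (P l).stmt b' ∧ (P l).bits b = (P l).bits b' ∧
          y ++ r = y'' ++ r' := by
        cases hP : P l with
        | det q => simpa [hP, Instr.stmt, Instr.bits] using hy
        | guess q₀ q₁ => simp_all [Instr.stmt, Instr.bits]
      obtain ⟨e1, e2, e3⟩ := key
      rw [← e1] at h'
      obtain ⟨i1, i2, i3⟩ := ih hd h' e3
      refine ⟨by omega, ?_, fun hd' => ?_⟩
      · rw [e2]; exact (List.prefix_append_right_inj _).2 i2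
      · obtain ⟨rfl, rfl, rfl⟩ := i3 hd'
        simp [e2]

/-- `Steps` treats both kinds of instruction by one rule, with a dummy bit for the deterministic
ones; this leaves one step case in inductions. -/
theorem NTM.run_iff_steps (M : NTM) {c c' : M.Cfg} {y n} :
    M.Run c y n c' ↔ Steps M.prog c y n c' := by
  constructor
  · intro h
    induction h with
    | refl => exact .refl _
    | det hl h ih =>
      have := Steps.step (P := M.prog) false (by rw [hl]; exact ih)
      rwa [hl] at this
    | guess b hl h ih =>
      have := Steps.step (P := M.prog) b (by rw [hl]; exact ih)
      rwa [hl] at this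
  · intro h
    induction h with
    | refl => exact .refl _
    | @step l v S y n c' b h ih =>
      cases hl : M.prog l with
      | det q => rw [hl] at ih; exact .det hl ih
      | guess q₀ q₁ => rw [hl] at ih; exact .guess b hl ih

/-- An upper bound on the number of symbols that a statement pushes. -/
def pushCount : TM2.Stmt Γ Λ σ → ℕ
  | .push _ _ q => pushCount q + 1
  | .peek _ _ q => pushCount q
  | .pop _ _ q => pushCount q
  | .load _ q => pushCount q
  | .branch _ q₁ q₂ => pushCount q₁ + pushCount q₂
  | .goto _ => 0
  | .halt => 0

theorem length_stepAux_le (q : TM2.Stmt Γ Λ σ) (v : σ) (S : ∀ k, List (Γ k)) (k : K) :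
    ((TM2.stepAux q v S).stk k).length ≤ (S k).length + pushCount q := by
  induction q generalizing v S with
  | push j f q ih =>
    have := ih v (update S j (f v :: S j))
    by_cases h : k = j
    · subst h; simp [pushCount] at this ⊢; omega
    · simp [pushCount, h] at this ⊢; omega
  | peek j f q ih => exact ih _ _
  | pop j f q ih =>
    have := ih (f v (S j).head?) (update S j (S j).tail)
    by_cases h : k = j
    · subst h; simp [pushCount] at this ⊢; omega
    · simp [pushCount, h] at this ⊢; omega
  | load f q ih => exact ih _ _
  | branch f q₁ q₂ ih₁ ih₂ =>
    have := ih₁ v S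
    have := ih₂ v S
    cases h : f v <;> simp [pushCount, TM2.stepAux, h] <;> omega
  | goto f => simp
  | halt => simp

/-- A program has finitely many statements, so the number of pushes per step is bounded. This turns
time bounds into bounds on the lengths of intermediate results. -/
theorem exists_length_le [Finite Λ] (P : Λ → Instr Γ Λ σ) :
    ∃ C : ℕ, ∀ (c : TM2.Cfg Γ Λ σ) (y n) (c' : TM2.Cfg Γ Λ σ), Steps P c y n c' →
      ∀ k, (c'.stk k).length ≤ (c.stk k).length + C * n := by
  obtain ⟨C, hC⟩ := (Set.finite_range fun p : Λ × Bool => pushCount ((P p.1).stmt p.2)).bddAbove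
  refine ⟨C, fun c y n c' h k => ?_⟩
  induction h with
  | refl => simp
  | @step l v S y n c' b h ih =>
    have h1 := length_stepAux_le ((P l).stmt b) v S k
    have h2 : pushCount ((P l).stmt b) ≤ C := hC ⟨(l, b), rfl⟩
    rw [mul_add]; dsimp only at *; omega

/-- Renaming of the labels; halting is replaced by going to the label `ex`, if there is one. -/
def relabel (f : Λ → Λ') (ex : Option Λ') : TM2.Stmt Γ Λ σ → TM2.Stmt Γ Λ' σ
  | .push k g q => .push k g (relabel f ex q)
  | .peek k g q => .peek k g (relabel f ex q)
  | .pop k g q => .pop k g (relabel f ex q)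
  | .load g q => .load g (relabel f ex q)
  | .branch g q₁ q₂ => .branch g (relabel f ex q₁) (relabel f ex q₂)
  | .goto g => .goto (f ∘ g)
  | .halt => match ex with
    | none => .halt
    | some l => .goto fun _ => l

/-- The label of a configuration after renaming. -/
def relabelOpt (f : Λ → Λ') (ex : Option Λ') : Option Λ → Option Λ'
  | none => ex
  | some l => some (f l)

theorem stepAux_relabel (f : Λ → Λ') (ex : Option Λ') (q : TM2.Stmt Γ Λ σ) (v : σ)
    (S : ∀ k, List (Γ k)) :
    TM2.stepAux (relabel f ex q) v S = ⟨relabelOpt f ex (TM2.stepAux q v S).l,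
      (TM2.stepAux q v S).var, (TM2.stepAux q v S).stk⟩ := by
  induction q generalizing v S with
  | branch g q₁ q₂ ih₁ ih₂ => cases h : g v <;> simp [relabel, TM2.stepAux, h, ih₁, ih₂]
  | halt => cases ex <;> simp [relabel, relabelOpt]
  | goto g => simp [relabel, relabelOpt]
  | _ => simp_all [relabel]

/-- Renaming of the labels of an instruction. -/
def Instr.relabel (f : Λ → Λ') (ex : Option Λ') : Instr Γ Λ σ → Instr Γ Λ' σ
  | .det q => .det (ClusterComputing.relabel f ex q)
  | .guess q₀ q₁ => .guess (ClusterComputing.relabel f ex q₀) (ClusterComputing.relabel f ex q₁)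

/-- The hypothesis concerns only the labels in the image of `f`, so `P'` may contain further code.
Embedding a routine in `seq` or `forPop` is an instance, with `ex` as the continuation. -/
theorem Steps.relabel {P' : Λ' → Instr Γ Λ' σ} {f : Λ → Λ'} {ex : Option Λ'}
    (hP : ∀ l, P' (f l) = (P l).relabel f ex) {c c' : TM2.Cfg Γ Λ σ} {y n}
    (h : Steps P c y n c') :
    Steps P' ⟨relabelOpt f ex c.l, c.var, c.stk⟩ y n ⟨relabelOpt f ex c'.l, c'.var, c'.stk⟩ := by
  induction h with
  | refl => exact .refl _
  | @step l v S y n c' b h ih =>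
    rw [← stepAux_relabel] at ih
    have e1 : ClusterComputing.relabel f ex ((P l).stmt b) = (P' (f l)).stmt b := by
      rw [hP]; cases P l <;> cases b <;> simp [Instr.stmt, Instr.relabel]
    have e2 : (P l).bits b = (P' (f l)).bits b := by
      rw [hP]; cases P l <;> simp [Instr.bits, Instr.relabel]
    rw [e1] at ih
    rw [e2]
    exact .step b ih

end Programs

/-! ### Routines -/

/-- A routine: a guessing stack program with an entry; halting is its exit. -/
structure Routine {K : Type} (Γ : K → Type) (σ : Type) where
  /-- the labels -/
  Λ : Type
  [fin : Fintype Λ]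
  /-- the entry -/
  main : Λ
  /-- the program -/
  code : Λ → Instr Γ Λ σ

attribute [instance] Routine.fin

namespace Routine

variable {K : Type} [DecidableEq K] {Γ : K → Type} {σ : Type}

/-- The routine makes no guesses. -/
def IsDet (R : Routine Γ σ) : Prop := ∀ l, ∃ q, R.code l = .det q

/-- Within `t` steps, and with the guesses `y`, the routine leads from `(v, S)` to `(v', S')`. -/
def Exec (R : Routine Γ σ) (v : σ) (S : ∀ k, List (Γ k)) (y : List Bool) (t : ℕ) (v' : σ)
    (S' : ∀ k, List (Γ k)) : Prop :=
  ∃ n ≤ t, Steps R.code ⟨some R.main, v, S⟩ y n ⟨none, v', S'⟩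

theorem Exec.mono {R : Routine Γ σ} {v S y t v' S'} (h : R.Exec v S y t v' S') {t'} (ht : t ≤ t') :
    R.Exec v S y t' v' S' :=
  let ⟨n, hn, h⟩ := h
  ⟨n, hn.trans ht, h⟩

/-- Execution of one statement. -/
abbrev op (q : TM2.Stmt Γ Unit σ) : Routine Γ σ := ⟨Unit, (), fun _ => .det q⟩

theorem isDet_op (q : TM2.Stmt Γ Unit σ) : (op q).IsDet := fun _ => ⟨q, rfl⟩

theorem exec_op {q : TM2.Stmt Γ Unit σ} {v S v' S'} (h : TM2.stepAux q v S = ⟨none, v', S'⟩) :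
    (op q).Exec v S [] 1 v' S' := by
  refine ⟨1, le_rfl, ?_⟩
  have := Steps.step (P := (op q).code) (l := ()) (v := v) (S := S) (c' := ⟨none, v', S'⟩)
    (y := []) (n := 0) false (by
      simp only [op, Instr.stmt, h]; exact .refl _)
  simpa [op, Instr.bits] using this

/-- Guessing of one bit. -/
abbrev choice (q : Bool → TM2.Stmt Γ Unit σ) : Routine Γ σ :=
  ⟨Unit, (), fun _ => .guess (q false) (q true)⟩

theorem exec_choice {q : Bool → TM2.Stmt Γ Unit σ} {v S v' S'} (b : Bool)
    (h : TM2.stepAux (q b) v S = ⟨none, v', S'⟩) : (choice q).Exec v S [b] 1 v' S' := by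
  refine ⟨1, le_rfl, ?_⟩
  have := Steps.step (P := (choice q).code) (l := ()) (v := v) (S := S) (c' := ⟨none, v', S'⟩)
    (y := []) (n := 0) b (by
      have : TM2.stepAux (Instr.stmt ((choice q).code ()) b) v S = ⟨none, v', S'⟩ := by
        refine Eq.trans ?_ h; cases b <;> rfl
      rw [this]; exact .refl _)
  simpa [choice, Instr.bits] using this

/-- Execution of two routines one after the other. -/
abbrev seq (A B : Routine Γ σ) : Routine Γ σ where
  Λ := A.Λ ⊕ B.Λ
  main := .inl A.main
  code
    | .inl l => (A.code l).relabel .inl (some (.inr B.main))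
    | .inr l => (B.code l).relabel .inr none

theorem IsDet.seq {A B : Routine Γ σ} (hA : A.IsDet) (hB : B.IsDet) : (A.seq B).IsDet := by
  rintro (l | l)
  · obtain ⟨q, hq⟩ := hA l
    exact ⟨_, by simp only [Routine.seq, hq, Instr.relabel]; rfl⟩
  · obtain ⟨q, hq⟩ := hB l
    exact ⟨_, by simp only [Routine.seq, hq, Instr.relabel]; rfl⟩

theorem Exec.seq {A B : Routine Γ σ} {v S y t v₁ S₁ y' t' v₂ S₂} (hA : A.Exec v S y t v₁ S₁)
    (hB : B.Exec v₁ S₁ y' t' v₂ S₂) : (A.seq B).Exec v S (y ++ y') (t + t') v₂ S₂ := by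
  obtain ⟨n, hn, hA⟩ := hA
  obtain ⟨n', hn', hB⟩ := hB
  have h1 := hA.relabel (P' := (A.seq B).code) (f := .inl) (ex := some (.inr B.main))
    (fun _ => rfl)
  have h2 := hB.relabel (P' := (A.seq B).code) (f := .inr) (ex := none) (fun _ => rfl)
  exact ⟨n + n', by omega, h1.trans h2⟩

/-- Repeatedly pop a symbol and execute `A`, as long as `test` succeeds. -/
abbrev forPop (a : K) (set : σ → Option (Γ a) → σ) (test : σ → Bool) (A : Routine Γ σ) :
    Routine Γ σ where
  Λ := Option A.Λ
  main := none
  code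
    | none => .det (.pop a set (.branch test (.goto fun _ => some A.main) .halt))
    | some l => (A.code l).relabel some (some none)

theorem IsDet.forPop {A : Routine Γ σ} (hA : A.IsDet) (a : K) (set : σ → Option (Γ a) → σ)
    (test : σ → Bool) : (A.forPop a set test).IsDet := by
  rintro (_ | l)
  · exact ⟨_, rfl⟩
  · obtain ⟨q, hq⟩ := hA l
    exact ⟨_, by simp only [Routine.forPop, hq, Instr.relabel]; rfl⟩

theorem exec_forPop_nil {A : Routine Γ σ} {a : K} {set : σ → Option (Γ a) → σ} {test : σ → Bool}
    {v : σ} {S : ∀ k, List (Γ k)} (hS : S a = []) (ht : test (set v none) = false) :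
    (A.forPop a set test).Exec v S [] 1 (set v none) S := by
  refine ⟨1, le_rfl, ?_⟩
  have := Steps.step (P := (A.forPop a set test).code) (l := none) (v := v) (S := S)
    (c' := ⟨none, set v none, S⟩) (y := []) (n := 0) false (by
      simp only [forPop, Instr.stmt, TM2.stepAux, hS, List.head?_nil, ht, cond_false,
        List.tail_nil]
      rw [← hS, update_eq_self]; exact .refl _)
  simpa [forPop, Instr.bits] using this

theorem exec_forPop_cons {A : Routine Γ σ} {a : K} {set : σ → Option (Γ a) → σ} {test : σ → Bool}
    {v : σ} {S : ∀ k, List (Γ k)} {s : Γ a} {r : List (Γ a)} {y t v₁ S₁ y' t' v₂ S₂}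
    (hS : S a = s :: r) (ht : test (set v (some s)) = true)
    (hA : A.Exec (set v (some s)) (update S a r) y t v₁ S₁)
    (h : (A.forPop a set test).Exec v₁ S₁ y' t' v₂ S₂) :
    (A.forPop a set test).Exec v S (y ++ y') (t + t' + 1) v₂ S₂ := by
  obtain ⟨n, hn, hA⟩ := hA
  obtain ⟨n', hn', h⟩ := h
  have h1 := hA.relabel (P' := (A.forPop a set test).code) (f := some) (ex := some none)
    (fun _ => rfl)
  refine ⟨n + n' + 1, by omega, ?_⟩
  have := Steps.step (P := (A.forPop a set test).code) (l := none) (v := v) (S := S)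
    (c' := ⟨none, v₂, S₂⟩) (y := y ++ y') (n := n + n') false (by
      simp only [forPop, Instr.stmt, TM2.stepAux, hS, List.head?_cons, ht, cond_true,
        List.tail_cons]
      exact h1.trans h)
  simpa [forPop, Instr.bits] using this

end Routine

/-! ### Routines on a part of the stacks -/

section Lift

variable {K J : Type} [DecidableEq K] [DecidableEq J] {Γ : K → Type} {Δ : J → Type}
  {Λ σ τ : Type}

/-- The alphabets of two families of stacks. -/
abbrev sumΓ (Γ : K → Type) (Δ : J → Type) : K ⊕ J → Type
  | .inl k => Γ k
  | .inr j => Δ j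

/-- The contents of two families of stacks. -/
def both (S : ∀ k, List (Γ k)) (T : ∀ j, List (Δ j)) : ∀ i, List (sumΓ Γ Δ i)
  | .inl k => S k
  | .inr j => T j

@[simp] theorem both_inl (S : ∀ k, List (Γ k)) (T : ∀ j, List (Δ j)) (k : K) :
    both S T (.inl k) = S k := rfl

@[simp] theorem both_inr (S : ∀ k, List (Γ k)) (T : ∀ j, List (Δ j)) (j : J) :
    both S T (.inr j) = T j := rfl

@[simp] theorem update_both_inl (S : ∀ k, List (Γ k)) (T : ∀ j, List (Δ j)) (k : K)
    (l : List (Γ k)) : update (both S T) (.inl k) l = both (update S k l) T := by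
  funext i
  rcases i with i | j
  · by_cases h : i = k
    · subst h; simp
    · rw [update_of_ne (by simpa using h)]; simp [h]
  · rw [update_of_ne (by simp)]; rfl

@[simp] theorem update_both_inr (S : ∀ k, List (Γ k)) (T : ∀ j, List (Δ j)) (j : J)
    (l : List (Δ j)) : update (both S T) (.inr j) l = both S (update T j l) := by
  funext i
  rcases i with k | i
  · rw [update_of_ne (by simp)]; rfl
  · by_cases h : i = j
    · subst h; simp
    · rw [update_of_ne (by simpa using h)]; simp [h]

/-- A statement on the left family of stacks and the left part of the state. -/
def liftL : TM2.Stmt Γ Λ σ → TM2.Stmt (sumΓ Γ Δ) Λ (σ × τ)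
  | .push k g q => .push (.inl k) (fun v => g v.1) (liftL q)
  | .peek k g q => .peek (.inl k) (fun v o => (g v.1 o, v.2)) (liftL q)
  | .pop k g q => .pop (.inl k) (fun v o => (g v.1 o, v.2)) (liftL q)
  | .load g q => .load (fun v => (g v.1, v.2)) (liftL q)
  | .branch g q₁ q₂ => .branch (fun v => g v.1) (liftL q₁) (liftL q₂)
  | .goto g => .goto fun v => g v.1
  | .halt => .halt

/-- A statement on the right family of stacks and the right part of the state. -/
def liftR : TM2.Stmt Γ Λ σ → TM2.Stmt (sumΓ Δ Γ) Λ (τ × σ)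
  | .push k g q => .push (.inr k) (fun v => g v.2) (liftR q)
  | .peek k g q => .peek (.inr k) (fun v o => (v.1, g v.2 o)) (liftR q)
  | .pop k g q => .pop (.inr k) (fun v o => (v.1, g v.2 o)) (liftR q)
  | .load g q => .load (fun v => (v.1, g v.2)) (liftR q)
  | .branch g q₁ q₂ => .branch (fun v => g v.2) (liftR q₁) (liftR q₂)
  | .goto g => .goto fun v => g v.2
  | .halt => .halt

theorem stepAux_liftL (q : TM2.Stmt Γ Λ σ) (v : σ) (w : τ) (S : ∀ k, List (Γ k))
    (T : ∀ j, List (Δ j)) :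
    TM2.stepAux (liftL q) (v, w) (both S T) = ⟨(TM2.stepAux q v S).l,
      ((TM2.stepAux q v S).var, w), both (TM2.stepAux q v S).stk T⟩ := by
  induction q generalizing v S with
  | branch g q₁ q₂ ih₁ ih₂ => cases h : g v <;> simp [liftL, TM2.stepAux, h, ih₁, ih₂]
  | push k g q ih =>
    simp only [liftL, TM2.stepAux]
    erw [update_both_inl]
    exact ih _ _
  | peek k g q ih => exact ih _ _
  | pop k g q ih =>
    simp only [liftL, TM2.stepAux]
    erw [update_both_inl]
    exact ih _ _
  | _ => simp_all [liftL]

theorem stepAux_liftR (q : TM2.Stmt Γ Λ σ) (v : σ) (w : τ) (S : ∀ k, List (Γ k))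
    (T : ∀ j, List (Δ j)) :
    TM2.stepAux (liftR q) (w, v) (both T S) = ⟨(TM2.stepAux q v S).l,
      (w, (TM2.stepAux q v S).var), both T (TM2.stepAux q v S).stk⟩ := by
  induction q generalizing v S with
  | branch g q₁ q₂ ih₁ ih₂ => cases h : g v <;> simp [liftR, TM2.stepAux, h, ih₁, ih₂]
  | push k g q ih =>
    simp only [liftR, TM2.stepAux]
    erw [update_both_inr]
    exact ih _ _
  | peek k g q ih => exact ih _ _
  | pop k g q ih =>
    simp only [liftR, TM2.stepAux]
    erw [update_both_inr]
    exact ih _ _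
  | _ => simp_all [liftR]

/-- Lifting of an instruction along a map of statements. -/
def Instr.lift {K K' : Type} {Γ : K → Type} {Γ' : K' → Type} {Λ Λ' σ σ' : Type}
    (f : TM2.Stmt Γ Λ σ → TM2.Stmt Γ' Λ' σ') : Instr Γ Λ σ → Instr Γ' Λ' σ'
  | .det q => .det (f q)
  | .guess q₀ q₁ => .guess (f q₀) (f q₁)

theorem Instr.stmt_lift {K K' : Type} {Γ : K → Type} {Γ' : K' → Type} {Λ Λ' σ σ' : Type}
    (f : TM2.Stmt Γ Λ σ → TM2.Stmt Γ' Λ' σ') (i : Instr Γ Λ σ) (b : Bool) :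
    (i.lift f).stmt b = f (i.stmt b) := by
  cases i <;> cases b <;> simp [lift, stmt]

theorem Instr.bits_lift {K K' : Type} {Γ : K → Type} {Γ' : K' → Type} {Λ Λ' σ σ' : Type}
    (f : TM2.Stmt Γ Λ σ → TM2.Stmt Γ' Λ' σ') (i : Instr Γ Λ σ) (b : Bool) :
    (i.lift f).bits b = i.bits b := by
  cases i <;> rfl

namespace Routine

/-- A routine on the left family of stacks and the left part of the state. -/
abbrev onLeft (Δ : J → Type) (τ : Type) (R : Routine Γ σ) : Routine (sumΓ Γ Δ) (σ × τ) :=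
  ⟨R.Λ, R.main, fun l => (R.code l).lift liftL⟩

/-- A routine on the right family of stacks and the right part of the state. -/
abbrev onRight (Δ : J → Type) (τ : Type) (R : Routine Γ σ) : Routine (sumΓ Δ Γ) (τ × σ) :=
  ⟨R.Λ, R.main, fun l => (R.code l).lift liftR⟩

theorem IsDet.onLeft {R : Routine Γ σ} (h : R.IsDet) : (R.onLeft Δ τ).IsDet := fun l => by
  obtain ⟨q, hq⟩ := h l
  exact ⟨_, by simp only [Routine.onLeft, hq, Instr.lift]; rfl⟩

theorem IsDet.onRight {R : Routine Γ σ} (h : R.IsDet) : (R.onRight Δ τ).IsDet := fun l => by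
  obtain ⟨q, hq⟩ := h l
  exact ⟨_, by simp only [Routine.onRight, hq, Instr.lift]; rfl⟩

theorem Exec.onLeft {R : Routine Γ σ} {v S y t v' S'} (h : R.Exec v S y t v' S') (w : τ)
    (T : ∀ j, List (Δ j)) : (R.onLeft Δ τ).Exec (v, w) (both S T) y t (v', w) (both S' T) := by
  obtain ⟨n, hn, h⟩ := h
  refine ⟨n, hn, ?_⟩
  suffices H : ∀ c c' : TM2.Cfg Γ R.Λ σ, Steps R.code c y n c' →
      Steps (R.onLeft Δ τ).code ⟨c.l, (c.var, w), both c.stk T⟩ y n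
        ⟨c'.l, (c'.var, w), both c'.stk T⟩ from H _ _ h
  clear h
  intro c c' h
  clear hn
  induction h with
  | refl => exact .refl _
  | @step l v S y n c' b h ih =>
    have e : ((R.onLeft Δ τ).code l).stmt b = liftL ((R.code l).stmt b) := Instr.stmt_lift _ _ _
    have := Steps.step (P := (R.onLeft Δ τ).code) (l := l) b (e ▸ stepAux_liftL _ v w S T ▸ ih)
    simpa only [Instr.bits_lift] using this

theorem Exec.onRight {R : Routine Γ σ} {v S y t v' S'} (h : R.Exec v S y t v' S') (w : τ)
    (T : ∀ j, List (Δ j)) : (R.onRight Δ τ).Exec (w, v) (both T S) y t (w, v') (both T S') := by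
  obtain ⟨n, hn, h⟩ := h
  refine ⟨n, hn, ?_⟩
  suffices H : ∀ c c' : TM2.Cfg Γ R.Λ σ, Steps R.code c y n c' →
      Steps (R.onRight Δ τ).code ⟨c.l, (w, c.var), both T c.stk⟩ y n
        ⟨c'.l, (w, c'.var), both T c'.stk⟩ from H _ _ h
  clear h
  intro c c' h
  clear hn
  induction h with
  | refl => exact .refl _
  | @step l v S y n c' b h ih =>
    have e : ((R.onRight Δ τ).code l).stmt b = liftR ((R.code l).stmt b) := Instr.stmt_lift _ _ _
    have := Steps.step (P := (R.onRight Δ τ).code) (l := l) b (e ▸ stepAux_liftR _ v w S T ▸ ih)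
    simpa only [Instr.bits_lift] using this

end Routine

end Lift

end ClusterComputing

/-! ### Building blocks of deterministic machines. -/

namespace ClusterComputing

set_option linter.unusedSectionVars false

open Turing Function

/-! ### Moving symbols between stacks -/

section Moves

variable {K : Type} [DecidableEq K] {Γ : K → Type} {Λ σ : Type}

open Classical in
/-- Push the value of `f`, if there is one. -/
noncomputable def pushOpt (k : K) (f : σ → Option (Γ k)) (q : TM2.Stmt Γ Λ σ) : TM2.Stmt Γ Λ σ :=
  -- A push needs a symbol in every state, hence a default symbol, which is never pushed; over an
  -- empty alphabet there is nothing to push.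
  if h : Nonempty (Γ k) then
    .branch (fun v => (f v).isSome) (.push k (fun v => (f v).getD h.some) q) q
  else q

theorem stepAux_pushOpt (k : K) (f : σ → Option (Γ k)) (q : TM2.Stmt Γ Λ σ) (v : σ)
    (S : ∀ k, List (Γ k)) :
    TM2.stepAux (pushOpt k f q) v S = TM2.stepAux q v (update S k ((f v).toList ++ S k)) := by
  unfold pushOpt
  split_ifs with h
  · cases hf : f v <;> simp [TM2.stepAux, hf]
  · cases hf : f v with
    | none => simp
    | some s => exact absurd ⟨s⟩ h

/-- Push the first `n` entries of the value of `w`, one after the other. -/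
noncomputable def pushTake (k : K) (w : σ → List (Γ k)) : ℕ → TM2.Stmt Γ Λ σ → TM2.Stmt Γ Λ σ
  | 0, q => q
  | n + 1, q => pushTake k w n (pushOpt k (fun v => (w v)[n]?) q)

theorem stepAux_pushTake (k : K) (w : σ → List (Γ k)) (n : ℕ) (q : TM2.Stmt Γ Λ σ) (v : σ)
    (S : ∀ k, List (Γ k)) : TM2.stepAux (pushTake k w n q) v S =
      TM2.stepAux q v (update S k (((w v).take n).reverse ++ S k)) := by
  induction n generalizing q with
  | zero => simp [pushTake]
  | succ n ih =>
    rw [pushTake, ih, stepAux_pushOpt]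
    cases h : (w v)[n]? <;> simp [List.take_add_one, h]

/-- Push the entries of the value of `w`, one after the other. -/
noncomputable def pushList [Fintype σ] (k : K) (w : σ → List (Γ k)) (q : TM2.Stmt Γ Λ σ) :
    TM2.Stmt Γ Λ σ :=
  -- A single statement cannot loop, so the number of conditional pushes is fixed in advance as the
  -- maximal length over the finitely many states.
  pushTake k w (Finset.univ.sup fun v => (w v).length) q

theorem stepAux_pushList [Fintype σ] (k : K) (w : σ → List (Γ k)) (q : TM2.Stmt Γ Λ σ) (v : σ)
    (S : ∀ k, List (Γ k)) : TM2.stepAux (pushList k w q) v S =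
      TM2.stepAux q v (update S k ((w v).reverse ++ S k)) := by
  have : (w v).length ≤ Finset.univ.sup fun v => (w v).length :=
    Finset.le_sup (f := fun v => (w v).length) (Finset.mem_univ v)
  rw [pushList, stepAux_pushTake, List.take_of_length_le this]

/-- Registers, one for each stack. -/
abbrev Regs (Γ : K → Type) : Type := ∀ k, Option (Γ k)

/-- Empty registers. -/
def noRegs : Regs Γ := fun _ => none

@[simp] theorem update_noRegs (k : K) : update (noRegs : Regs Γ) k none = noRegs :=
  update_eq_self k noRegs

/-- Empty stacks. -/
def noStk : ∀ k, List (Γ k) := fun _ => []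

@[simp] theorem noStk_apply (k : K) : (noStk k : List (Γ k)) = [] := rfl

@[simp] theorem update_noStk (k : K) : update (noStk : ∀ k, List (Γ k)) k [] = noStk :=
  update_eq_self k noStk

variable {ρ : Type}

namespace Routine

/-- The loop that pops the symbols of the stack `a`, keeping each one in its register. -/
abbrev each (a : K) (A : Routine Γ (ρ × Regs Γ)) : Routine Γ (ρ × Regs Γ) :=
  A.forPop a (fun v o => (v.1, update v.2 a o)) (fun v => (v.2 a).isSome)

theorem exec_each_nil {A : Routine Γ (ρ × Regs Γ)} {a : K} {r : ρ} {S : ∀ k, List (Γ k)}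
    (hS : S a = []) : (each a A).Exec (r, noRegs) S [] 1 (r, noRegs) S := by
  have := exec_forPop_nil (A := A) (a := a) (set := fun v o => (v.1, update v.2 a o))
    (test := fun v => (v.2 a).isSome) (v := (r, noRegs)) hS (by simp)
  simpa using this

/-- The next pop overwrites the register of `a`, so whatever the body leaves there is harmless and
the rest of the loop can be assumed to start from empty registers; `hw` says that all other
registers are empty. -/
theorem exec_each_cons {A : Routine Γ (ρ × Regs Γ)} {a : K} {r r₁ r₂ : ρ} {w₁ : Regs Γ}
    {S S₁ S₂ : ∀ k, List (Γ k)} {s : Γ a} {l : List (Γ a)} {y t y' t'} (hS : S a = s :: l)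
    (hA : A.Exec (r, update noRegs a (some s)) (update S a l) y t (r₁, w₁) S₁)
    (h : (each a A).Exec (r₁, noRegs) S₁ y' t' (r₂, noRegs) S₂)
    (hw : ∀ o, update w₁ a o = update noRegs a o := by simp) :
    (each a A).Exec (r, noRegs) S (y ++ y') (t + t' + 1) (r₂, noRegs) S₂ := by
  refine exec_forPop_cons hS (by simp) hA ?_
  obtain ⟨n, hn, h⟩ := h
  refine ⟨n, hn, ?_⟩
  cases h with
  | @step _ _ _ y n _ b h =>
    have := Steps.step (P := (each a A).code) (l := none) (v := (r₁, w₁))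
      (S := S₁) (c' := ⟨none, (r₂, noRegs), S₂⟩) (y := y) (n := n) b (by
        simpa [forPop, Instr.stmt, TM2.stepAux, hw] using h)
    simpa [forPop, Instr.bits] using this

/-- Empty all registers. -/
abbrev clearRegs : Routine Γ (ρ × Regs Γ) := op (.load (fun v => (v.1, noRegs)) .halt)

theorem exec_clearRegs (r : ρ) (w : Regs Γ) (S : ∀ k, List (Γ k)) :
    clearRegs.Exec (r, w) S [] 1 (r, noRegs) S := exec_op rfl

variable [Fintype K] [∀ k, Fintype (Γ k)] [Fintype ρ]

/-- The outputs of a sequential transducer. -/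
def outputs {A B : Type} (δ : ρ → A → ρ) (w : ρ → A → List B) : ρ → List A → List B
  | _, [] => []
  | r, s :: l => w r s ++ outputs δ w (δ r s) l

/-- Run a sequential transducer on the stack `a`, with output to the stack `b`. -/
noncomputable abbrev scan (a b : K) (δ : ρ → Γ a → ρ) (w : ρ → Γ a → List (Γ b)) :
    Routine Γ (ρ × Regs Γ) :=
  each a (op (pushList b (fun v => (v.2 a).elim [] (w v.1))
    (.load (fun v => ((v.2 a).elim v.1 (δ v.1), v.2)) .halt)))

theorem isDet_scan (a b : K) (δ : ρ → Γ a → ρ) (w : ρ → Γ a → List (Γ b)) :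
    (scan a b δ w).IsDet := (isDet_op _).forPop _ _ _

theorem exec_scan {a b : K} (hab : a ≠ b) (δ : ρ → Γ a → ρ) (w : ρ → Γ a → List (Γ b)) (r : ρ)
    (S : ∀ k, List (Γ k)) :
    (scan a b δ w).Exec (r, noRegs) S [] (2 * (S a).length + 1) ((S a).foldl δ r, noRegs)
      (update (update S a []) b ((outputs δ w r (S a)).reverse ++ S b)) := by
  induction h : S a generalizing r S with
  | nil =>
    have := exec_each_nil (A := op (pushList b (fun v => (v.2 a).elim [] (w v.1))
      (.load (fun v => ((v.2 a).elim v.1 (δ v.1), v.2)) .halt))) (r := r) h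
    have hS : update S a [] = S := by rw [← h]; exact update_eq_self a S
    simpa [hS, outputs] using this
  | cons s l ih =>
    have h1 := exec_each_cons (r := r) (w₁ := update noRegs a (some s)) (y := []) (t := 1)
      (y' := []) (r₁ := δ r s)
      (S₁ := update (update S a l) b ((w r s).reverse ++ S b)) h (exec_op (by
        rw [stepAux_pushList]
        simp [TM2.stepAux, update_of_ne hab.symm])) (ih _ _ (by simp [update_of_ne hab]))
    convert h1 using 1
    · rfl
    · simp; omega
    · rfl
    · funext k
      rcases eq_or_ne k b with rfl | hb
      · simp [outputs]
      · rcases eq_or_ne k a with rfl | ha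
        · simp [hb]
        · simp [hb, ha]

/-- Empty the stack `a` and push the images of its symbols on the stack `b`. -/
noncomputable abbrev move (a b : K) (g : Γ a → Option (Γ b)) : Routine Γ (ρ × Regs Γ) :=
  scan a b (fun r _ => r) (fun _ s => (g s).toList)

/-- Popping one stack onto another reverses the content; hence strings are transported below by two
moves, through `.tmp`. -/
theorem exec_move {a b : K} (hab : a ≠ b) (g : Γ a → Option (Γ b)) (r : ρ)
    (S : ∀ k, List (Γ k)) :
    (move a b g).Exec (r, noRegs) S [] (2 * (S a).length + 1) (r, noRegs)
      (update (update S a []) b (((S a).filterMap g).reverse ++ S b)) := by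
  have h := exec_scan hab (fun r _ => r) (fun _ s => (g s).toList) r S
  have h1 : ∀ l : List (Γ a), l.foldl (fun r _ => r) r = r := fun l => by
    induction l <;> simp_all
  have h2 : ∀ l : List (Γ a),
      outputs (fun r _ => r) (fun _ s => (g s).toList) r l = l.filterMap g := fun l => by
    induction l with
    | nil => rfl
    | cons s l ih => cases h : g s <;> simp [outputs, ih, h]
  rwa [h1, h2] at h

/-- Empty the stack `a` and push the images of its symbols on the stacks `b` and `c`. -/
noncomputable abbrev move₂ (a b c : K) (g : Γ a → Option (Γ b)) (g' : Γ a → Option (Γ c)) :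
    Routine Γ (ρ × Regs Γ) :=
  each a (op (pushOpt b (fun v => (v.2 a).bind g) (pushOpt c (fun v => (v.2 a).bind g') .halt)))

theorem isDet_move₂ (a b c : K) (g : Γ a → Option (Γ b)) (g' : Γ a → Option (Γ c)) :
    (move₂ (ρ := ρ) a b c g g').IsDet := (isDet_op _).forPop _ _ _

theorem exec_move₂ {a b c : K} (hab : a ≠ b) (hac : a ≠ c) (hbc : b ≠ c) (g : Γ a → Option (Γ b))
    (g' : Γ a → Option (Γ c)) (r : ρ) (S : ∀ k, List (Γ k)) :
    (move₂ a b c g g').Exec (r, noRegs) S [] (2 * (S a).length + 1) (r, noRegs)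
      (update (update (update S a []) b (((S a).filterMap g).reverse ++ S b)) c
        (((S a).filterMap g').reverse ++ S c)) := by
  induction h : S a generalizing r S with
  | nil =>
    have := exec_each_nil (A := op (pushOpt b (fun v => (v.2 a).bind g)
      (pushOpt c (fun v => (v.2 a).bind g') .halt))) (r := r) h
    have hS : update S a [] = S := by rw [← h]; exact update_eq_self a S
    simpa [hS] using this
  | cons s l ih =>
    have h1 := exec_each_cons (r := r) (w₁ := update noRegs a (some s)) (y := []) (t := 1)
      (y' := []) (r₁ := r)
      (S₁ := update (update (update S a l) b ((g s).toList ++ S b)) c ((g' s).toList ++ S c)) h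
      (exec_op (by
        rw [stepAux_pushOpt, stepAux_pushOpt]
        simp [TM2.stepAux, update_of_ne hab.symm, update_of_ne hac.symm, update_of_ne hbc.symm]))
      (ih _ _ (by simp [update_of_ne hab, update_of_ne hac]))
    convert h1 using 1
    · rfl
    · simp; omega
    · funext k
      rcases eq_or_ne k c with rfl | hc
      · cases hg : g' s <;> simp [hg]
      · rcases eq_or_ne k b with rfl | hb
        · cases hg : g s <;> simp [hc, hg]
        · rcases eq_or_ne k a with rfl | ha
          · simp [hb, hc]
          · simp [hb, ha, hc]

end Routine

end Moves

/-! ### Auxiliary stacks -/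

/-- Names of auxiliary stacks. -/
inductive Aux
  | inp | cnt | tmp | out
  deriving DecidableEq

instance : Fintype Aux := ⟨{.inp, .cnt, .tmp, .out}, fun j => by cases j <;> simp⟩

section AuxStacks

variable {A E D B : Type}

/-- The alphabets of the auxiliary stacks. -/
abbrev AuxΓ (A E D B : Type) : Aux → Type
  | .inp => A
  | .cnt => E
  | .tmp => D
  | .out => B

instance AuxΓ.fintype [Fintype A] [Fintype E] [Fintype D] [Fintype B] :
    ∀ j, Fintype (AuxΓ A E D B j)
  | .inp => inferInstanceAs (Fintype A)
  | .cnt => inferInstanceAs (Fintype E)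
  | .tmp => inferInstanceAs (Fintype D)
  | .out => inferInstanceAs (Fintype B)

instance sumΓ.fintype {K J : Type} {Γ : K → Type} {Δ : J → Type} [∀ k, Fintype (Γ k)]
    [∀ j, Fintype (Δ j)] : ∀ i, Fintype (sumΓ Γ Δ i)
  | .inl k => inferInstanceAs (Fintype (Γ k))
  | .inr j => inferInstanceAs (Fintype (Δ j))

/-- The contents of the auxiliary stacks. -/
def aux (a : List A) (e : List E) (d : List D) (b : List B) : ∀ j, List (AuxΓ A E D B j)
  | .inp => a
  | .cnt => e
  | .tmp => d
  | .out => b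

variable (a a' : List A) (e e' : List E) (d d' : List D) (b b' : List B)

@[simp] theorem aux_inp : aux a e d b .inp = a := rfl
@[simp] theorem aux_cnt : aux a e d b .cnt = e := rfl
@[simp] theorem aux_tmp : aux a e d b .tmp = d := rfl
@[simp] theorem aux_out : aux a e d b .out = b := rfl

@[simp] theorem update_aux_inp : update (aux a e d b) .inp a' = aux a' e d b := by
  funext j; cases j <;> rfl

@[simp] theorem update_aux_cnt : update (aux a e d b) .cnt e' = aux a e' d b := by
  funext j; cases j <;> rfl

@[simp] theorem update_aux_tmp : update (aux a e d b) .tmp d' = aux a e d' b := by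
  funext j; cases j <;> rfl

@[simp] theorem update_aux_out : update (aux a e d b) .out b' = aux a e d b' := by
  funext j; cases j <;> rfl

theorem noStk_eq_aux : (noStk : ∀ j, List (AuxΓ A E D B j)) = aux [] [] [] [] := by
  funext j; cases j <;> rfl

theorem noStk_eq_both {K J : Type} {Γ : K → Type} {Δ : J → Type} :
    (noStk : ∀ i, List (sumΓ Γ Δ i)) = both noStk noStk := by
  funext i; rcases i with _ | _ <;> rfl

end AuxStacks

/-! ### Machines computing functions -/

/-- A deterministic machine with the input alphabet `A` and the output alphabet `B`. -/
structure Machine (A B : Type) where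
  /-- the stacks -/
  {K : Type}
  [dec : DecidableEq K]
  [fin : Fintype K]
  /-- the stack alphabets -/
  Γ : K → Type
  [Γfin : ∀ k, Fintype (Γ k)]
  /-- the input stack -/
  k₀ : K
  /-- the output stack -/
  k₁ : K
  /-- the symbols of the input stack -/
  i : Γ k₀ ≃ A
  /-- the symbols of the output stack -/
  o : Γ k₁ ≃ B
  /-- the internal states -/
  σ : Type
  [σfin : Fintype σ]
  /-- the initial state -/
  init : σ
  /-- the program -/
  R : Routine Γ σ
  det : R.IsDet

attribute [instance] Machine.dec Machine.fin Machine.Γfin Machine.σfin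

namespace Machine

variable {A B : Type}

/-- Stacks with a given input. -/
def input (M : Machine A B) (l : List A) : ∀ k, List (M.Γ k) := update noStk M.k₀ (l.map M.i.symm)

/-- Stacks with a given output. -/
def output (M : Machine A B) (l : List B) : ∀ k, List (M.Γ k) := update noStk M.k₁ (l.map M.o.symm)

/-- On the input `l`, the machine produces the output `l'` within `t` steps. -/
def Outputs (M : Machine A B) (l : List A) (l' : List B) (t : ℕ) : Prop :=
  M.R.Exec M.init (M.input l) [] t M.init (M.output l')

theorem exists_length_output_le (M : Machine A B) :
    ∃ C : ℕ, ∀ l l' t, M.Outputs l l' t → l'.length ≤ l.length + C * t := by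
  obtain ⟨C, hC⟩ := exists_length_le M.R.code
  refine ⟨C, fun l l' t ⟨n, hn, h⟩ => ?_⟩
  have h1 := hC _ _ _ _ h M.k₁
  have h2 : (M.input l M.k₁).length ≤ l.length := by
    unfold input
    rcases eq_or_ne M.k₁ M.k₀ with h | h
    · rw [h]; simp
    · simp [h]
  have h3 : (M.output l' M.k₁).length = l'.length := by simp [output]
  have h4 : C * n ≤ C * t := Nat.mul_le_mul_left C hn
  dsimp only at h1
  omega

end Machine

/-- The functions that are computable in polynomial time, with respect to given encodings. -/
def PT {α β A B : Type} (ea : α → List A) (eb : β → List B) (f : α → β) : Prop :=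
  ∃ (M : Machine A B) (T : Polynomial ℕ), ∀ a, M.Outputs (ea a) (eb (f a)) (T.eval (ea a).length)

theorem eval_mono (T : Polynomial ℕ) : Monotone fun n => T.eval n := by
  intro m n h
  simp only [Polynomial.eval_eq_sum]
  exact Finset.sum_le_sum fun i _ => Nat.mul_le_mul_left _ (Nat.pow_le_pow_left h i)

end ClusterComputing

namespace ClusterComputing

set_option linter.unusedSectionVars false

open Turing Function

/-! ### Closure properties of polynomial time -/

namespace PT

open Routine

variable {α β γ A B C : Type} {ea : α → List A} {eb : β → List B} {ec : γ → List C}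

/-- The machine of a finite-state sequential transducer. -/
noncomputable def transducerMachine [Fintype A] [Fintype B] {Q : Type} [Fintype Q] (q₀ : Q)
    (δ : Q → A → Q) (w : Q → A → List B) (fin : Q → List B) : Machine A B where
  Γ := AuxΓ A Empty B B
  k₀ := .inp
  k₁ := .out
  i := .refl A
  o := .refl B
  σ := Q × Regs (AuxΓ A Empty B B)
  init := (q₀, noRegs)
  R := (scan .inp .tmp δ w).seq ((op (pushList .tmp (fun v => fin v.1)
    (.load (fun v => (q₀, v.2)) .halt))).seq (move .tmp .out some))
  det := (isDet_scan _ _ _ _).seq ((isDet_op _).seq (isDet_scan _ _ _ _))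

/-- The source of the elementary functions: most string operations below are one left-to-right pass
with finite memory, which also may emit `fin` at the end. -/
theorem transducer [Fintype A] [Fintype B] {Q : Type} [Fintype Q] (q₀ : Q)
    (δ : Q → A → Q) (w : Q → A → List B) (fin : Q → List B) {f : α → β}
    (h : ∀ a, eb (f a) = outputs δ w q₀ (ea a) ++ fin ((ea a).foldl δ q₀)) : PT ea eb f := by
  obtain ⟨D, hD⟩ : ∃ D, ∀ q s, (w q s).length ≤ D := by
    obtain ⟨D, hD⟩ := (Set.finite_range fun p : Q × A => (w p.1 p.2).length).bddAbove
    exact ⟨D, fun q s => hD ⟨(q, s), rfl⟩⟩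
  obtain ⟨E, hE⟩ : ∃ E, ∀ q, (fin q).length ≤ E := by
    obtain ⟨E, hE⟩ := (Set.finite_range fun q : Q => (fin q).length).bddAbove
    exact ⟨E, fun q => hE ⟨q, rfl⟩⟩
  have hout : ∀ l q, (outputs δ w q l).length ≤ D * l.length := by
    intro l
    induction l with
    | nil => simp [outputs]
    | cons s l ih =>
      intro q
      have := ih (δ q s)
      have := hD q s
      simp [outputs, mul_add]; omega
  -- On an input of length `n`, the scan takes `2n + 1` steps, the final output one, and the move
  -- back at most `2(Dn + E) + 1`.
  refine ⟨transducerMachine q₀ δ w fin, Polynomial.C (2 + 2 * D) * .X + .C (2 * E + 3), fun a => ?_⟩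
  have h1 := exec_scan (Γ := AuxΓ A Empty B B) (a := .inp) (b := .tmp) (by simp) δ w q₀
    (aux (ea a) [] [] [])
  have h2 := exec_move (Γ := AuxΓ A Empty B B) (a := .tmp) (b := .out) (by simp) some q₀
    (aux [] [] (eb (f a)).reverse [])
  simp only [aux_inp, aux_tmp, update_aux_inp, update_aux_tmp, List.append_nil] at h1
  simp only [aux_tmp, aux_out, update_aux_tmp, update_aux_out, List.append_nil,
    List.filterMap_some, List.reverse_reverse] at h2
  have h3 := h1.seq ((exec_op (q := pushList .tmp (fun v => fin v.1)
    (.load (fun v => (q₀, v.2)) .halt)) (v' := (q₀, noRegs))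
    (S' := aux [] [] (eb (f a)).reverse []) (by
      rw [stepAux_pushList]; simp [TM2.stepAux, h])).seq h2)
  have e1 : (transducerMachine q₀ δ w fin).input (ea a) = aux (ea a) [] [] [] :=
    have : update (noStk : ∀ j, List (AuxΓ A Empty B B j)) .inp ((ea a).map id) =
        aux (ea a) [] [] [] := by rw [noStk_eq_aux]; simp
    this
  have e2 : (transducerMachine q₀ δ w fin).output (eb (f a)) = aux [] [] [] (eb (f a)) :=
    have : update (noStk : ∀ j, List (AuxΓ A Empty B B j)) .out ((eb (f a)).map id) =
        aux [] [] [] (eb (f a)) := by rw [noStk_eq_aux]; simp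
    this
  rw [Machine.Outputs, e1, e2]
  refine h3.mono ?_
  have := hout (ea a) q₀
  have := hE ((ea a).foldl δ q₀)
  simp only [h, List.length_reverse, List.length_append, Polynomial.eval_add, Polynomial.eval_mul,
    Polynomial.eval_C, Polynomial.eval_X]
  nlinarith

/-- The program that runs two machines one after the other. -/
noncomputable def compMachine [Fintype B] (M₁ : Machine A B) (M₂ : Machine B C) : Machine A C where
  K := (M₁.K ⊕ M₂.K) ⊕ Aux
  Γ := sumΓ (sumΓ M₁.Γ M₂.Γ) (AuxΓ Empty Empty B Empty)
  k₀ := .inl (.inl M₁.k₀)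
  k₁ := .inl (.inr M₂.k₁)
  i := M₁.i
  o := M₂.o
  σ := (M₁.σ × M₂.σ) × Regs (sumΓ (sumΓ M₁.Γ M₂.Γ) (AuxΓ Empty Empty B Empty))
  init := ((M₁.init, M₂.init), noRegs)
  R := ((M₁.R.onLeft M₂.Γ M₂.σ).onLeft _ _).seq ((move (.inl (.inl M₁.k₁)) (.inr .tmp)
    fun s => some (M₁.o s)).seq ((move (.inr .tmp) (.inl (.inr M₂.k₀))
      fun s => some (M₂.i.symm s)).seq ((M₂.R.onRight M₁.Γ M₁.σ).onLeft _ _)))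
  det := (M₁.det.onLeft.onLeft).seq ((isDet_scan _ _ _ _).seq ((isDet_scan _ _ _ _).seq
    M₂.det.onRight.onLeft))

theorem comp [Fintype B] {g : β → γ} {f : α → β} (hg : PT eb ec g) (hf : PT ea eb f) :
    PT ea ec fun a => g (f a) := by
  obtain ⟨M₁, T₁, h₁⟩ := hf
  obtain ⟨M₂, T₂, h₂⟩ := hg
  obtain ⟨D, hD⟩ := M₁.exists_length_output_le
  have hD' := fun a => hD _ _ _ (h₁ a)
  -- `L` bounds the length of the intermediate string, hence the cost of moving it and the running
  -- time of `M₂` on it.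
  let L : Polynomial ℕ := .X + .C D * T₁
  refine ⟨compMachine M₁ M₂, T₁ + 2 * L + 1 + 2 * L + 1 + T₂.comp L, fun a => ?_⟩
  have e0 : (noStk : ∀ k, List (sumΓ (sumΓ M₁.Γ M₂.Γ) (AuxΓ Empty Empty B Empty) k)) =
      both (both noStk noStk) (aux [] [] [] []) := by
    simp only [noStk_eq_both, ← noStk_eq_aux]
  have e1 : (compMachine M₁ M₂).input (ea a) =
      both (both (M₁.input (ea a)) noStk) (aux [] [] [] []) :=
    have : update (noStk : ∀ k, List (sumΓ (sumΓ M₁.Γ M₂.Γ) (AuxΓ Empty Empty B Empty) k))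
        (.inl (.inl M₁.k₀)) ((ea a).map M₁.i.symm) = _ := by rw [e0]; simp; rfl
    this
  have e2 : (compMachine M₁ M₂).output (ec (g (f a))) =
      both (both noStk (M₂.output (ec (g (f a))))) (aux [] [] [] []) :=
    have : update (noStk : ∀ k, List (sumΓ (sumΓ M₁.Γ M₂.Γ) (AuxΓ Empty Empty B Empty) k))
        (.inl (.inr M₂.k₁)) ((ec (g (f a))).map M₂.o.symm) = _ := by rw [e0]; simp; rfl
    this
  have r1 := (Exec.onLeft (h₁ a) M₂.init (noStk (Γ := M₂.Γ))).onLeft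
    (noRegs : Regs (sumΓ (sumΓ M₁.Γ M₂.Γ) (AuxΓ Empty Empty B Empty)))
    (aux [] [] [] [] : ∀ j, List (AuxΓ Empty Empty B Empty j))
  have r2 := exec_move (Γ := sumΓ (sumΓ M₁.Γ M₂.Γ) (AuxΓ Empty Empty B Empty))
    (a := .inl (.inl M₁.k₁)) (b := .inr .tmp) (by simp) (fun s => some (M₁.o s))
    (M₁.init, M₂.init) (both (both (M₁.output (eb (f a))) noStk) (aux [] [] [] []))
  have r3 := exec_move (Γ := sumΓ (sumΓ M₁.Γ M₂.Γ) (AuxΓ Empty Empty B Empty))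
    (a := .inr .tmp) (b := .inl (.inr M₂.k₀)) (by simp) (fun s => some (M₂.i.symm s))
    (M₁.init, M₂.init) (both (both noStk noStk) (aux [] [] (eb (f a)).reverse []))
  have r4 := (Exec.onRight (h₂ (f a)) M₁.init (noStk (Γ := M₁.Γ))).onLeft
    (noRegs : Regs (sumΓ (sumΓ M₁.Γ M₂.Γ) (AuxΓ Empty Empty B Empty)))
    (aux [] [] [] [] : ∀ j, List (AuxΓ Empty Empty B Empty j))
  simp [Machine.output] at r2
  simp [List.filterMap_eq_map'] at r3
  rw [Machine.Outputs, e1, e2]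
  refine (r1.seq (r2.seq (r3.seq r4))).mono ?_
  have := eval_mono T₂ (hD' a)
  simp [L] at this ⊢
  have := hD' a
  omega

end PT

end ClusterComputing

namespace ClusterComputing

set_option linter.unusedSectionVars false

open Turing Function

/-- The encoding of pairs: the components are written one after the other, each symbol being marked
with the component that it belongs to. -/
def prodEnc {α β A B : Type} (ea : α → List A) (eb : β → List B) (p : α × β) : List (A ⊕ B) :=
  (ea p.1).map .inl ++ (eb p.2).map .inr

theorem length_prodEnc {α β A B : Type} (ea : α → List A) (eb : β → List B) (p : α × β) :
    (prodEnc ea eb p).length = (ea p.1).length + (eb p.2).length := by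
  simp [prodEnc]

theorem filterMap_getLeft?_prodEnc {α β A B : Type} (ea : α → List A) (eb : β → List B)
    (p : α × β) : (prodEnc ea eb p).filterMap Sum.getLeft? = ea p.1 := by
  simp [prodEnc, List.filterMap_append, List.filterMap_map, Function.comp_def]

theorem filterMap_getRight?_prodEnc {α β A B : Type} (ea : α → List A) (eb : β → List B)
    (p : α × β) : (prodEnc ea eb p).filterMap Sum.getRight? = eb p.2 := by
  simp [prodEnc, List.filterMap_append, List.filterMap_map, Function.comp_def]

theorem filterMap_getLeft?_map {A B C : Type} (g : A → C) (l : List (A ⊕ B)) :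
    l.filterMap (fun s => s.getLeft?.map g) = (l.filterMap Sum.getLeft?).map g := by
  rw [List.map_filterMap]

namespace PT

open Routine

variable {α β γ A B C : Type} {ea : α → List A} {eb : β → List B} {ec : γ → List C}

/-- The alphabets of the machine that runs two machines on the same input. -/
abbrev pairΓ (M₁ : Machine A B) (M₂ : Machine A C) : (M₁.K ⊕ M₂.K) ⊕ Aux → Type :=
  sumΓ (sumΓ M₁.Γ M₂.Γ) (AuxΓ A Empty (A ⊕ (B ⊕ C)) (B ⊕ C))

/-- The machine that runs two machines on the same input. -/
noncomputable def pairMachine [Fintype A] [Fintype B] [Fintype C] (M₁ : Machine A B)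
    (M₂ : Machine A C) : Machine A (B ⊕ C) where
  K := (M₁.K ⊕ M₂.K) ⊕ Aux
  Γ := pairΓ M₁ M₂
  k₀ := .inr .inp
  k₁ := .inr .out
  i := .refl A
  o := .refl (B ⊕ C)
  σ := (M₁.σ × M₂.σ) × Regs (pairΓ M₁ M₂)
  init := ((M₁.init, M₂.init), noRegs)
  R := (move (.inr .inp) (.inr .tmp) fun s => some (.inl s)).seq
    ((move₂ (.inr .tmp) (.inl (.inl M₁.k₀)) (.inl (.inr M₂.k₀))
      (fun s => s.getLeft?.map M₁.i.symm) (fun s => s.getLeft?.map M₂.i.symm)).seq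
    (((M₁.R.onLeft M₂.Γ M₂.σ).onLeft _ _).seq (((M₂.R.onRight M₁.Γ M₁.σ).onLeft _ _).seq
    ((move (.inl (.inr M₂.k₁)) (.inr .tmp) fun s => some (.inr (.inr (M₂.o s)))).seq
    ((move (.inr .tmp) (.inr .out) Sum.getRight?).seq
    ((move (.inl (.inl M₁.k₁)) (.inr .tmp) fun s => some (.inr (.inl (M₁.o s)))).seq
    (move (.inr .tmp) (.inr .out) Sum.getRight?)))))))
  det := (isDet_scan _ _ _ _).seq ((isDet_move₂ _ _ _ _ _).seq (M₁.det.onLeft.onLeft.seq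
    (M₂.det.onRight.onLeft.seq ((isDet_scan _ _ _ _).seq ((isDet_scan _ _ _ _).seq
    ((isDet_scan _ _ _ _).seq (isDet_scan _ _ _ _)))))))

/-- The two machines own disjoint stacks, so both copies of the input can be loaded before either
runs. The result of `M₂` goes to `.out` first, because what is pushed last is read first. -/
theorem pair [Fintype A] [Fintype B] [Fintype C] {f : α → β} {g : α → γ} (hf : PT ea eb f)
    (hg : PT ea ec g) : PT ea (prodEnc eb ec) fun a => (f a, g a) := by
  obtain ⟨M₁, T₁, h₁⟩ := hf
  obtain ⟨M₂, T₂, h₂⟩ := hg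
  obtain ⟨D₁, hD₁⟩ := M₁.exists_length_output_le
  obtain ⟨D₂, hD₂⟩ := M₂.exists_length_output_le
  have hD₁' := fun a => hD₁ _ _ _ (h₁ a)
  have hD₂' := fun a => hD₂ _ _ _ (h₂ a)
  refine ⟨pairMachine M₁ M₂, 4 * .X + T₁ + T₂ + 4 * (.X + .C D₁ * T₁) + 4 * (.X + .C D₂ * T₂) + 6,
    fun a => ?_⟩
  have e0 : (noStk : ∀ k, List (pairΓ M₁ M₂ k)) = both (both noStk noStk) (aux [] [] [] []) := by
    simp only [noStk_eq_both, ← noStk_eq_aux]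
  have e1 : (pairMachine M₁ M₂).input (ea a) = both (both noStk noStk) (aux (ea a) [] [] []) :=
    have : update (noStk : ∀ k, List (pairΓ M₁ M₂ k)) (.inr .inp) ((ea a).map id) = _ := by
      rw [e0]; simp
    this
  have e2 : (pairMachine M₁ M₂).output (prodEnc eb ec (f a, g a)) =
      both (both noStk noStk) (aux [] [] [] (prodEnc eb ec (f a, g a))) :=
    have : update (noStk : ∀ k, List (pairΓ M₁ M₂ k)) (.inr .out)
        ((prodEnc eb ec (f a, g a)).map id) = _ := by
      rw [e0]; simp
    this
  have r1 := exec_move (Γ := pairΓ M₁ M₂) (a := .inr .inp) (b := .inr .tmp) (by simp)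
    (fun s => some (.inl s)) (M₁.init, M₂.init)
    (both (both noStk noStk) (aux (ea a) [] [] []))
  have r2 := exec_move₂ (Γ := pairΓ M₁ M₂) (a := .inr .tmp) (b := .inl (.inl M₁.k₀))
    (c := .inl (.inr M₂.k₀)) (by simp) (by simp) (by simp)
    (fun s => s.getLeft?.map M₁.i.symm) (fun s => s.getLeft?.map M₂.i.symm) (M₁.init, M₂.init)
    (both (both noStk noStk) (aux [] [] ((ea a).map Sum.inl).reverse []))
  have r3 := (Exec.onLeft (h₁ a) M₂.init (M₂.input (ea a))).onLeft
    (noRegs : Regs (pairΓ M₁ M₂))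
    (aux [] [] [] [] : ∀ j, List (AuxΓ A Empty (A ⊕ (B ⊕ C)) (B ⊕ C) j))
  have r4 := (Exec.onRight (h₂ a) M₁.init (M₁.output (eb (f a)))).onLeft
    (noRegs : Regs (pairΓ M₁ M₂))
    (aux [] [] [] [] : ∀ j, List (AuxΓ A Empty (A ⊕ (B ⊕ C)) (B ⊕ C) j))
  have r5 := exec_move (Γ := pairΓ M₁ M₂) (a := .inl (.inr M₂.k₁)) (b := .inr .tmp) (by simp)
    (fun s => some (.inr (.inr (M₂.o s)))) (M₁.init, M₂.init)
    (both (both (M₁.output (eb (f a))) (M₂.output (ec (g a)))) (aux [] [] [] []))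
  have r6 := exec_move (Γ := pairΓ M₁ M₂) (a := .inr .tmp) (b := .inr .out) (by simp)
    Sum.getRight? (M₁.init, M₂.init)
    (both (both (M₁.output (eb (f a))) noStk)
      (aux [] [] ((ec (g a)).map fun s => .inr (.inr s)).reverse []))
  have r7 := exec_move (Γ := pairΓ M₁ M₂) (a := .inl (.inl M₁.k₁)) (b := .inr .tmp) (by simp)
    (fun s => some (.inr (.inl (M₁.o s)))) (M₁.init, M₂.init)
    (both (both (M₁.output (eb (f a))) noStk) (aux [] [] [] ((ec (g a)).map .inr)))
  have r8 := exec_move (Γ := pairΓ M₁ M₂) (a := .inr .tmp) (b := .inr .out) (by simp)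
    Sum.getRight? (M₁.init, M₂.init) (both (both noStk noStk)
      (aux [] [] ((eb (f a)).map fun s => .inr (.inl s)).reverse ((ec (g a)).map .inr)))
  simp [List.filterMap_eq_map'] at r1
  simp [List.filterMap_map, Function.comp_def, List.filterMap_eq_map'] at r2
  simp [Machine.output, List.filterMap_map, List.filterMap_eq_map'] at r5
  simp [Function.comp_def, List.filterMap_map, List.filterMap_eq_map'] at r6
  simp [Machine.output, List.filterMap_map, List.filterMap_eq_map'] at r7
  simp [Function.comp_def, List.filterMap_map, List.filterMap_eq_map'] at r8
  rw [Machine.Outputs, e1, e2]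
  refine (r1.seq (r2.seq (r3.seq (r4.seq (r5.seq (r6.seq (r7.seq r8))))))).mono ?_
  have h1 := hD₁' a
  have h2 := hD₂' a
  simp at h1 h2 ⊢
  omega

/-- The alphabets of the machine that iterates a machine. -/
abbrev iterΓ (E : Type) (M : Machine A A) : M.K ⊕ Aux → Type :=
  sumΓ M.Γ (AuxΓ (E ⊕ A) E A A)

/-- The loop that iterates a machine. -/
noncomputable abbrev iterLoop [Fintype A] (E : Type) [Fintype E] (M : Machine A A) :
    Routine (iterΓ E M) (M.σ × Regs (iterΓ E M)) :=
  each (.inr .cnt) (clearRegs.seq ((M.R.onLeft _ _).seq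
    ((move (.inl M.k₁) (.inr .tmp) fun s => some (M.o s)).seq
      (move (.inr .tmp) (.inl M.k₀) fun s => some (M.i.symm s)))))

/-- The machine that iterates a machine. -/
noncomputable def iterMachine [Fintype A] (E : Type) [Fintype E] (M : Machine A A) :
    Machine (E ⊕ A) A where
  K := M.K ⊕ Aux
  Γ := iterΓ E M
  k₀ := .inr .inp
  k₁ := .inr .out
  i := .refl (E ⊕ A)
  o := .refl A
  σ := M.σ × Regs (iterΓ E M)
  init := (M.init, noRegs)
  R := (move₂ (.inr .inp) (.inr .cnt) (.inr .tmp) Sum.getLeft? Sum.getRight?).seq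
    ((move (.inr .tmp) (.inl M.k₀) fun s => some (M.i.symm s)).seq
    ((iterLoop E M).seq ((move (.inl M.k₀) (.inr .tmp) fun s => some (M.i s)).seq
    (move (.inr .tmp) (.inr .out) some))))
  det := (isDet_move₂ _ _ _ _ _).seq ((isDet_scan _ _ _ _).seq ((((isDet_op _).seq
    (M.det.onLeft.seq ((isDet_scan _ _ _ _).seq (isDet_scan _ _ _ _)))).forPop _ _ _).seq
    ((isDet_scan _ _ _ _).seq (isDet_scan _ _ _ _))))

/-- A round costs one pop, one clearing of the registers (the moves start from empty ones), a run of
`M`, and two moves of at most `2b + 1` steps: together at most `T(b) + 4b + 4`. -/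
theorem exec_iterLoop [Fintype A] {E : Type} [Fintype E] (M : Machine A A) {T : Polynomial ℕ}
    {f : α → α} (h : ∀ a, M.Outputs (ea a) (ea (f a)) (T.eval (ea a).length)) (b : ℕ) (l : List E)
    (a : α) (hb : ∀ i ≤ l.length, (ea (f^[i] a)).length ≤ b) :
    (iterLoop E M).Exec (M.init, noRegs) (both (M.input (ea a)) (aux [] l [] [])) []
      (l.length * (T.eval b + 4 * b + 4) + 1) (M.init, noRegs)
      (both (M.input (ea (f^[l.length] a))) (aux [] [] [] [])) := by
  induction l generalizing a with
  | nil => exact (exec_each_nil (by simp)).mono (by simp)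
  | cons s l ih =>
    have ih' := ih (f a) (fun i hi => hb (i + 1) (by simpa using hi))
    have r1 := exec_clearRegs M.init (update (noRegs : Regs (iterΓ E M)) (.inr .cnt) (some s))
      (both (M.input (ea a)) (aux [] l [] []))
    have r2 := Exec.onLeft (h a) (noRegs : Regs (iterΓ E M))
      (aux [] l [] [] : ∀ j, List (AuxΓ (E ⊕ A) E A A j))
    have r3 := exec_move (Γ := iterΓ E M) (a := .inl M.k₁) (b := .inr .tmp) (by simp)
      (fun s => some (M.o s)) M.init (both (M.output (ea (f a))) (aux [] l [] []))
    have r4 := exec_move (Γ := iterΓ E M) (a := .inr .tmp) (b := .inl M.k₀) (by simp)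
      (fun s => some (M.i.symm s)) M.init (both noStk (aux [] l (ea (f a)).reverse []))
    simp [Machine.output] at r3
    simp [List.filterMap_eq_map'] at r4
    have r5 := exec_each_cons (r := M.init) (S := both (M.input (ea a)) (aux [] (s :: l) [] []))
      (a := .inr .cnt) (s := s) (l := l) rfl
      (by simpa [Machine.input] using r1.seq (r2.seq (r3.seq r4))) ih'
    refine r5.mono ?_
    have h1 : (ea (f a)).length ≤ b := hb 1 (by simp)
    have h2 := eval_mono T (hb 0 (by simp))
    simp at h2 ⊢
    rw [add_mul]
    omega

/-- The counter is unary. The bound `P` on all intermediate lengths is essential: a map that doubles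
its argument would leave polynomial time when iterated. -/
theorem iterate [Fintype A] {E : Type} [Fintype E] {f : α → α} (hf : PT ea ea f)
    (P : Polynomial ℕ) (hP : ∀ (l : List E) (a : α), ∀ i ≤ l.length,
      (ea (f^[i] a)).length ≤ P.eval (l.length + (ea a).length)) :
    PT (prodEnc id ea) ea fun p : List E × α => f^[p.1.length] p.2 := by
  obtain ⟨M, T, h⟩ := hf
  refine ⟨iterMachine E M, 2 * .X + 2 * .X + .X * (T.comp P + 4 * P + 4) + 4 * P + 5,
    fun p => ?_⟩
  obtain ⟨l, a⟩ := p
  set b := P.eval (l.length + (ea a).length) with hb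
  have e0 : (noStk : ∀ k, List (iterΓ E M k)) = both noStk (aux [] [] [] []) := by
    simp only [noStk_eq_both, ← noStk_eq_aux]
  have e1 : (iterMachine E M).input (prodEnc id ea (l, a)) =
      both (Γ := M.Γ) (Δ := AuxΓ (E ⊕ A) E A A) noStk (aux (prodEnc id ea (l, a)) [] [] []) :=
    have : update (noStk : ∀ k, List (iterΓ E M k)) (.inr .inp)
        ((prodEnc id ea (l, a)).map id) = _ := by
      rw [e0]; simp
    this
  have e2 : (iterMachine E M).output (ea (f^[l.length] a)) =
      both (Γ := M.Γ) (Δ := AuxΓ (E ⊕ A) E A A) noStk (aux [] [] [] (ea (f^[l.length] a))) :=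
    have : update (noStk : ∀ k, List (iterΓ E M k)) (.inr .out)
        ((ea (f^[l.length] a)).map id) = _ := by
      rw [e0]; simp
    this
  have r1 := exec_move₂ (Γ := iterΓ E M) (a := .inr .inp) (b := .inr .cnt) (c := .inr .tmp)
    (by simp) (by simp) (by simp) Sum.getLeft? Sum.getRight? M.init
    (both noStk (aux (prodEnc id ea (l, a)) [] [] []))
  have r2 := exec_move (Γ := iterΓ E M) (a := .inr .tmp) (b := .inl M.k₀) (by simp)
    (fun s => some (M.i.symm s)) M.init (both noStk (aux [] l.reverse (ea a).reverse []))
  have r3 := exec_iterLoop M h b l.reverse a (by simpa using hP l a)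
  have r4 := exec_move (Γ := iterΓ E M) (a := .inl M.k₀) (b := .inr .tmp) (by simp)
    (fun s => some (M.i s)) M.init (both (M.input (ea (f^[l.length] a))) (aux [] [] [] []))
  have r5 := exec_move (Γ := iterΓ E M) (a := .inr .tmp) (b := .inr .out) (by simp)
    some M.init (both noStk (aux [] [] (ea (f^[l.length] a)).reverse []))
  simp [filterMap_getLeft?_prodEnc, filterMap_getRight?_prodEnc] at r1
  simp [List.filterMap_eq_map'] at r2
  simp at r3
  simp [Machine.input] at r4
  simp at r5
  rw [Machine.Outputs, e1, e2]
  refine (r1.seq (r2.seq (r3.seq (r4.seq r5)))).mono ?_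
  have h1 := hP l a _ le_rfl
  have h2 : l.length * (T.eval b + 4 * b + 4) ≤
      (l.length + (ea a).length) * (T.eval b + 4 * b + 4) := Nat.mul_le_mul_right _ (by omega)
  simp [length_prodEnc, ← hb] at h1 ⊢
  omega

end PT

end ClusterComputing

namespace ClusterComputing

set_option linter.unusedSectionVars false

open Turing Function

/-! ### Comparison with `Turing.TM2ComputableInPolyTime` -/

section

variable {K : Type} [DecidableEq K] {Γ : K → Type} {Λ σ : Type}

theorem evals_of_steps {P : Λ → Instr Γ Λ σ} {m : Λ → TM2.Stmt Γ Λ σ} (hm : ∀ l, P l = .det (m l))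
    {c c' : TM2.Cfg Γ Λ σ} {y n} (h : Steps P c y n c') :
    (flip bind (TM2.step m))^[n] (some c) = some c' := by
  induction h with
  | refl => rfl
  | @step l v S y n c' b h ih =>
    rw [hm] at ih
    exact ih

theorem steps_of_evals {m : Λ → TM2.Stmt Γ Λ σ} {c c' : TM2.Cfg Γ Λ σ} {n}
    (h : (flip bind (TM2.step m))^[n] (some c) = some c') :
    Steps (fun l => .det (m l)) c [] n c' := by
  induction n generalizing c with
  | zero => cases h; exact .refl _
  | succ n ih =>
    obtain ⟨l, v, S⟩ := c
    cases l with
    | none =>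
      have : ∀ n, (flip bind (TM2.step m))^[n] none = none := fun n => by
        induction n with
        | zero => rfl
        | succ n ih => exact ih
      exact absurd ((this n).symm.trans h) (by simp)
    | some l =>
      have := Steps.step (P := fun l => .det (m l)) (l := l) (v := v) (S := S) false (ih h)
      simpa [Instr.bits] using this

/-- The symbols that a statement can push. -/
def pushSet : TM2.Stmt Γ Λ σ → Set (Σ k, Γ k)
  | .push k f q => Set.range (fun v => ⟨k, f v⟩) ∪ pushSet q
  | .peek _ _ q => pushSet q
  | .pop _ _ q => pushSet q
  | .load _ q => pushSet q
  | .branch _ q₁ q₂ => pushSet q₁ ∪ pushSet q₂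
  | .goto _ => ∅
  | .halt => ∅

theorem finite_pushSet [Finite σ] (q : TM2.Stmt Γ Λ σ) : (pushSet q).Finite := by
  induction q with
  | push k f q ih => exact (Set.finite_range _).union ih
  | branch _ _ _ ih₁ ih₂ => exact ih₁.union ih₂
  | goto => exact Set.finite_empty
  | halt => exact Set.finite_empty
  | _ => assumption

/-- The restriction of the alphabets to a set of symbols. -/
abbrev SubΓ (F : Set (Σ k, Γ k)) (k : K) : Type := {g : Γ k // ⟨k, g⟩ ∈ F}

/-- The restriction of a statement to a set of symbols that contains all symbols it pushes. -/
def restrict (F : Set (Σ k, Γ k)) : (q : TM2.Stmt Γ Λ σ) → pushSet q ⊆ F →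
    TM2.Stmt (SubΓ F) Λ σ
  | .push k f q, h => .push k (fun v => ⟨f v, h (.inl ⟨v, rfl⟩)⟩)
      (restrict F q fun _ hs => h (.inr hs))
  | .peek k f q, h => .peek k (fun v o => f v (o.map Subtype.val)) (restrict F q h)
  | .pop k f q, h => .pop k (fun v o => f v (o.map Subtype.val)) (restrict F q h)
  | .load f q, h => .load f (restrict F q h)
  | .branch f q₁ q₂, h => .branch f (restrict F q₁ fun _ hs => h (.inl hs))
      (restrict F q₂ fun _ hs => h (.inr hs))
  | .goto f, _ => .goto f
  | .halt, _ => .halt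

/-- The inclusion of stacks over restricted alphabets. -/
def incl {F : Set (Σ k, Γ k)} (S : ∀ k, List (SubΓ F k)) (k : K) : List (Γ k) :=
  (S k).map Subtype.val

theorem update_incl {F : Set (Σ k, Γ k)} (S : ∀ k, List (SubΓ F k)) (k : K)
    (l : List (SubΓ F k)) : update (incl S) k (l.map Subtype.val) = incl (update S k l) := by
  funext j
  rcases eq_or_ne j k with rfl | h
  · simp [incl]
  · simp [incl, h]

theorem stepAux_restrict {F : Set (Σ k, Γ k)} (q : TM2.Stmt Γ Λ σ) (h : pushSet q ⊆ F) (v : σ)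
    (S : ∀ k, List (SubΓ F k)) :
    TM2.stepAux q v (incl S) = ⟨(TM2.stepAux (restrict F q h) v S).l,
      (TM2.stepAux (restrict F q h) v S).var, incl (TM2.stepAux (restrict F q h) v S).stk⟩ := by
  induction q generalizing v S with
  | push k f q ih =>
    refine Eq.trans ?_ (ih (fun _ hs => h (.inr hs)) v
      (update S k (⟨f v, h (.inl ⟨v, rfl⟩)⟩ :: S k)))
    rw [TM2.stepAux, ← update_incl]
    rfl
  | peek k f q ih =>
    refine Eq.trans ?_ (ih h (f v ((S k).head?.map Subtype.val)) S)
    rw [TM2.stepAux, ← List.head?_map]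
    rfl
  | pop k f q ih =>
    refine Eq.trans ?_ (ih h (f v ((S k).head?.map Subtype.val)) (update S k (S k).tail))
    rw [TM2.stepAux, ← update_incl, List.map_tail, ← List.head?_map]
    rfl
  | load f q ih => exact ih _ _ _
  | branch f q₁ q₂ ih₁ ih₂ =>
    rw [restrict, TM2.stepAux, TM2.stepAux]
    cases f v
    · exact ih₂ _ _ _
    · exact ih₁ _ _ _
  | goto f => rfl
  | halt => rfl

theorem Steps.restrict {F : Set (Σ k, Γ k)} {m : Λ → TM2.Stmt Γ Λ σ} (hF : ∀ l, pushSet (m l) ⊆ F)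
    {c c' : TM2.Cfg Γ Λ σ} {y n} (h : Steps (fun l => .det (m l)) c y n c')
    {S : ∀ k, List (SubΓ F k)} (hS : c.stk = incl S) :
    ∃ S', c'.stk = incl S' ∧ Steps (fun l => .det (ClusterComputing.restrict F (m l) (hF l)))
      ⟨c.l, c.var, S⟩ [] n ⟨c'.l, c'.var, S'⟩ := by
  induction h generalizing S with
  | refl => exact ⟨S, hS, .refl _⟩
  | @step l v T y n c' b h ih =>
    dsimp only at hS
    subst hS
    have e := stepAux_restrict (m l) (hF l) v S
    obtain ⟨S', h1, h2⟩ := ih (S := (TM2.stepAux (ClusterComputing.restrict F (m l) (hF l)) v S).stk)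
      (by simp only [Instr.stmt, e])
    simp only [Instr.stmt, e] at h2
    refine ⟨S', h1, ?_⟩
    have := Steps.step (P := fun l => .det (ClusterComputing.restrict F (m l) (hF l))) (l := l)
      (v := v) (S := S) b h2
    simpa [Instr.bits] using this

end

theorem initList_eq (tm : FinTM2) (s : List (tm.Γ tm.k₀)) :
    initList tm s = ⟨some tm.main, tm.initialState, update noStk tm.k₀ s⟩ := by
  unfold initList
  congr 1
  funext k
  by_cases h : k = tm.k₀
  · subst h; simp
  · simp [h]

theorem haltList_eq (tm : FinTM2) (s : List (tm.Γ tm.k₁)) :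
    haltList tm s = ⟨none, tm.initialState, update noStk tm.k₁ s⟩ := by
  unfold haltList
  congr 1
  funext k
  by_cases h : k = tm.k₁
  · subst h; simp
  · simp [h]

variable {α β A B : Type} {ea : α → List A} {eb : β → List B} {f : α → β}

theorem PT.tm2 (h : PT ea eb f) : Nonempty (TM2ComputableInPolyTime ea eb f) := by
  obtain ⟨M, T, h⟩ := h
  let tm : FinTM2 := { M with
    Λ := M.R.Λ, main := M.R.main, initialState := M.init, m := fun l => (M.R.code l).stmt false }
  have hm : ∀ l, M.R.code l = .det (tm.m l) := fun l => by
    obtain ⟨q, hq⟩ := M.det l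
    simp [tm, hq, Instr.stmt]
  refine ⟨⟨⟨tm, M.i, M.o⟩, T, fun a => Classical.choice ?_⟩⟩
  obtain ⟨n, hn, h⟩ := h a
  refine ⟨⟨⟨n, ?_⟩, hn⟩⟩
  rw [Option.map_some, initList_eq, haltList_eq]
  exact evals_of_steps (m := tm.m) hm h

/-- `FinTM2` admits infinite alphabets on the work stacks, `Machine` does not. Finitely many
statements over finitely many states push only finitely many symbols, so the alphabets can be cut
down to these. -/
theorem PT.of_tm2 [Finite B] (h : Nonempty (TM2ComputableInPolyTime ea eb f)) : PT ea eb f := by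
  classical
  obtain ⟨⟨⟨tm, i, o⟩, T, h⟩⟩ := h
  dsimp only at h
  have : Fintype tm.K := tm.kFin
  have : Fintype tm.Λ := tm.ΛFin
  have : Fintype tm.σ := tm.σFin
  have : Fintype (tm.Γ tm.k₀) := tm.Γk₀Fin
  have : Finite (tm.Γ tm.k₁) := Finite.of_equiv _ o.symm
  -- All symbols of the input and output stacks are kept, so that these alphabets remain in
  -- bijection with `A` and `B`.
  let F : Set (Σ k, tm.Γ k) := (⋃ l, pushSet (tm.m l)) ∪
    (Set.range (Sigma.mk tm.k₀) ∪ Set.range (Sigma.mk tm.k₁))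
  have hF : F.Finite := (Set.finite_iUnion fun l => finite_pushSet _).union
    ((Set.finite_range _).union (Set.finite_range _))
  have hm : ∀ l, pushSet (tm.m l) ⊆ F := fun l _ hs => .inl (Set.mem_iUnion.2 ⟨l, hs⟩)
  have : Finite F := hF
  have : ∀ k, Fintype (SubΓ F k) := fun k => by
    have : Finite (SubΓ F k) := Finite.of_injective (fun g => (⟨⟨k, g.1⟩, g.2⟩ : F))
      fun g g' hg => by
        have := congrArg Subtype.val hg
        simp only [Sigma.mk.injEq, heq_eq_eq, true_and] at this
        exact Subtype.ext this
    exact Fintype.ofFinite _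
  have h₀ : ∀ g : tm.Γ tm.k₀, (⟨tm.k₀, g⟩ : Σ k, tm.Γ k) ∈ F := fun g => .inr (.inl ⟨g, rfl⟩)
  have h₁ : ∀ g : tm.Γ tm.k₁, (⟨tm.k₁, g⟩ : Σ k, tm.Γ k) ∈ F := fun g => .inr (.inr ⟨g, rfl⟩)
  let M : Machine A B := {
    K := tm.K
    Γ := SubΓ F
    k₀ := tm.k₀
    k₁ := tm.k₁
    i := (Equiv.subtypeUnivEquiv h₀).trans i
    o := (Equiv.subtypeUnivEquiv h₁).trans o
    σ := tm.σ
    init := tm.initialState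
    R := ⟨tm.Λ, tm.main, fun l => .det (restrict F (tm.m l) (hm l))⟩
    det := fun l => ⟨_, rfl⟩ }
  refine ⟨M, T, fun a => ?_⟩
  obtain ⟨⟨n, he⟩, hn⟩ := h a
  rw [Option.map_some, initList_eq, haltList_eq] at he
  have e1 : ∀ l : List A, update noStk tm.k₀ (l.map i.invFun) = incl (F := F) (M.input l) := by
    intro l
    have := update_incl (F := F) noStk tm.k₀ (l.map M.i.symm)
    rw [Machine.input]
    refine Eq.trans ?_ this
    simp only [List.map_map]
    rfl
  have e2 : ∀ l : List B, update noStk tm.k₁ (l.map o.invFun) = incl (F := F) (M.output l) := by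
    intro l
    have := update_incl (F := F) noStk tm.k₁ (l.map M.o.symm)
    rw [Machine.output]
    refine Eq.trans ?_ this
    simp only [List.map_map]
    rfl
  obtain ⟨S', hS', hs⟩ := (steps_of_evals he).restrict hm (e1 _)
  have e3 : S' = M.output (eb (f a)) := by
    have e4 : incl S' = incl (F := F) (M.output (eb (f a))) := hS'.symm.trans (e2 _)
    funext k
    exact List.map_injective_iff.2 Subtype.val_injective (congrFun e4 k)
  rw [e3] at hs
  exact ⟨n, hn, hs⟩

theorem pt_iff_tm2 [Finite B] : PT ea eb f ↔ Nonempty (TM2ComputableInPolyTime ea eb f) :=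
  ⟨PT.tm2, PT.of_tm2⟩

end ClusterComputing

namespace ClusterComputing

set_option linter.unusedSectionVars false

open Turing Function Routine

/-! ### Guessing machines with a deterministic verifier -/

theorem NTM.mem_acc_iff (M : NTM) {x y : List Bool} : y ∈ M.acc x ↔
    ∃ n c, Steps M.prog (M.init x) y n c ∧ c.l = none ∧ M.accepting c.var = true := by
  simp [NTM.acc, M.run_iff_steps]

theorem NTM.mem_paths_iff (M : NTM) {x y : List Bool} : y ∈ M.paths x ↔
    ∃ n c, Steps M.prog (M.init x) y n c ∧ c.l = none := by
  simp [NTM.paths, M.run_iff_steps]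

/-- It suffices to know the computations of a machine along the guesses of a certain length. -/
theorem NTM.of_runs (N : NTM) (L : List Bool → ℕ) (R : List Bool → List Bool → Bool)
    (T : Polynomial ℕ) (h : ∀ x w, w.length = L x → ∃ n ≤ T.eval x.length, ∃ c,
      Steps N.prog (N.init x) w n c ∧ c.l = none ∧ N.accepting c.var = R x w) :
    N.IsPolyTime ∧ ∀ x, N.paths x = {w | w.length = L x} ∧
      N.acc x = {w | w.length = L x ∧ R x w = true} := by
  have key : ∀ x y' n' c', Steps N.prog (N.init x) y' n' c' → n' ≤ T.eval x.length ∧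
      (c'.l = none → y'.length = L x ∧ N.accepting c'.var = R x y') := by
    intro x y' n' c' hs
    -- An arbitrary run is compared with the known halting run along its own guesses, padded with
    -- zeros and cut to the right length. By determinism it is not longer, and it is the same run if
    -- it halts.
    obtain ⟨n, hn, c, hc, hl, ha⟩ := h x ((y' ++ List.replicate (L x) false).take (L x)) (by simp)
    obtain ⟨h1, -, h3⟩ := hc.deterministic hl hs (List.take_append_drop (L x) _)
    refine ⟨h1.trans hn, fun hl' => ?_⟩
    obtain ⟨e1, -, rfl⟩ := h3 hl'
    constructor
    · rw [e1]; simp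
    · rw [ha, ← e1]
  refine ⟨⟨T, fun x y n c hr => (key x y n c (N.run_iff_steps.1 hr)).1⟩, fun x => ⟨?_, ?_⟩⟩
  · ext w
    rw [NTM.mem_paths_iff]
    constructor
    · rintro ⟨n, c, hs, hl⟩
      exact ((key _ _ _ _ hs).2 hl).1
    · intro hw
      obtain ⟨n, -, c, hc, hl, -⟩ := h x w hw
      exact ⟨n, c, hc, hl⟩
  · ext w
    rw [NTM.mem_acc_iff]
    constructor
    · rintro ⟨n, c, hs, hl, ha⟩
      obtain ⟨h1, h2⟩ := (key _ _ _ _ hs).2 hl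
      exact ⟨h1, h2 ▸ ha⟩
    · rintro ⟨hw, hR⟩
      obtain ⟨n, -, c, hc, hl, ha⟩ := h x w hw
      exact ⟨n, c, hc, hl, ha.trans hR⟩

/-- The alphabets of the machine that guesses a string and runs a verifier. -/
abbrev guessΓ (M₁ : Machine Bool Bool) (M₂ : Machine (Bool ⊕ Bool) Bool) :
    (M₁.K ⊕ M₂.K) ⊕ Aux → Type :=
  sumΓ (sumΓ M₁.Γ M₂.Γ) (AuxΓ Bool Bool (Bool ⊕ Bool) Empty)

/-- The loop that guesses a string. -/
noncomputable abbrev guessLoop (M₁ : Machine Bool Bool) (M₂ : Machine (Bool ⊕ Bool) Bool) :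
    Routine (guessΓ M₁ M₂) ((M₁.σ × M₂.σ) × Regs (guessΓ M₁ M₂)) :=
  each (.inl (.inl M₁.k₁)) (choice fun b => .push (.inr .tmp) (fun _ => .inr b) .halt)

/-- The routine that guesses a string and runs a verifier. -/
noncomputable abbrev guessRoutine (M₁ : Machine Bool Bool) (M₂ : Machine (Bool ⊕ Bool) Bool) :
    Routine (guessΓ M₁ M₂) ((M₁.σ × M₂.σ) × Regs (guessΓ M₁ M₂)) :=
  (move (.inr .inp) (.inr .tmp) fun s => some (.inl s)).seq
    ((move₂ (.inr .tmp) (.inl (.inl M₁.k₀)) (.inr .cnt) (fun s => s.getLeft?.map M₁.i.symm)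
      Sum.getLeft?).seq
    (((M₁.R.onLeft M₂.Γ M₂.σ).onLeft _ _).seq
    ((guessLoop M₁ M₂).seq
    ((move (.inr .tmp) (.inl (.inr M₂.k₀)) fun s => some (M₂.i.symm s)).seq
    ((move (.inr .cnt) (.inr .tmp) fun s => some (.inl s)).seq
    ((move (.inr .tmp) (.inl (.inr M₂.k₀)) fun s => some (M₂.i.symm s)).seq
    (((M₂.R.onRight M₁.Γ M₁.σ).onLeft _ _).seq
    (op (.pop (.inl (.inr M₂.k₁)) (fun v o => (v.1, update v.2 (.inl (.inr M₂.k₁)) o))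
      .halt)))))))))

/-- The machine that guesses a string and runs a verifier. -/
noncomputable def guessNTM (M₁ : Machine Bool Bool) (M₂ : Machine (Bool ⊕ Bool) Bool) : NTM where
  K := (M₁.K ⊕ M₂.K) ⊕ Aux
  k₀ := .inr .inp
  Γ := guessΓ M₁ M₂
  inputAlphabet := .refl Bool
  Λ := (guessRoutine M₁ M₂).Λ
  ΛFin := (guessRoutine M₁ M₂).fin
  main := (guessRoutine M₁ M₂).main
  σ := (M₁.σ × M₂.σ) × Regs (guessΓ M₁ M₂)
  initialState := ((M₁.init, M₂.init), noRegs)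
  accepting v := (v.2 (.inl (.inr M₂.k₁))).elim false M₂.o
  prog := (guessRoutine M₁ M₂).code

/-- The output of `M₁` is only a unary counter here: each of its symbols is traded for one guessed
bit. -/
theorem exec_guessLoop (M₁ : Machine Bool Bool) (M₂ : Machine (Bool ⊕ Bool) Bool)
    (r : M₁.σ × M₂.σ) (e : List Bool) (l : List Bool) (d : List (Bool ⊕ Bool)) (w : List Bool)
    (hw : w.length = l.length) :
    (guessLoop M₁ M₂).Exec (r, noRegs) (both (both (M₁.output l) noStk) (aux [] e d [])) w
      (2 * l.length + 1) (r, noRegs)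
      (both (both noStk noStk) (aux [] e ((w.map Sum.inr).reverse ++ d) [])) := by
  induction l generalizing d w with
  | nil =>
    obtain rfl : w = [] := by simpa using hw
    have : M₁.output ([] : List Bool) = noStk := by simp [Machine.output]
    rw [this]
    exact exec_each_nil rfl
  | cons s l ih =>
    obtain _ | ⟨b, w⟩ := w
    · simp at hw
    have h1 := exec_each_cons (Γ := guessΓ M₁ M₂) (r := r)
      (S := both (both (M₁.output (s :: l)) noStk) (aux [] e d []))
      (a := .inl (.inl M₁.k₁)) (s := M₁.o.symm s) (l := l.map M₁.o.symm) (by simp [Machine.output])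
      (exec_choice (q := fun b => .push (.inr .tmp) (fun _ => .inr b) .halt) b
        (v' := (r, update noRegs (.inl (.inl M₁.k₁)) (some (M₁.o.symm s))))
        (S' := both (both (M₁.output l) noStk) (aux [] e (.inr b :: d) []))
        (by simp [TM2.stepAux, Machine.output]))
      (ih (.inr b :: d) w (by simpa using hw))
    simp only [List.singleton_append] at h1
    convert h1.mono _ using 2
    · simp
    · simp; omega

/-- Guess and check. Only the length of `len x` matters. After the guesses all is deterministic, so
the paths are exactly the strings of this length and the accepting ones are the witnesses
themselves: uniqueness and number of witnesses carry over. -/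
theorem exists_ntm {len : List Bool → List Bool} {R : List Bool × List Bool → Bool}
    (hlen : PT id id len) (hR : PT (prodEnc id id) (fun b => [b]) R) :
    ∃ N : NTM, N.IsPolyTime ∧ ∀ x, N.paths x = {w | w.length = (len x).length} ∧
      N.acc x = {w | w.length = (len x).length ∧ R (x, w) = true} := by
  obtain ⟨M₁, T₁, h₁⟩ := hlen
  obtain ⟨M₂, T₂, h₂⟩ := hR
  obtain ⟨D₁, hD₁⟩ := M₁.exists_length_output_le
  have hD₁' := fun a => hD₁ _ _ _ (h₁ a)
  refine ⟨guessNTM M₁ M₂, (guessNTM M₁ M₂).of_runs (fun x => (len x).length)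
    (fun x w => R (x, w)) (8 * .X + T₁ + 4 * (.X + .C D₁ * T₁) + T₂.comp (2 * .X + .C D₁ * T₁) + 9)
      fun x w hw => ?_⟩
  have e0 : (noStk : ∀ k, List (guessΓ M₁ M₂ k)) = both (both noStk noStk) (aux [] [] [] []) := by
    simp only [noStk_eq_both, ← noStk_eq_aux]
  have e1 : update (noStk : ∀ k, List (guessΓ M₁ M₂ k)) (.inr .inp) (x.map id) =
      both (both noStk noStk) (aux x [] [] []) := by rw [e0]; simp
  have r1 := exec_move (Γ := guessΓ M₁ M₂) (a := .inr .inp) (b := .inr .tmp) (by simp)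
    (fun s => some (.inl s)) (M₁.init, M₂.init) (both (both noStk noStk) (aux x [] [] []))
  have r2 := exec_move₂ (Γ := guessΓ M₁ M₂) (a := .inr .tmp) (b := .inl (.inl M₁.k₀))
    (c := .inr .cnt) (by simp) (by simp) (by simp)
    (fun s => s.getLeft?.map M₁.i.symm) Sum.getLeft? (M₁.init, M₂.init)
    (both (both noStk noStk) (aux [] [] (x.map Sum.inl).reverse []))
  have r3 := (Exec.onLeft (h₁ x) M₂.init (noStk (Γ := M₂.Γ))).onLeft
    (noRegs : Regs (guessΓ M₁ M₂))
    (aux [] x [] [] : ∀ j, List (AuxΓ Bool Bool (Bool ⊕ Bool) Empty j))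
  have r4 := exec_guessLoop M₁ M₂ (M₁.init, M₂.init) x (len x) [] w hw
  have r5 := exec_move (Γ := guessΓ M₁ M₂) (a := .inr .tmp) (b := .inl (.inr M₂.k₀)) (by simp)
    (fun s => some (M₂.i.symm s)) (M₁.init, M₂.init)
    (both (both noStk noStk) (aux [] x (w.map Sum.inr).reverse []))
  have r6 := exec_move (Γ := guessΓ M₁ M₂) (a := .inr .cnt) (b := .inr .tmp) (by simp)
    (fun s => some (.inl s)) (M₁.init, M₂.init)
    (both (both noStk (M₂.input (w.map Sum.inr))) (aux [] x [] []))
  have r7 := exec_move (Γ := guessΓ M₁ M₂) (a := .inr .tmp) (b := .inl (.inr M₂.k₀)) (by simp)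
    (fun s => some (M₂.i.symm s)) (M₁.init, M₂.init)
    (both (both noStk (M₂.input (w.map Sum.inr))) (aux [] [] (x.map Sum.inl).reverse []))
  have r8 := (Exec.onRight (h₂ (x, w)) M₁.init (noStk (Γ := M₁.Γ))).onLeft
    (noRegs : Regs (guessΓ M₁ M₂))
    (aux [] [] [] [] : ∀ j, List (AuxΓ Bool Bool (Bool ⊕ Bool) Empty j))
  have r9 := exec_op (Γ := guessΓ M₁ M₂) (σ := (M₁.σ × M₂.σ) × Regs (guessΓ M₁ M₂))
    (q := .pop (Sum.inl (Sum.inr M₂.k₁))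
      (fun v o => (v.1, update v.2 (Sum.inl (Sum.inr M₂.k₁)) o)) .halt)
    (v := ((M₁.init, M₂.init), noRegs))
    (v' := ((M₁.init, M₂.init), update noRegs (Sum.inl (Sum.inr M₂.k₁))
      (some (M₂.o.symm (R (x, w))))))
    (S := both (both noStk (M₂.output [R (x, w)])) (aux [] [] [] []))
    (S' := both (both noStk noStk) (aux [] [] [] [])) (by simp [TM2.stepAux, Machine.output])
  simp [List.filterMap_eq_map'] at r1
  simp [List.filterMap_map, Function.comp_def, List.filterMap_eq_map'] at r2
  simp [List.filterMap_eq_map'] at r5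
  simp [List.filterMap_eq_map'] at r6
  simp [Machine.input, List.filterMap_eq_map', Function.comp_def] at r7
  simp only [List.append_nil] at r4
  have e2 : M₂.input (prodEnc id id (x, w)) = update noStk M₂.k₀
      ((x.map fun s => M₂.i.symm (Sum.inl s)) ++ w.map fun s => M₂.i.symm (Sum.inr s)) := by
    simp [Machine.input, prodEnc, Function.comp_def]
  have e3 : M₂.input (w.map Sum.inr) = update noStk M₂.k₀
      (w.map fun s => M₂.i.symm (Sum.inr s)) := by
    simp [Machine.input, Function.comp_def]
  rw [e2] at r8
  rw [e3] at r6
  obtain ⟨n, hn, hs⟩ := r1.seq (r2.seq (r3.seq (r4.seq (r5.seq (r6.seq (r7.seq (r8.seq r9)))))))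
  have e4 : (guessNTM M₁ M₂).init x = ⟨some (guessRoutine M₁ M₂).main,
      ((M₁.init, M₂.init), noRegs), both (both noStk noStk) (aux x [] [] [])⟩ := by
    rw [← e1]; rfl
  have hs' : Steps (guessNTM M₁ M₂).prog ((guessNTM M₁ M₂).init x) w n ⟨none,
      ((M₁.init, M₂.init), update noRegs (Sum.inl (Sum.inr M₂.k₁))
        (some (M₂.o.symm (R (x, w))))), both (both noStk noStk) (aux [] [] [] [])⟩ := by
    rw [e4]
    simp only [List.nil_append, List.append_nil] at hs
    exact hs
  refine ⟨n, hn.trans ?_, _, hs', rfl, by simp [guessNTM]⟩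
  have h1 := hD₁' x
  have h2 := eval_mono T₂ (show (prodEnc id id (x, w)).length ≤
    2 * x.length + D₁ * T₁.eval x.length by rw [length_prodEnc]; simp [hw] at h1 ⊢; omega)
  simp [hw] at h1 h2 ⊢
  omega

end ClusterComputing

namespace ClusterComputing

set_option linter.unusedSectionVars false

open Turing Function Routine

/-! ### Deterministic verification of computation paths -/

namespace NTM

variable (N : NTM)

/-- The alphabets of the oracle simulation: one stack of bits is added to the stacks of `N`. -/
abbrev oracleΓ : N.K ⊕ Unit → Type := sumΓ N.Γ fun _ => Bool

/-- The simulation of `N` in which the guesses are read from a stack. The state is extended by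
two flags: whether the stack has been found empty, and the bit that has been read last. -/
abbrev oracleRoutine : Routine N.oracleΓ (N.σ × (Bool × Bool)) where
  Λ := N.Λ
  main := N.main
  code l := match N.prog l with
    | .det q => .det (liftL q)
    | .guess q₀ q₁ => .det (.pop (Sum.inr ())
        (fun v o => (v.1, (v.2.1 || o.isNone, o.getD false)))
        (.branch (fun v => v.2.2) (liftL q₁) (liftL q₀)))

theorem isDet_oracleRoutine : N.oracleRoutine.IsDet := fun l => by
  simp only [oracleRoutine]
  cases N.prog l <;> exact ⟨_, rfl⟩

/-- The configuration of the simulation. -/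
def oracleCfg (c : N.Cfg) (y : List Bool) (f : Bool × Bool) :
    TM2.Cfg N.oracleΓ N.Λ (N.σ × (Bool × Bool)) :=
  ⟨c.l, (c.var, f), both c.stk fun _ => y⟩

/-- The simulation keeps step with `N` for up to `n` steps. Either the guesses made so far are a
prefix of `y`, or the stack ran dry: then missing guesses count as `0`, the flag records this, and
the guess sequence is strictly longer than `y`. -/
theorem steps_oracleRoutine (n : ℕ) (c : N.Cfg) (y : List Bool) (f : Bool × Bool) :
    ∃ m ≤ n, ∃ g c' y' f', Steps N.prog c g m c' ∧ (c'.l = none ∨ m = n) ∧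
      Steps N.oracleRoutine.code (N.oracleCfg c y f) [] m (N.oracleCfg c' y' f') ∧
      (f'.1 = f.1 ∧ y = g ++ y' ∨
        f'.1 = true ∧ y' = [] ∧ ∃ k, g = y ++ List.replicate (k + 1) false) := by
  induction n generalizing c y f with
  | zero => exact ⟨0, le_rfl, [], c, y, f, .refl _, .inr rfl, .refl _, .inl ⟨rfl, rfl⟩⟩
  | succ n ih =>
    obtain ⟨l, v, S⟩ := c
    cases l with
    | none => exact ⟨0, by simp, [], _, y, f, .refl _, .inl rfl, .refl _, .inl ⟨rfl, rfl⟩⟩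
    | some l =>
      obtain ⟨b, y₁, f₁, hstep, hcase⟩ : ∃ b y₁ f₁,
          (∀ c' y' f' m, Steps N.oracleRoutine.code
            (N.oracleCfg (TM2.stepAux ((N.prog l).stmt b) v S) y₁ f₁) [] m
              (N.oracleCfg c' y' f') →
            Steps N.oracleRoutine.code (N.oracleCfg ⟨some l, v, S⟩ y f) [] (m + 1)
              (N.oracleCfg c' y' f')) ∧
          (f₁.1 = f.1 ∧ y = (N.prog l).bits b ++ y₁ ∨
            f₁.1 = true ∧ y = [] ∧ y₁ = [] ∧ (N.prog l).bits b = [false]) := by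
        cases hl : N.prog l with
        | det q =>
          refine ⟨false, y, f, fun c' y' f' m h => ?_, .inl ⟨rfl, rfl⟩⟩
          have hc : N.oracleRoutine.code l = .det (liftL q) := by simp [oracleRoutine, hl]
          have := Steps.step (P := N.oracleRoutine.code) (l := l) (v := (v, f))
            (S := both S fun _ => y) (n := m) (y := []) (c' := N.oracleCfg c' y' f') false (by
              rw [hc]; simp only [Instr.stmt]; rw [stepAux_liftL]; exact h)
          rw [hc] at this
          exact this
        | guess q₀ q₁ =>
          have hc : N.oracleRoutine.code l = .det (.pop (Sum.inr ())
            (fun v o => (v.1, (v.2.1 || o.isNone, o.getD false)))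
            (.branch (fun v => v.2.2) (liftL q₁) (liftL q₀))) := by simp [oracleRoutine, hl]
          refine ⟨y.head?.getD false, y.tail, (f.1 || y.head?.isNone, y.head?.getD false),
            fun c' y' f' m h => ?_, ?_⟩
          · have := Steps.step (P := N.oracleRoutine.code) (l := l) (v := (v, f))
              (S := both S fun _ => y) (n := m) (y := []) (c' := N.oracleCfg c' y' f') false (by
                rw [hc]
                simp only [Instr.stmt, TM2.stepAux, update_both_inr, both_inr]
                have e : update (fun _ : Unit => y) () y.tail = fun _ => y.tail := by
                  funext u; simp
                rw [e]
                cases hb : y.head?.getD false <;> simp only [cond_true, cond_false] <;>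
                  rw [stepAux_liftL] <;> simpa [hb, oracleCfg, Instr.stmt] using h)
            rw [hc] at this
            exact this
          · cases y <;> simp [Instr.bits]
      obtain ⟨m, hm, g, c', y', f', h1, h2, h3, h4⟩ :=
        ih (TM2.stepAux ((N.prog l).stmt b) v S) y₁ f₁
      refine ⟨m + 1, by omega, _, c', y', f', .step b h1, h2.imp_right fun h => by omega, hstep _ _ _ _ h3, ?_⟩
      rcases hcase with ⟨hf, hy⟩ | ⟨hf, hy, hy₁, hb⟩
      · rcases h4 with ⟨hf', hy'⟩ | ⟨hf', hy', k, hk⟩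
        · exact .inl ⟨hf'.trans hf, by rw [hy, hy', List.append_assoc]⟩
        · exact .inr ⟨hf', hy', k, by rw [hk, hy, List.append_assoc]⟩
      · subst hy₁
        rcases h4 with ⟨hf', hy'⟩ | ⟨hf', hy', k, hk⟩
        · obtain ⟨rfl, rfl⟩ := List.append_eq_nil_iff.1 hy'.symm
          exact .inr ⟨hf'.trans hf, rfl, 0, by simp [hb, hy]⟩
        · exact .inr ⟨hf', hy', k + 1, by rw [hb, hk, hy]; simp [List.replicate_succ]⟩

/-- The alphabets of the verifier. -/
abbrev verifierΓ : (N.K ⊕ Unit) ⊕ Aux → Type :=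
  sumΓ N.oracleΓ (AuxΓ (Bool ⊕ Bool) Empty (Bool ⊕ Bool) Bool)

/-- The states of the verifier. -/
abbrev VerifierState : Type := (N.σ × (Bool × Bool)) × Regs N.verifierΓ

/-- Empty the stacks in a list. -/
noncomputable def clearAll : List N.K → Routine N.verifierΓ N.VerifierState
  | [] => op .halt
  | k :: ks => (move (Sum.inl (Sum.inl k)) (Sum.inr Aux.out) fun _ => none).seq (clearAll ks)

theorem isDet_clearAll (ks : List N.K) : (N.clearAll ks).IsDet := by
  induction ks with
  | nil => exact isDet_op _
  | cons k ks ih => exact (isDet_scan _ _ _ _).seq ih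

/-- `Machine.Outputs` requires all stacks but the output to be empty at the end, so the leftovers of
the simulated machine have to be removed. -/
theorem exec_clearAll (r : N.σ × (Bool × Bool)) (b : ℕ) (ks : List N.K)
    (S : ∀ k, List (N.Γ k)) (hb : ∀ k, (S k).length ≤ b) : ∃ S' : ∀ k, List (N.Γ k),
      (∀ k, k ∈ ks ∨ S k = [] → S' k = []) ∧
      (N.clearAll ks).Exec (r, noRegs) (both (both S noStk) (aux [] [] [] [])) []
        (ks.length * (2 * b + 1) + 1) (r, noRegs) (both (both S' noStk) (aux [] [] [] [])) := by
  induction ks generalizing S with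
  | nil => exact ⟨S, by simp, (exec_op rfl).mono (by simp)⟩
  | cons k ks ih =>
    obtain ⟨S', h1, h2⟩ := ih (update S k []) fun j => by
      rcases eq_or_ne j k with rfl | h
      · simp
      · simpa [h] using hb j
    have r1 := exec_move (Γ := N.verifierΓ) (a := .inl (.inl k)) (b := .inr .out) (by simp)
      (fun _ => none) r (both (both S noStk) (aux [] [] [] []))
    simp only [both_inl, both_inr, update_both_inl, update_both_inr, aux_out, update_aux_out,
      List.filterMap_none, List.reverse_nil, List.append_nil] at r1
    refine ⟨S', fun j hj => h1 j ?_, (r1.seq h2).mono ?_⟩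
    · rcases eq_or_ne j k with rfl | h
      · simp
      · simpa [h] using hj
    · have := hb k
      simp only [List.length_cons, add_mul]
      omega

/-- The deterministic machine that verifies that a string is an accepting path of `N`. -/
noncomputable def verifier : Machine (Bool ⊕ Bool) Bool where
  K := (N.K ⊕ Unit) ⊕ Aux
  Γ := N.verifierΓ
  k₀ := .inr .inp
  k₁ := .inr .out
  i := .refl _
  o := .refl _
  σ := N.VerifierState
  init := ((N.initialState, (false, false)), noRegs)
  R := (move (.inr .inp) (.inr .tmp) some).seq
    ((move₂ (.inr .tmp) (.inl (.inl N.k₀)) (.inl (.inr ()))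
      (fun s => s.getLeft?.map N.inputAlphabet.symm) Sum.getRight?).seq
    ((N.oracleRoutine.onLeft _ _).seq
    ((scan (.inl (.inr ())) (.inr .out) (fun r _ => (r.1, (true, r.2.2))) (fun _ _ => [])).seq
    ((N.clearAll Finset.univ.toList).seq
    (op (.push (.inr .out) (fun v => N.accepting v.1.1 && !v.1.2.1)
      (.load (fun _ => ((N.initialState, (false, false)), noRegs)) .halt)))))))
  det := (isDet_scan _ _ _ _).seq ((isDet_move₂ _ _ _ _ _).seq
    (N.isDet_oracleRoutine.onLeft.seq ((isDet_scan _ _ _ _).seq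
    ((N.isDet_clearAll _).seq (isDet_op _)))))

theorem exists_exec_oracleRoutine {T : Polynomial ℕ} (hT : ∀ (x y : List Bool) (n : ℕ) (c : N.Cfg),
    N.Run (N.init x) y n c → n ≤ T.eval x.length) (x y : List Bool) :
    ∃ n ≤ T.eval x.length, ∃ g c y' f, Steps N.prog (N.init x) g n c ∧ c.l = none ∧
      y'.length ≤ y.length ∧
      (y ∈ N.acc x ↔ N.accepting c.var = true ∧ f = false ∧ y' = []) ∧ ∃ b,
      N.oracleRoutine.Exec (N.initialState, (false, false)) (both (N.init x).stk fun _ => y) []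
        (T.eval x.length) (c.var, (f, b)) (both c.stk fun _ => y') := by
  obtain ⟨m, -, g, c, y', ⟨f, b⟩, h1, h2, h3, h4⟩ :=
    -- One step more than any run of `N` can take, which leaves only the alternative that the
    -- simulation has halted.
    N.steps_oracleRoutine (T.eval x.length + 1) (N.init x) y (false, false)
  have hm : m ≤ T.eval x.length := hT x g m c (N.run_iff_steps.2 h1)
  have hl : c.l = none := h2.resolve_right (by omega)
  refine ⟨m, hm, g, c, y', f, h1, hl, ?_, ?_, b, m, hm, ?_⟩
  · rcases h4 with ⟨-, rfl⟩ | ⟨-, rfl, -⟩ <;> simp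
  · rw [N.mem_acc_iff]
    constructor
    · rintro ⟨n, c', hs, hl', ha⟩
      rcases h4 with ⟨hf, hy⟩ | ⟨-, -, k, hk⟩
      · obtain ⟨-, -, e⟩ := hs.deterministic hl' h1 (r := []) (r' := y') (by simpa using hy)
        obtain ⟨rfl, rfl, rfl⟩ := e hl
        exact ⟨ha, hf, by simpa using hy⟩
      -- If the guesses ran out, the simulated path properly extends `y`; by determinism `y` is then
      -- no complete path.
      · obtain ⟨-, -, e⟩ := h1.deterministic hl hs (r := []) (by simpa using hk)
        have := congrArg List.length ((e hl').1.trans hk)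
        simp at this
    · rintro ⟨ha, rfl, rfl⟩
      rcases h4 with ⟨-, hy⟩ | ⟨hf, -⟩
      · exact ⟨m, c, by rw [hy, List.append_nil]; exact h1, hl, ha⟩
      · simp at hf
  · have := h3
    rw [oracleCfg, oracleCfg, hl] at this
    exact this

open Classical in
/-- Membership in the set of accepting paths can be verified in polynomial time. -/
theorem pt_acc (hN : N.IsPolyTime) :
    PT (prodEnc id id) (fun b : Bool => [b])
      fun p : List Bool × List Bool => decide (p.2 ∈ N.acc p.1) := by
  obtain ⟨T, hT⟩ := hN
  obtain ⟨C, hC⟩ := exists_length_le N.prog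
  refine ⟨N.verifier, 6 * .X + T + .C (Fintype.card N.K) * (2 * (.X + .C C * T) + 1) + 5,
    fun ⟨x, y⟩ => ?_⟩
  obtain ⟨n, hn, g, c, y', f, hs, hl, hy', hacc, b, hex⟩ := N.exists_exec_oracleRoutine hT x y
  obtain ⟨S', hS', r5⟩ := N.exec_clearAll (c.var, (f || !y'.isEmpty, b)) (x.length + C * n)
    Finset.univ.toList c.stk fun k => by
      refine (hC _ _ _ _ hs k).trans ?_
      have : ((N.init x).stk k).length ≤ x.length := by
        rcases eq_or_ne k N.k₀ with rfl | h
        · simp [NTM.init]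
        · simp [NTM.init, h]
      omega
  obtain rfl : S' = noStk := funext fun k => hS' k (by simp)
  have e0 : (noStk : ∀ k, List (N.verifierΓ k)) = both (both noStk noStk) (aux [] [] [] []) := by
    simp only [noStk_eq_both, ← noStk_eq_aux]
  have e1 : N.verifier.input (prodEnc id id (x, y)) =
      both (both noStk noStk) (aux (prodEnc id id (x, y)) [] [] []) :=
    have : update (noStk : ∀ k, List (N.verifierΓ k)) (.inr .inp)
        ((prodEnc id id (x, y)).map id) = _ := by
      rw [e0]; simp
    this
  have e2 : N.verifier.output [decide (y ∈ N.acc x)] =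
      both (both noStk noStk) (aux [] [] [] [decide (y ∈ N.acc x)]) :=
    have : update (noStk : ∀ k, List (N.verifierΓ k)) (.inr .out)
        ([decide (y ∈ N.acc x)].map id) = _ := by
      rw [e0]; simp
    this
  have r1 := exec_move (Γ := N.verifierΓ) (a := .inr .inp) (b := .inr .tmp) (by simp)
    some (N.initialState, (false, false))
    (both (both noStk noStk) (aux (prodEnc id id (x, y)) [] [] []))
  have r2 := exec_move₂ (Γ := N.verifierΓ) (a := .inr .tmp) (b := .inl (.inl N.k₀))
    (c := .inl (.inr ())) (by simp) (by simp) (by simp)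
    (fun s => s.getLeft?.map N.inputAlphabet.symm) Sum.getRight?
    (N.initialState, (false, false))
    (both (both noStk noStk) (aux [] [] (prodEnc id id (x, y)).reverse []))
  have r3 := hex.onLeft (noRegs : Regs N.verifierΓ)
    (aux [] [] [] [] : ∀ j, List (AuxΓ (Bool ⊕ Bool) Empty (Bool ⊕ Bool) Bool j))
  -- Emptying the stack of guesses raises the flag if any are left, so that too long strings are
  -- rejected as well as too short ones.
  have r4 := exec_scan (Γ := N.verifierΓ) (a := .inl (.inr ())) (b := .inr .out) (by simp)
    (fun r _ => (r.1, (true, r.2.2))) (fun _ _ => []) (c.var, (f, b))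
    (both (both c.stk fun _ => y') (aux [] [] [] []))
  have r6 := exec_op (Γ := N.verifierΓ) (σ := N.VerifierState)
    (q := .push (Sum.inr Aux.out) (fun v => N.accepting v.1.1 && !v.1.2.1)
      (.load (fun _ => ((N.initialState, (false, false)), noRegs)) .halt))
    (v := ((c.var, (f || !y'.isEmpty, b)), noRegs))
    (v' := ((N.initialState, (false, false)), noRegs))
    (S := both (both noStk noStk) (aux [] [] [] []))
    (S' := both (both noStk noStk) (aux [] [] [] [decide (y ∈ N.acc x)])) (by
      have : decide (y ∈ N.acc x) = (N.accepting c.var && !(f || !y'.isEmpty)) := by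
        rw [Bool.eq_iff_iff, decide_eq_true_iff, hacc]
        cases f <;> simp
      simp [TM2.stepAux, this])
  have e3 : ∀ l : List Bool, outputs (fun (r : N.σ × (Bool × Bool)) (_ : Bool) => (r.1, (true, r.2.2)))
      (fun _ _ => ([] : List Bool)) (c.var, (f, b)) l = [] := by
    intro l
    generalize (c.var, (f, b)) = r
    induction l generalizing r with
    | nil => rfl
    | cons s l ih => exact ih _
  have e4 : ∀ l : List Bool, l.foldl (fun (r : N.σ × (Bool × Bool)) (_ : Bool) =>
      (r.1, (true, r.2.2))) (c.var, (f, b)) = (c.var, (f || !l.isEmpty, b)) := by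
    intro l
    have : ∀ (l : List Bool), l.foldl (fun (r : N.σ × (Bool × Bool)) (_ : Bool) =>
      (r.1, (true, r.2.2))) (c.var, (true, b)) = (c.var, (true, b)) := by
      intro l; induction l <;> simp_all
    cases l with
    | nil => simp
    | cons s l => simpa using this l
  have e5 : update (fun _ : Unit => y') () [] = noStk := rfl
  have e6 : (N.init x).stk = update noStk N.k₀ (x.map N.inputAlphabet.symm) := rfl
  have e7 : update (noStk : ∀ _ : Unit, List Bool) () y = fun _ => y := by funext u; simp
  simp only [both_inr, aux_inp, aux_tmp, update_both_inr, update_aux_inp, update_aux_tmp,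
    List.filterMap_some, List.append_nil] at r1
  simp only [both_inr, both_inl, aux_tmp, update_both_inr, update_both_inl, update_aux_tmp, noStk_apply, List.append_nil, List.filterMap_reverse,
    filterMap_getLeft?_map, filterMap_getLeft?_prodEnc, filterMap_getRight?_prodEnc, id,
    List.reverse_reverse, e7] at r2
  rw [e6] at r3
  simp only [both_inl, both_inr, aux_out, update_both_inl, update_both_inr, update_aux_out,
    e3, e4, e5, List.reverse_nil, List.append_nil] at r4
  rw [Machine.Outputs, e1, e2]
  refine (r1.seq (r2.seq (r3.seq (r4.seq (r5.seq r6))))).mono ?_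
  have h1 := eval_mono T (show x.length ≤ x.length + y.length by omega)
  have h2 : x.length + C * n ≤ x.length + y.length + C * T.eval (x.length + y.length) :=
    add_le_add (by omega) (Nat.mul_le_mul_left C (hn.trans h1))
  have h3 := Nat.mul_le_mul_left (Fintype.card N.K)
    (show 2 * (x.length + C * n) + 1 ≤
      2 * (x.length + y.length + C * T.eval (x.length + y.length)) + 1 by omega)
  have h4 : (Finset.univ.toList : List N.K).length = Fintype.card N.K := by
    rw [Finset.length_toList, Finset.card_univ]
  rw [h4]
  simp only [List.length_reverse, length_prodEnc, id, Polynomial.eval_add, Polynomial.eval_mul,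
    Polynomial.eval_X, Polynomial.eval_C, Polynomial.eval_ofNat, Polynomial.eval_one] at h1 h2 h3 ⊢
  omega

end NTM

end ClusterComputing

namespace ClusterComputing

set_option linter.unusedSectionVars false

open Turing Function Routine

/-! ### A library of polynomial-time functions -/

namespace Routine

variable {A B Q : Type} {δ : Q → A → Q} {w : Q → A → List B}

theorem outputs_append (q : Q) (l l' : List A) :
    outputs δ w q (l ++ l') = outputs δ w q l ++ outputs δ w (l.foldl δ q) l' := by
  induction l generalizing q with
  | nil => rfl
  | cons s l ih => simp [outputs, ih]

theorem outputs_of_fixed {q : Q} {l : List A} (h : ∀ s ∈ l, δ q s = q) :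
    outputs δ w q l = l.flatMap (w q) := by
  induction l with
  | nil => rfl
  | cons s l ih =>
    rw [outputs, h s (by simp), ih fun s hs => h s (by simp [hs]), List.flatMap_cons]

theorem foldl_of_fixed {q : Q} {l : List A} (h : ∀ s ∈ l, δ q s = q) : l.foldl δ q = q := by
  induction l with
  | nil => rfl
  | cons s l ih => rw [List.foldl_cons, h s (by simp), ih fun s hs => h s (by simp [hs])]

end Routine

namespace PT

variable {α β γ δ A B C D : Type} {ea : α → List A} {eb : β → List B} {ec : γ → List C}
  {ed : δ → List D} [Fintype A] [Fintype B] [Fintype C] [Fintype D]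

/-- The one-bit strings as an encoding of truth values. -/
abbrev bitEnc : Bool → List Bool := fun b => [b]

theorem of_flatMap (g : A → List B) {f : α → β} (h : ∀ a, eb (f a) = (ea a).flatMap g) :
    PT ea eb f := by
  refine transducer (Q := Unit) () (fun _ _ => ()) (fun _ a => g a) (fun _ => []) fun a => ?_
  rw [h, List.append_nil]
  induction ea a with
  | nil => rfl
  | cons s l ih => rw [List.flatMap_cons, outputs, ← ih]

theorem refl : PT ea ea fun a => a := of_flatMap (fun s => [s]) fun a => by simp

theorem fst : PT (prodEnc ea eb) ea Prod.fst :=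
  of_flatMap (fun s => s.getLeft?.toList) fun p => by
    simp [prodEnc, List.flatMap_map]

theorem snd : PT (prodEnc ea eb) eb Prod.snd :=
  of_flatMap (fun s => s.getRight?.toList) fun p => by
    simp [prodEnc, List.flatMap_map]

theorem fold {Q : Type} [Fintype Q] (q₀ : Q) (δ : Q → A → Q) (fin : Q → List B) {f : α → β}
    (h : ∀ a, eb (f a) = fin ((ea a).foldl δ q₀)) : PT ea eb f := by
  refine transducer q₀ δ (fun _ _ => []) fin fun a => ?_
  have : ∀ (l : List A) q, outputs δ (fun _ _ => ([] : List B)) q l = [] := by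
    intro l
    induction l with
    | nil => intro q; rfl
    | cons s l ih => intro q; rw [outputs, ih]; rfl
  rw [this, h, List.nil_append]

theorem const (b : β) : PT ea eb fun _ => b :=
  fold (Q := Unit) () (fun _ _ => ()) (fun _ => eb b) fun _ => rfl

theorem comp₂ {k : β × γ → δ} (hk : PT (prodEnc eb ec) ed k) {f : α → β} {g : α → γ}
    (hf : PT ea eb f) (hg : PT ea ec g) : PT ea ed fun a => k (f a, g a) :=
  hk.comp (hf.pair hg)

theorem bool₂ (k : Bool → Bool → Bool) {f g : α → Bool} (hf : PT ea bitEnc f)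
    (hg : PT ea bitEnc g) : PT ea bitEnc fun a => k (f a) (g a) :=
  comp₂ (k := fun p => k p.1 p.2) (fold (Q := Bool × Bool) (false, false)
    (fun q s => s.elim (fun b => (b, q.2)) fun b => (q.1, b)) (fun q => [k q.1 q.2])
    fun p => by simp [prodEnc]) hf hg

theorem and {f g : α → Bool} (hf : PT ea bitEnc f) (hg : PT ea bitEnc g) :
    PT ea bitEnc fun a => f a && g a := bool₂ _ hf hg

theorem or {f g : α → Bool} (hf : PT ea bitEnc f) (hg : PT ea bitEnc g) :
    PT ea bitEnc fun a => f a || g a := bool₂ _ hf hg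

theorem not {f : α → Bool} (hf : PT ea bitEnc f) : PT ea bitEnc fun a => !f a :=
  bool₂ (fun a _ => !a) hf hf

/-- Both branches are computed; the bit is encoded in front of them, so a single pass can keep the
right one. -/
theorem cond {c : α → Bool} {f g : α → β} (hc : PT ea bitEnc c) (hf : PT ea eb f)
    (hg : PT ea eb g) : PT ea eb fun a => if c a then f a else g a := by
  refine comp₂ (k := fun p : Bool × (β × β) => if p.1 then p.2.1 else p.2.2)
    (transducer (Q := Bool) false (fun q s => s.elim (fun b => b) fun _ => q)
      (fun q s => s.elim (fun _ => []) fun s => s.elim (fun s => if q then [s] else [])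
        fun s => if q then [] else [s]) (fun _ => []) fun p => ?_) hc (hf.pair hg)
  obtain ⟨b, y, z⟩ := p
  rw [prodEnc, List.map_cons, List.map_nil, List.singleton_append, outputs,
    outputs_of_fixed (by simp)]
  cases b <;> simp [prodEnc, List.flatMap_map]

theorem append {f g : α → List B} (hf : PT ea id f) (hg : PT ea id g) :
    PT ea id fun a => f a ++ g a :=
  comp₂ (k := fun p => p.1 ++ p.2)
    (of_flatMap (fun s => s.elim (fun b => [b]) fun b => [b]) fun p => by
      simp [prodEnc, List.flatMap_map]) hf hg

theorem map (k : B → C) {f : α → List B} (hf : PT ea id f) :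
    PT ea id fun a => (f a).map k :=
  comp (of_flatMap (fun b => [k b]) fun l => by simp [← List.map_eq_flatMap]) hf

theorem isEmpty {f : α → List B} (hf : PT ea id f) : PT ea bitEnc fun a => (f a).isEmpty :=
  comp (fold true (fun _ _ => false) (fun q => [q]) fun l => by
    cases l with
    | nil => rfl
    | cons s l => rw [id, List.foldl_cons, foldl_of_fixed (by simp)]; rfl) hf

theorem elem_true {f : α → List Bool} (hf : PT ea id f) :
    PT ea bitEnc fun a => (f a).elem true :=
  comp (fold false (fun q b => q || b) (fun q => [q]) fun l => by
    have : ∀ (l : List Bool) q, (q || l.elem true) = l.foldl (fun q b => q || b) q := by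
      intro l
      induction l with
      | nil => simp
      | cons s l ih => intro q; rw [List.foldl_cons, ← ih]; cases s <;> simp
    have := this l false
    simpa using this) hf

theorem tail {f : α → List B} (hf : PT ea id f) : PT ea id fun a => (f a).tail :=
  comp (transducer (Q := Bool) false (fun _ _ => true) (fun q s => if q then [s] else [])
    (fun _ => []) fun l => by
      cases l with
      | nil => rfl
      | cons s l =>
        simp only [id, outputs]; rw [outputs_of_fixed (by simp)]; simp) hf

/-- Polynomially many iterations of a map that adds at most a constant number of symbols. -/
theorem iterate_of_le {f : α → α} (hf : PT ea ea f) (K : ℕ)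
    (hK : ∀ a, (ea (f a)).length ≤ (ea a).length + K) {E : Type} [Fintype E] :
    PT (prodEnc id ea) ea fun p : List E × α => f^[p.1.length] p.2 := by
  refine hf.iterate (.C (K + 1) * .X) fun l a i hi => ?_
  have h : ∀ i, (ea (f^[i] a)).length ≤ (ea a).length + i * K := by
    intro i
    induction i with
    | zero => simp
    | succ i ih =>
      rw [Function.iterate_succ_apply', Nat.succ_mul]
      have := hK (f^[i] a)
      omega
  have h1 := h i
  have h2 := Nat.mul_le_mul_right K hi
  simp only [Polynomial.eval_mul, Polynomial.eval_C, Polynomial.eval_X]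
  nlinarith

theorem drop {f : α → List B} {g : α → List C} (hf : PT ea id f) (hg : PT ea id g) :
    PT ea id fun a => (g a).drop (f a).length := by
  have h := comp₂ (iterate_of_le (tail (ea := (id : List C → List C)) refl) 0 fun a => by simp)
    hf hg
  have e : ∀ n (l : List C), (fun a : List C => a.tail)^[n] l = l.drop n := by
    intro n
    induction n with
    | zero => simp
    | succ n ih => intro l; rw [Function.iterate_succ_apply', ih, List.tail_drop]
  simpa only [e] using h

/-- The iterated step moves the head of the first string to the end of the second, remembering it
during the pass. -/
theorem take {f : α → List B} {g : α → List C} (hf : PT ea id f) (hg : PT ea id g) :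
    PT ea id fun a => (g a).take (f a).length := by
  have hs : PT (prodEnc id id) (prodEnc id id)
      fun p : List C × List C => (p.1.tail, p.2 ++ p.1.head?.toList) := by
    refine transducer (Q := Option C) none (fun q s => q.or s.getLeft?)
      (fun q s => match q with
        | some _ => [s]
        | none => s.elim (fun _ => []) fun _ => [s]) (fun q => q.toList.map Sum.inr) fun p => ?_
    obtain ⟨l, m⟩ := p
    cases l with
    | nil =>
      have : ∀ s ∈ m.map (Sum.inr (α := C)), (none : Option C).or s.getLeft? = none := by simp
      simp only [prodEnc, id, List.map_nil, List.nil_append]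
      rw [outputs_of_fixed this, foldl_of_fixed this]
      simp [List.flatMap_map, ← List.map_eq_flatMap]
    | cons s l =>
      have : ∀ t ∈ l.map (Sum.inl (β := C)) ++ m.map Sum.inr,
        (some s).or t.getLeft? = some s := by simp
      simp only [prodEnc, id, List.map_cons, List.cons_append, outputs, List.foldl_cons,
        Sum.getLeft?_inl, Option.none_or]
      rw [outputs_of_fixed this, foldl_of_fixed this]
      simp
  have h := snd.comp <| comp₂ (iterate_of_le hs 1 fun p => by
    obtain ⟨_ | _, m⟩ := p <;> simp [prodEnc]; omega) hf (hg.pair (const []))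
  have e : ∀ n (l m : List C), ((fun p : List C × List C =>
      (p.1.tail, p.2 ++ p.1.head?.toList))^[n] (l, m)).2 = m ++ l.take n := by
    intro n
    induction n with
    | zero => simp
    | succ n ih => intro l m; rw [Function.iterate_succ_apply, ih]; cases l <;> simp
  simpa only [e, List.nil_append] using h

/-- Running a finite automaton on two strings in parallel. -/
theorem zipFold {Q : Type} [Fintype Q] (q₀ : Q) (δ : Q → B × C → Q) {f : α → List B}
    {g : α → List C} (hf : PT ea id f) (hg : PT ea id g) (fin : Q → Bool) :
    PT ea bitEnc fun a => fin (((f a).zip (g a)).foldl δ q₀) := by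
  let st : (List B × List C) × Q → (List B × List C) × Q := fun p =>
    ((p.1.1.tail, p.1.2.tail), ((p.1.1.zip p.1.2).head?.elim p.2 (δ p.2)))
  have hs : PT (prodEnc (prodEnc id id) fun q : Q => [q])
      (prodEnc (prodEnc id id) fun q : Q => [q]) st := by
    -- One pass deletes the heads of both strings and remembers them until the automaton state,
    -- which is encoded last, is reached and updated.
    let δ' : Option B × Option C → (B ⊕ C) ⊕ Q → Option B × Option C :=
      fun q s => s.elim (fun s => s.elim (fun b => (q.1.or (some b), q.2))
        fun c => (q.1, q.2.or (some c))) fun _ => q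
    let w : Option B × Option C → (B ⊕ C) ⊕ Q → List ((B ⊕ C) ⊕ Q) := fun q s => match q, s with
        | (none, _), .inl (.inl _) => []
        | (_, none), .inl (.inr _) => []
        | (some b, some c), .inr s => [.inr (δ s (b, c))]
        | _, s => [s]
    have h1 : ∀ l : List B, outputs δ' w (none, none) ((l.map Sum.inl).map Sum.inl) =
        (l.tail.map Sum.inl).map Sum.inl ∧
        ((l.map Sum.inl).map Sum.inl).foldl δ' (none, none) = (l.head?, none) := by
      rintro (_ | ⟨b, l⟩)
      · exact ⟨rfl, rfl⟩
      · have : ∀ s ∈ (l.map Sum.inl).map Sum.inl, δ' (some b, none) s = (some b, none) := by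
          simp [δ']
        simp only [List.map_cons, outputs, List.foldl_cons]
        rw [show δ' (none, none) (.inl (.inl b)) = (some b, none) from rfl,
          outputs_of_fixed this, foldl_of_fixed this]
        simp [w, List.flatMap_map, ← List.map_eq_flatMap]
    have h2 : ∀ o (m : List C), outputs δ' w (o, none) ((m.map Sum.inr).map Sum.inl) =
        (m.tail.map Sum.inr).map Sum.inl ∧
        ((m.map Sum.inr).map Sum.inl).foldl δ' (o, none) = (o, m.head?) := by
      rintro o (_ | ⟨c, m⟩)
      · exact ⟨rfl, rfl⟩
      · have : ∀ s ∈ (m.map Sum.inr).map Sum.inl, δ' (o, some c) s = (o, some c) := by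
          simp [δ']
        simp only [List.map_cons, outputs, List.foldl_cons]
        rw [show δ' (o, none) (.inl (.inr c)) = (o, some c) from rfl,
          outputs_of_fixed this, foldl_of_fixed this]
        cases o <;> simp [w, List.flatMap_map, ← List.map_eq_flatMap]
    refine transducer (none, none) δ' w (fun _ => []) fun p => ?_
    obtain ⟨⟨l, m⟩, q⟩ := p
    simp only [prodEnc, List.map_append, id, outputs_append, List.append_nil, List.foldl_append,
      (h1 l).1, (h1 l).2, (h2 l.head? m).1, (h2 l.head? m).2]
    congr 1
    rcases l with _ | ⟨b, l⟩ <;> rcases m with _ | ⟨c, m⟩ <;> rfl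
  have h := (fold (eb := bitEnc) (f := fun p : (List B × List C) × Q => fin p.2) none
    (fun _ s => s.getRight?) (fun q : Option Q => (q.map fin).toList) fun p => by
      simp [prodEnc]).comp <|
    comp₂ (iterate_of_le hs 0 fun p => by simp [prodEnc, st]; omega) hf
      ((hf.pair hg).pair (const q₀))
  have e : ∀ (l : List B) (m : List C) q,
      (st^[l.length] ((l, m), q)).2 = (l.zip m).foldl δ q := by
    intro l
    induction l with
    | nil => intro m q; rfl
    | cons b l ih =>
      intro m q
      rw [List.length_cons, Function.iterate_succ_apply]
      rcases m with _ | ⟨c, m⟩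
      · simpa [st] using ih [] q
      · simpa [st] using ih m (δ q (b, c))
  simpa only [e] using h

/-- The truth value of equality. -/
theorem beq {f g : α → List Bool} (hf : PT ea id f) (hg : PT ea id g) :
    PT ea bitEnc fun a => f a == g a := by
  have h := ((isEmpty (drop hf hg)).and (isEmpty (drop hg hf))).and
    (zipFold true (fun q p => q && p.1 == p.2) hf hg id)
  have e0 : ∀ l : List (Bool × Bool), l.foldl (fun q p => q && p.1 == p.2) false = false :=
    fun l => foldl_of_fixed (by simp)
  have e : ∀ l m : List Bool, ((m.drop l.length).isEmpty && (l.drop m.length).isEmpty &&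
      id ((l.zip m).foldl (fun q p => q && p.1 == p.2) true)) = (l == m) := by
    intro l
    induction l with
    | nil => intro m; cases m <;> simp
    | cons a l ih =>
      intro m
      cases m with
      | nil => simp
      | cons b m =>
        have := ih m
        rcases a <;> rcases b <;> simp_all
  simpa only [e] using h

/-! #### Numbers in unary -/

/-- The string `0^n`. -/
abbrev zeros (n : ℕ) : List Bool := List.replicate n false

theorem zeros_length {f : α → List B} (hf : PT ea id f) :
    PT ea id fun a => zeros (f a).length := by
  simpa using map (fun _ => false) hf

theorem zeros_add {m n : α → ℕ} (hm : PT ea id fun a => zeros (m a))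
    (hn : PT ea id fun a => zeros (n a)) : PT ea id fun a => zeros (m a + n a) := by
  simpa [List.replicate_append_replicate] using hm.append hn

theorem zeros_mul {m n : α → ℕ} (hm : PT ea id fun a => zeros (m a))
    (hn : PT ea id fun a => zeros (n a)) : PT ea id fun a => zeros (m a * n a) := by
  have hs : PT (prodEnc id id) (prodEnc id id)
      fun p : List Bool × List Bool => (p.1, p.2 ++ p.1) := fst.pair (snd.append fst)
  have e : ∀ i (l m : List Bool), (fun p : List Bool × List Bool => (p.1, p.2 ++ p.1))^[i] (l, m)
      = (l, m ++ (List.replicate i l).flatten) := by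
    intro i
    induction i with
    | zero => simp
    | succ i ih =>
      intro l m
      -- Each round appends one more copy of the first component.
      rw [Function.iterate_succ_apply, ih]
      -- The growth per round is not constant, so the iteration below needs its own, quadratic,
      -- bound.
      simp [List.replicate_succ]
  have h := snd.comp <| comp₂ (hs.iterate (E := Bool) (.X ^ 2 + .X) fun l p i hi => by
    obtain ⟨a, b⟩ := p
    rw [e]
    have := Nat.mul_le_mul_right a.length hi
    simp [prodEnc]
    nlinarith) hm (hn.pair (const []))
  simpa [e, List.flatten_replicate_replicate] using h

theorem zeros_eval (T : Polynomial ℕ) {n : α → ℕ} (hn : PT ea id fun a => zeros (n a)) :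
    PT ea id fun a => zeros (T.eval (n a)) := by
  induction T using Polynomial.induction_on with
  | C c => simpa using const (zeros c)
  | add P Q hP hQ => simpa using zeros_add hP hQ
  | monomial k c h => simpa [pow_succ, mul_assoc] using zeros_mul h hn

end PT

end ClusterComputing

/-! ### From machines to complexity: path lengths, codings, and unique refutations under UP = coUP.
-/

namespace ClusterComputing

set_option linter.unusedSectionVars false

open Turing Function Routine PT

theorem mem_fpt_iff {g : List Bool → List Bool} : g ∈ FPt ↔ PT id id g :=
  pt_iff_tm2.symm

theorem mem_polyPred₃_iff {r : List Bool → List Bool → List Bool → Bool} : r ∈ PolyPred₃ ↔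
    PT (prodEnc id (prodEnc id id)) bitEnc fun t => r t.1 t.2.1 t.2.2 :=
  pt_iff_tm2.symm

/-! ### The length of the paths of a balanced machine -/

theorem NTM.Run.length_le {M : NTM} {c c' : M.Cfg} {y : List Bool} {n : ℕ} (h : M.Run c y n c') :
    y.length ≤ n := by
  induction h with
  | refl => simp
  | det _ _ ih => omega
  | guess _ _ _ ih => simpa using ih

/-- The machine that accepts on all paths. -/
def NTM.acceptAll (M : NTM) : NTM := { M with accepting := fun _ => true }

theorem NTM.run_acceptAll {M : NTM} {c c' : M.Cfg} {y : List Bool} {n : ℕ} :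
    M.acceptAll.Run c y n c' ↔ M.Run c y n c' :=
  M.acceptAll.run_iff_steps.trans M.run_iff_steps.symm

theorem NTM.acc_acceptAll (M : NTM) (x : List Bool) : M.acceptAll.acc x = M.paths x := by
  ext y
  constructor
  · rintro ⟨n, c, h, hc, _⟩
    exact ⟨n, c, NTM.run_acceptAll.1 h, hc⟩
  · rintro ⟨n, c, h, hc⟩
    exact ⟨n, c, NTM.run_acceptAll.2 h, hc, rfl⟩

theorem NTM.IsPolyTime.acceptAll {M : NTM} (hM : M.IsPolyTime) : M.acceptAll.IsPolyTime := by
  obtain ⟨T, hT⟩ := hM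
  exact ⟨T, fun x y n c h => hT x y n c (NTM.run_acceptAll.1 h)⟩

/-- Instead of evaluating a polynomial with rational coefficients, the machine itself is consulted:
`0^k` is a path exactly if `k = p(|x|)`. Zeros are removed from `0^T`, where `T` is the time bound,
until a path is reached. -/
theorem NTM.IsBalanced.pt {M : NTM} {p : ℕ → ℕ} (hp : M.IsBalanced p) (hM : M.IsPolyTime) :
    PT (id : List Bool → List Bool) id fun x => zeros (p x.length) := by
  classical
  obtain ⟨T, hT⟩ := id hM
  have hpT : ∀ x : List Bool, p x.length ≤ T.eval x.length := by
    intro x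
    obtain ⟨n, c, h, -⟩ : zeros (p x.length) ∈ M.paths x := by simp [hp x]
    simpa using h.length_le.trans (hT _ _ _ _ h)
  let D : List Bool × List Bool → Bool := fun q => decide (q.2 ∈ M.acceptAll.acc q.1)
  have hD : ∀ x k, D (x, zeros k) = true ↔ k = p x.length := by
    intro x k
    simp [D, NTM.acc_acceptAll, hp x]
  have hs : PT (prodEnc id id) (prodEnc id id)
      fun q : List Bool × List Bool => (q.1, if D q then q.2 else q.2.tail) :=
    fst.pair (cond (M.acceptAll.pt_acc hM.acceptAll) snd (tail snd))
  have hT' : PT (id : List Bool → List Bool) id fun x => zeros (T.eval x.length) :=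
    zeros_eval T (zeros_length refl)
  have h := snd.comp <| comp₂ (iterate_of_le hs 0 fun q => by
    simp only [length_prodEnc]; split_ifs <;> simp) hT' (refl.pair hT')
  have e : ∀ x j k, p x.length ≤ k → (fun q : List Bool × List Bool =>
      (q.1, if D q then q.2 else q.2.tail))^[j] (x, zeros k) =
        (x, zeros (max (p x.length) (k - j))) := by
    intro x j
    induction j with
    | zero => intro k hk; simp [hk]
    | succ j ih =>
      intro k hk
      rw [Function.iterate_succ_apply]
      by_cases hkp : k = p x.length
      · simp only [if_pos ((hD x k).2 hkp)]
        rw [ih k hk]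
        congr 2; omega
      · simp only [if_neg (fun h => hkp ((hD x k).1 h)), List.tail_replicate]
        rw [ih _ (by omega)]
        congr 2; omega
  have e' : ∀ x : List Bool, ((fun q : List Bool × List Bool =>
      (q.1, if D q then q.2 else q.2.tail))^[(zeros (T.eval x.length)).length]
        (x, zeros (T.eval x.length))).2 = zeros (p x.length) := by
    intro x
    rw [e _ _ _ (hpT x)]
    simp
  simpa only [e'] using h

/-! ### Coding pairs of strings and padded strings -/

/-- A pair of strings as a string, in which each bit is preceded by a tag. -/
def code (x y : List Bool) : List Bool :=
  x.flatMap (fun b => [false, b]) ++ y.flatMap fun b => [true, b]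

/-- The bits with a given tag. -/
def decode (t : Bool) : List Bool → List Bool
  | a :: b :: l => if a = t then b :: decode t l else decode t l
  | _ => []

theorem length_code (x y : List Bool) : (code x y).length = 2 * (x.length + y.length) := by
  simp [code, List.length_flatMap]; ring

theorem decode_false_code (x y : List Bool) : decode false (code x y) = x := by
  induction x with
  | nil =>
    induction y with
    | nil => rfl
    | cons b y ih => simpa [code, decode] using ih
  | cons b x ih => simpa [code, decode] using ih

theorem decode_true_code (x y : List Bool) : decode true (code x y) = y := by
  induction x with
  | nil =>
    induction y with
    | nil => rfl
    | cons b y ih => simpa [code, decode] using ih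
  | cons b x ih => simpa [code, decode] using ih

namespace PT

variable {α A : Type} {ea : α → List A} [Fintype A]

theorem pair_code {f g : α → List Bool} (hf : PT ea id f) (hg : PT ea id g) :
    PT ea id fun a => code (f a) (g a) :=
  comp₂ (k := fun p => code p.1 p.2) (of_flatMap
    (fun s => s.elim (fun b => [false, b]) fun b => [true, b]) fun p => by
      simp [prodEnc, code, List.flatMap_map]) hf hg

theorem decode (t : Bool) : PT id id (decode t) := by
  refine transducer (Q := Option Bool) none (fun q b => if q.isSome then none else some b)
    (fun q b => if q = some t then [b] else []) (fun _ => []) fun l => ?_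
  rw [List.append_nil]
  induction l using ClusterComputing.decode.induct t with
  | case1 b l ih => simpa [ClusterComputing.decode, outputs] using ih
  | case2 a b l h ih => simpa [ClusterComputing.decode, outputs, h] using ih
  | case3 l h =>
    rcases l with _ | ⟨a, _ | ⟨b, l⟩⟩
    · rfl
    · rfl
    · exact absurd rfl (h a b l)

end PT

/-- The part of a string after the first `1`. -/
def unpad : List Bool → List Bool
  | [] => []
  | b :: l => if b then l else unpad l

theorem unpad_zeros (j : ℕ) (w : List Bool) : unpad (zeros j ++ true :: w) = w := by
  induction j with
  | zero => rfl
  | succ j ih => simpa [List.replicate_succ, unpad] using ih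

theorem exists_eq_zeros_append {l : List Bool} (h : true ∈ l) :
    ∃ j, l = zeros j ++ true :: unpad l := by
  induction l with
  | nil => simp at h
  | cons b l ih =>
    cases b
    · obtain ⟨j, hj⟩ := ih (by simpa using h)
      exact ⟨j + 1, by simpa [List.replicate_succ, unpad] using hj⟩
    · exact ⟨0, rfl⟩

theorem PT.unpad : PT id id unpad := by
  refine transducer false (fun q b => q || b) (fun q b => if q then [b] else []) (fun _ => [])
    fun l => ?_
  rw [List.append_nil]
  induction l with
  | nil => rfl
  | cons b l ih =>
    cases b
    · simpa [ClusterComputing.unpad, outputs] using ih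
    · simp only [ClusterComputing.unpad, id, outputs]
      rw [outputs_of_fixed (by simp)]
      simp

/-! ### Unique refutations -/

/-- If UP is closed under complement, then the non-existence of short strings with a
polynomial-time property, of which there is at most one, has unique short witnesses. -/
theorem exists_refutation (hUP : UP = coUP) {len : List Bool → List Bool} (hlen : PT id id len)
    {R : List Bool × List Bool → Bool} (hR : PT (prodEnc id id) bitEnc R)
    (huniq : ∀ s, {z | z.length = (len s).length ∧ R (s, z) = true}.Subsingleton) :
    ∃ (m : Polynomial ℕ) (W : List Bool × List Bool → Bool), PT (prodEnc id id) bitEnc W ∧ ∀ s,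
      {w | w.length = m.eval s.length ∧ W (s, w) = true}.Subsingleton ∧
      ((∃ w, w.length = m.eval s.length ∧ W (s, w) = true) ↔
        ¬ ∃ z, z.length = (len s).length ∧ R (s, z) = true) := by
  classical
  obtain ⟨N, hN, hacc⟩ := exists_ntm hlen hR
  -- Uniqueness of `z` makes this a UP language; the hypothesis supplies a machine `M` for its
  -- complement, whose only accepting path is the refutation.
  have hL : {s | ∃ z, z.length = (len s).length ∧ R (s, z) = true} ∈ UP :=
    ⟨N, hN, fun s => ⟨(hacc s).2 ▸ huniq s, by rw [(hacc s).2]; rfl⟩⟩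
  rw [hUP] at hL
  obtain ⟨M, hM, hMacc⟩ := hL
  obtain ⟨T, hT⟩ := id hM
  -- The paths of `M` vary in length up to `T`. Writing a path `w` as `0…01w` brings it to length `T
  -- + 1` in exactly one way, so the refutation stays unique.
  refine ⟨T + 1, fun q => q.2.elem true && decide (unpad q.2 ∈ M.acc q.1),
    (elem_true snd).and ((M.pt_acc hM).comp (fst.pair (PT.unpad.comp snd))), fun s => ⟨?_, ?_⟩⟩
  · rintro w ⟨hw, hw'⟩ v ⟨hv, hv'⟩
    simp only [Bool.and_eq_true, List.elem_eq_mem, decide_eq_true_eq] at hw' hv'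
    obtain ⟨i, hi⟩ := exists_eq_zeros_append hw'.1
    obtain ⟨j, hj⟩ := exists_eq_zeros_append hv'.1
    have e := (hMacc s).1 hw'.2 hv'.2
    rw [e] at hi
    have := congrArg List.length hi
    have := congrArg List.length hj
    simp at *
    obtain rfl : i = j := by omega
    exact hi.trans hj.symm
  · have h1 := (hMacc s).2
    rw [Set.mem_compl_iff, Set.mem_ofPred_eq] at h1
    rw [h1]
    constructor
    · rintro ⟨w, -, hw⟩
      simp only [Bool.and_eq_true, List.elem_eq_mem, decide_eq_true_eq] at hw
      exact ⟨_, hw.2⟩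
    · rintro ⟨w, hw⟩
      obtain ⟨n, c, h, -⟩ := id hw
      have := h.length_le.trans (hT _ _ _ _ h)
      refine ⟨zeros (T.eval s.length - w.length) ++ true :: w, ?_, ?_⟩
      · simp; omega
      · simp [unpad_zeros, hw]

end ClusterComputing

/-! ### The lexicographical order expressed by binary values. -/

namespace ClusterComputing

set_option linter.unusedSectionVars false

/-! ### Positions in the lexicographical order -/

/-- The number with a given binary representation. -/
def val : List Bool → ℕ
  | [] => 0
  | b :: l => b.toNat * 2 ^ l.length + val l

theorem val_append (l m : List Bool) : val (l ++ m) = val l * 2 ^ m.length + val m := by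
  induction l with
  | nil => simp [val]
  | cons b l ih => simp [val, ih, pow_add]; ring

theorem val_lt (l : List Bool) : val l < 2 ^ l.length := by
  induction l with
  | nil => simp [val]
  | cons b l ih => cases b <;> simp [val, pow_succ] <;> omega

theorem val_injective {l m : List Bool} (h : l.length = m.length) (hv : val l = val m) :
    l = m := by
  induction l generalizing m with
  | nil => exact (List.length_eq_zero_iff.1 h.symm).symm
  | cons a l ih =>
    rcases m with _ | ⟨b, m⟩
    · simp at h
    · simp only [List.length_cons, add_left_inj] at h
      have h1 := val_lt l
      have h2 := val_lt m
      rw [val, val, h] at hv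
      rw [h] at h1
      cases a <;> cases b <;> simp at hv
      · rw [ih h hv]
      · omega
      · omega
      · rw [ih h hv]

theorem exists_val_eq (n : ℕ) {i : ℕ} (hi : i < 2 ^ n) : ∃ l, l.length = n ∧ val l = i := by
  induction n generalizing i with
  | zero => exact ⟨[], rfl, by simp [val]; simp at hi; omega⟩
  | succ n ih =>
    rw [pow_succ] at hi
    by_cases h : i < 2 ^ n
    · obtain ⟨l, hl, hv⟩ := ih h
      exact ⟨false :: l, by simp [hl], by simp [val, hv]⟩
    · obtain ⟨l, hl, hv⟩ := ih (i := i - 2 ^ n) (by omega)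
      exact ⟨true :: l, by simp [hl], by simp [val, hv, hl]; omega⟩

theorem val_zeros (n : ℕ) : val (List.replicate n false) = 0 := by
  induction n with
  | zero => rfl
  | succ n ih => simp [List.replicate_succ, val, ih]

theorem val_ones (n : ℕ) : val (List.replicate n true) + 1 = 2 ^ n := by
  induction n with
  | zero => rfl
  | succ n ih => simp [List.replicate_succ, val, pow_succ]; omega

theorem lexLT_iff {l m : List Bool} (h : l.length = m.length) : LexLT l m ↔ val l < val m := by
  rw [LexLT, List.shortlex_def]
  simp only [h, lt_irrefl, false_or, true_and]
  induction l generalizing m with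
  | nil => simp [(List.length_eq_zero_iff.1 h.symm), val]
  | cons a l ih =>
    rcases m with _ | ⟨b, m⟩
    · simp at h
    · simp only [List.length_cons, add_left_inj] at h
      have h1 := val_lt l
      have h2 := val_lt m
      have := ih h
      rw [val, val, h, List.cons_lex_cons_iff, this]
      rw [h] at h1
      cases a <;> cases b <;>
        simp [show ¬ true < false by decide] <;> omega

theorem lexLE_iff {l m : List Bool} (h : l.length = m.length) : LexLE l m ↔ val l ≤ val m := by
  rw [LexLE, lexLT_iff h, le_iff_lt_or_eq]
  exact or_congr_right ⟨fun e => e ▸ rfl, val_injective h⟩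

theorem lexSucc_iff {l m : List Bool} (h : l.length = m.length) :
    LexSucc l m ↔ val m = val l + 1 := by
  rw [LexSucc, lexLT_iff h]
  constructor
  · rintro ⟨h1, h2⟩
    by_contra h3
    have := val_lt m
    obtain ⟨c, hc, hv⟩ := exists_val_eq m.length (i := val l + 1) (by omega)
    refine h2 c ?_
    rw [lexLT_iff (h.trans hc.symm), lexLT_iff hc]
    omega
  · intro h1
    refine ⟨by omega, fun c ⟨h2, h3⟩ => ?_⟩
    -- Shorter strings come first, so a string between two of the same length has that length too.
    have hc : c.length = m.length := by
      have h4 := List.shortlex_def.1 h2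
      have h5 := List.shortlex_def.1 h3
      omega
    rw [lexLT_iff (h.trans hc.symm)] at h2
    rw [lexLT_iff hc] at h3
    omega

/-- `ρ` numbers the strings of length `n`. -/
def IsRank (n : ℕ) (ρ : List Bool → ℕ) : Prop := Set.BijOn ρ {w | w.length = n} (Set.Iio (2 ^ n))

theorem IsRank.eq_iff {n : ℕ} {ρ : List Bool → ℕ} (hρ : IsRank n ρ) {y z : List Bool}
    (hy : y.length = n) (hz : z.length = n) : ρ y = ρ z ↔ y = z :=
  ⟨fun h => hρ.2.1 hy hz h, fun h => h ▸ rfl⟩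

theorem isRank_val (n : ℕ) : IsRank n val := by
  refine ⟨fun w hw => ?_, fun w hw v hv => val_injective (hw.trans hv.symm), fun i hi => ?_⟩
  · have := val_lt w
    rwa [show w.length = n from hw] at this
  · exact exists_val_eq n hi

/-- The accepting paths of `M` on `x` are the strings with positions in an interval. -/
def Block (M : NTM) (x : List Bool) (n : ℕ) (ρ : List Bool → ℕ) : Prop :=
  ∃ l u : List Bool, l.length = n ∧ u.length = n ∧
    M.acc x = {w | w.length = n ∧ ρ l ≤ ρ w ∧ ρ w ≤ ρ u}

/-! ### Bijections of strings versus numberings of strings. -/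

section Transport

variable {n : ℕ} {h : List.Vector Bool n ≃ List.Vector Bool n} {ρ : List Bool → ℕ}

/-- Together with `exists_rank` this replaces the bijection `h` by the position `ρ` of each string,
so that orders can be treated by arithmetic and without vectors. -/
theorem exists_equiv (hρ : IsRank n ρ) : ∃ h : List.Vector Bool n ≃ List.Vector Bool n,
    ∀ w, val (h w).toList = ρ w.toList := by
  let e₁ : List.Vector Bool n ≃ Set.Iio (2 ^ n) := hρ.equiv
  let e₂ : List.Vector Bool n ≃ Set.Iio (2 ^ n) := (isRank_val n).equiv
  refine ⟨e₁.trans e₂.symm, fun w => ?_⟩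
  have : e₂ ((e₁.trans e₂.symm) w) = e₁ w := by simp
  exact congrArg Subtype.val this

theorem exists_rank (h : List.Vector Bool n ≃ List.Vector Bool n) : ∃ ρ, IsRank n ρ ∧
    ∀ w, val (h w).toList = ρ w.toList := by
  obtain ⟨ρ, e⟩ : ∃ ρ : List Bool → ℕ, ∀ w : List.Vector Bool n,
      val (h w).toList = ρ w.toList := by
    refine ⟨fun w => if hw : w.length = n then val (h ⟨w, hw⟩).toList else 0, ?_⟩
    rintro ⟨w, hw⟩
    simp [hw]
  refine ⟨ρ, ⟨?_, ?_, ?_⟩, e⟩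
  · intro w hw
    have h1 : val (h ⟨w, hw⟩).toList = ρ w := e _
    have h2 := val_lt (h ⟨w, hw⟩).toList
    rw [h1, List.Vector.toList_length] at h2
    exact h2
  · intro w hw v hv hwv
    have h1 : val (h ⟨w, hw⟩).toList = ρ w := e _
    have h2 : val (h ⟨v, hv⟩).toList = ρ v := e _
    rw [← h1, ← h2] at hwv
    exact congrArg Subtype.val (h.injective (Subtype.ext (val_injective
      ((List.Vector.toList_length _).trans (List.Vector.toList_length _).symm) hwv)))
  · intro i hi
    obtain ⟨l, hl, hv⟩ := exists_val_eq n hi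
    obtain ⟨v, rfl⟩ : ∃ v : List.Vector Bool n, v.toList = l := ⟨⟨l, hl⟩, rfl⟩
    refine ⟨(h.symm v).toList, List.Vector.toList_length _, ?_⟩
    rw [← e, Equiv.apply_symm_apply]
    exact hv

theorem lexSucc_iff_rank (hh : ∀ w, val (h w).toList = ρ w.toList) (y z : List.Vector Bool n) :
    LexSucc (h y).toList (h z).toList ↔ ρ z.toList = ρ y.toList + 1 := by
  rw [lexSucc_iff (by simp), hh, hh]

theorem clustered_iff_block (hh : ∀ w, val (h w).toList = ρ w.toList) (M : NTM) (x : List Bool) :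
    Clustered M x h ↔ Block M x n ρ := by
  have key : ∀ a b : List.Vector Bool n,
      LexLE (h a).toList (h b).toList ↔ ρ a.toList ≤ ρ b.toList := fun a b => by
    rw [lexLE_iff (by simp), hh, hh]
  have e : ∀ l u : List.Vector Bool n, {w | ∃ hw : w.length = n,
      LexLE (h l).toList (h ⟨w, hw⟩).toList ∧ LexLE (h ⟨w, hw⟩).toList (h u).toList} =
      {w | w.length = n ∧ ρ l.toList ≤ ρ w ∧ ρ w ≤ ρ u.toList} := by
    intro l u
    ext w
    exact ⟨fun ⟨hw, h1, h2⟩ => ⟨hw, (key l ⟨w, hw⟩).1 h1, (key ⟨w, hw⟩ u).1 h2⟩,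
      fun ⟨hw, h1, h2⟩ => ⟨hw, (key l ⟨w, hw⟩).2 h1, (key ⟨w, hw⟩ u).2 h2⟩⟩
  constructor
  · rintro ⟨l, u, hlu⟩
    exact ⟨l.toList, u.toList, by simp, by simp, hlu.trans (e l u)⟩
  · rintro ⟨l, u, hl, hu, hlu⟩
    exact ⟨⟨l, hl⟩, ⟨u, hu⟩, hlu.trans (e ⟨l, hl⟩ ⟨u, hu⟩).symm⟩

theorem eq_zeros_iff_rank (hh : ∀ w, val (h w).toList = ρ w.toList) (y : List.Vector Bool n) :
    (h y).toList = List.replicate n false ↔ ρ y.toList = 0 := by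
  rw [← hh]
  refine ⟨fun e => by rw [e, val_zeros], fun e => val_injective (by simp) ?_⟩
  rw [e, val_zeros]

theorem eq_ones_iff_rank (hh : ∀ w, val (h w).toList = ρ w.toList) (y : List.Vector Bool n) :
    (h y).toList = List.replicate n true ↔ ρ y.toList + 1 = 2 ^ n := by
  rw [← hh, ← val_ones]
  refine ⟨fun e => by rw [e], fun e => val_injective (by simp) (by omega)⟩

end Transport

/-! ### Polynomials -/

theorem isPolynomial_eval (T : Polynomial ℕ) : IsPolynomial fun n => T.eval n :=
  ⟨T.map (Nat.castRingHom ℚ), fun n => by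
    simp⟩

theorem IsPolynomial.add {p q : ℕ → ℕ} (hp : IsPolynomial p) (hq : IsPolynomial q) :
    IsPolynomial fun n => p n + q n := by
  obtain ⟨P, hP⟩ := hp
  obtain ⟨Q, hQ⟩ := hq
  exact ⟨P + Q, fun n => by simp [hP, hQ]⟩

theorem IsPolynomial.comp {p q : ℕ → ℕ} (hp : IsPolynomial p) (hq : IsPolynomial q) :
    IsPolynomial fun n => p (q n) := by
  obtain ⟨P, hP⟩ := hp
  obtain ⟨Q, hQ⟩ := hq
  exact ⟨P.comp Q, fun n => by simp [hP, hQ]⟩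

end ClusterComputing

/-! ### The cluster classes in arithmetical form, and orders composed of blocks. -/

namespace ClusterComputing

set_option linter.unusedSectionVars false

open PT

/-! ### The classes in terms of positions -/

theorem mem_cluSharpP {f : List Bool → ℕ} {p : ℕ → ℕ} (hp : IsPolynomial p) {M : NTM}
    (hM : M.IsPolyTime) (hMp : M.IsBalanced p) {b t : List Bool → List Bool} (hb : PT id id b)
    (ht : PT id id t) {adj : List Bool → List Bool → List Bool → Bool}
    (hadj : PT (prodEnc id (prodEnc id id)) bitEnc fun t => adj t.1 t.2.1 t.2.2)
    (h : ∀ x, ∃ ρ, IsRank (p x.length) ρ ∧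
      ((b x).length = p x.length ∧ ρ (b x) = 0) ∧
      ((t x).length = p x.length ∧ ρ (t x) + 1 = 2 ^ p x.length) ∧
      (∀ y z, y.length = p x.length → z.length = p x.length →
        (adj x y z = true ↔ ρ z = ρ y + 1)) ∧
      (f x ≠ 0 → Block M x (p x.length) ρ) ∧ (M.acc x).encard = f x) :
    f ∈ CLUSharpP := by
  refine ⟨p, hp, M, hM, hMp, b, mem_fpt_iff.2 hb, t, mem_fpt_iff.2 ht, adj,
    mem_polyPred₃_iff.2 hadj, fun x => ?_⟩
  obtain ⟨ρ, hρ, ⟨hb, hb0⟩, ⟨ht, ht1⟩, ha, hblock, hcard⟩ := h x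
  obtain ⟨e, he⟩ := exists_equiv hρ
  exact ⟨e, ⟨hb, ht, (eq_zeros_iff_rank he _).2 hb0, (eq_ones_iff_rank he _).2 ht1⟩,
    fun y z => (ha _ _ (by simp) (by simp)).trans (lexSucc_iff_rank he y z).symm,
    fun h0 => (clustered_iff_block he M x).2 (hblock h0), hcard⟩

theorem exists_rank_of_mem_free {f : List Bool → ℕ} (hf : f ∈ CLUSharpPFree) :
    ∃ p, IsPolynomial p ∧ ∃ M : NTM, M.IsPolyTime ∧ M.IsBalanced p ∧
      ∃ adj : List Bool → List Bool → List Bool → Bool,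
      PT (prodEnc id (prodEnc id id)) bitEnc (fun t => adj t.1 t.2.1 t.2.2) ∧
      ∀ x, ∃ ρ, IsRank (p x.length) ρ ∧
      (∀ y z, y.length = p x.length → z.length = p x.length →
        (adj x y z = true ↔ ρ z = ρ y + 1)) ∧
      (f x ≠ 0 → Block M x (p x.length) ρ) ∧ (M.acc x).encard = f x := by
  obtain ⟨p, hp, M, hM, hMp, adj, hadj, h⟩ := hf
  refine ⟨p, hp, M, hM, hMp, adj, mem_polyPred₃_iff.1 hadj, fun x => ?_⟩
  obtain ⟨e, ha, hblock, hcard⟩ := h x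
  obtain ⟨ρ, hρ, he⟩ := exists_rank e
  exact ⟨ρ, hρ, fun y z hy hz => (ha ⟨y, hy⟩ ⟨z, hz⟩).trans (lexSucc_iff_rank he _ _),
    fun h0 => (clustered_iff_block he M x).1 (hblock h0), hcard⟩

theorem exists_rank_of_mem_circular {f : List Bool → ℕ} (hf : f ∈ CLUSharpPCircular) :
    ∃ p, IsPolynomial p ∧ ∃ M : NTM, M.IsPolyTime ∧ M.IsBalanced p ∧
      ∃ adj : List Bool → List Bool → List Bool → Bool,
      PT (prodEnc id (prodEnc id id)) bitEnc (fun t => adj t.1 t.2.1 t.2.2) ∧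
      ∀ x, ∃ ρ, IsRank (p x.length) ρ ∧
      (∀ y z, y.length = p x.length → z.length = p x.length → (adj x y z = true ↔
        ρ z = ρ y + 1 ∨ ρ y + 1 = 2 ^ p x.length ∧ ρ z = 0)) ∧
      (f x ≠ 0 → Block M x (p x.length) ρ) ∧ (M.acc x).encard = f x := by
  obtain ⟨p, hp, M, hM, hMp, adj, hadj, h⟩ := hf
  refine ⟨p, hp, M, hM, hMp, adj, mem_polyPred₃_iff.1 hadj, fun x => ?_⟩
  obtain ⟨e, ha, hblock, hcard⟩ := h x
  obtain ⟨ρ, hρ, he⟩ := exists_rank e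
  exact ⟨ρ, hρ, fun y z hy hz => (ha ⟨y, hy⟩ ⟨z, hz⟩).trans
    (or_congr (lexSucc_iff_rank he _ _)
      (and_congr (eq_ones_iff_rank he _) (eq_zeros_iff_rank he _))),
    fun h0 => (clustered_iff_block he M x).1 (hblock h0), hcard⟩

theorem cluSharpP_subset_free : CLUSharpP ⊆ CLUSharpPFree := by
  rintro f ⟨p, hp, M, hM, hMp, b, -, t, -, adj, hadj, h⟩
  refine ⟨p, hp, M, hM, hMp, adj, hadj, fun x => ?_⟩
  obtain ⟨e, -, h'⟩ := h x
  exact ⟨e, h'⟩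

/-- With computable bottom and top, the single wrap-around pair can be recognized and added to the
adjacency predicate. -/
theorem cluSharpP_subset_circular : CLUSharpP ⊆ CLUSharpPCircular := by
  rintro f ⟨p, hp, M, hM, hMp, b, hb, t, ht, adj, hadj, h⟩
  rw [mem_fpt_iff] at hb ht
  rw [mem_polyPred₃_iff] at hadj
  refine ⟨p, hp, M, hM, hMp, fun x y z => adj x y z || (y == t x && z == b x),
    mem_polyPred₃_iff.2 (hadj.or ((beq (fst.comp snd) (ht.comp fst)).and
      (beq (snd.comp snd) (hb.comp fst)))), fun x => ?_⟩
  obtain ⟨e, ⟨hbx, htx, hb0, ht1⟩, ha, hrest⟩ := h x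
  refine ⟨e, fun y z => ?_, hrest⟩
  have key : ∀ (y : List.Vector Bool (p x.length)) (l : List Bool) (hl : l.length = p x.length),
      y.toList = l ↔ (e y).toList = (e ⟨l, hl⟩).toList := by
    rintro y l hl
    refine ⟨fun h => ?_, fun h => ?_⟩
    · rw [show y = ⟨l, hl⟩ from Subtype.ext h]
    · rw [e.injective (Subtype.ext h)]; rfl
  rw [Bool.or_eq_true, Bool.and_eq_true, beq_iff_eq, beq_iff_eq, ha, key y _ htx, key z _ hbx,
    hb0, ht1]

/-! ### Deciding immediate succession -/

/-- One step of the automaton that compares the binary representations of two numbers; it keeps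
track of whether they are equal, or the second one is larger by one. -/
def succStep (q : Bool × Bool) (s : Bool × Bool) : Bool × Bool :=
  (q.1 && s.1 == s.2, q.1 && !s.1 && s.2 || q.2 && s.1 && !s.2)

/-- Appending bits `a`, `b` to numbers `u`, `v` gives `2v + b = 2u + a + 1` exactly if `v = u`, `a =
0`, `b = 1`, or `v = u + 1`, `a = 1`, `b = 0`. Hence the induction from the right end. -/
theorem foldl_succStep (l : List (Bool × Bool)) :
    (l.foldl succStep (true, false)).1 = decide (val (l.map Prod.fst) = val (l.map Prod.snd)) ∧
    (l.foldl succStep (true, false)).2 =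
      decide (val (l.map Prod.snd) = val (l.map Prod.fst) + 1) := by
  induction l using List.reverseRecOn with
  | nil => exact ⟨rfl, rfl⟩
  | append_singleton l s ih =>
    obtain ⟨a, b⟩ := s
    rw [List.foldl_append, List.foldl_cons, List.foldl_nil, succStep, ih.1, ih.2]
    rw [Bool.eq_iff_iff, Bool.eq_iff_iff]
    cases a <;> cases b <;> simp [val_append, val] <;> omega

theorem exists_pt_succ {α A : Type} {ea : α → List A} [Fintype A] :
    ∃ s : List Bool → List Bool → Bool,
      (∀ y z, y.length = z.length → (s y z = true ↔ val z = val y + 1)) ∧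
      ∀ {f g : α → List Bool}, PT ea id f → PT ea id g → PT ea bitEnc fun a => s (f a) (g a) := by
  refine ⟨fun y z => ((y.zip z).foldl succStep (true, false)).2, fun y z h => ?_,
    fun hf hg => zipFold (true, false) succStep hf hg fun q => q.2⟩
  beta_reduce
  rw [(foldl_succStep _).2, decide_eq_true_iff, List.map_fst_zip h.le, List.map_snd_zip h.ge]

/-! ### Refining the numbering by blocks -/

theorem block_le {P a b i j : ℕ} (hj : j < P) (h : a * P + i ≤ b * P + j) : a ≤ b := by
  by_contra hab
  have := Nat.mul_le_mul_right P (show b + 1 ≤ a by omega)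
  rw [Nat.succ_mul] at this
  omega

theorem block_succ_iff {P a b i j : ℕ} (hi : i < P) (hj : j < P) :
    b * P + j = a * P + i + 1 ↔ a = b ∧ j = i + 1 ∨ b = a + 1 ∧ i + 1 = P ∧ j = 0 := by
  constructor
  · intro h
    have h1 := block_le (i := i) (a := a) (b := b) hj (by omega)
    rcases h1.eq_or_lt with rfl | h1
    · exact .inl ⟨rfl, by omega⟩
    · have := Nat.mul_le_mul_right P (show a + 1 ≤ b from h1)
      rw [Nat.succ_mul] at this
      obtain rfl : b = a + 1 := by
        by_contra h2
        have := Nat.mul_le_mul_right P (show a + 1 + 1 ≤ b by omega)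
        rw [Nat.succ_mul, Nat.succ_mul] at this
        omega
      rw [Nat.succ_mul] at h
      exact .inr ⟨rfl, by omega, by omega⟩
  · rintro (⟨rfl, rfl⟩ | ⟨rfl, hi, rfl⟩)
    · omega
    · rw [Nat.succ_mul]; omega

/-- Division by `2 ^ p` with remainder recovers the block and the position in it; the numberings
inside different blocks may be unrelated. -/
theorem isRank_blocks {r p : ℕ} {σ : List Bool → List Bool → ℕ}
    (hσ : ∀ c, c.length = r → IsRank p (σ c)) :
    IsRank (r + p) fun w => val (w.take r) * 2 ^ p + σ (w.take r) (w.drop r) := by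
  have hlen : ∀ w : List Bool, w.length = r + p →
      (w.take r).length = r ∧ (w.drop r).length = p := by
    intro w hw
    simp [hw]
  have hlt : ∀ w : List Bool, w.length = r + p → σ (w.take r) (w.drop r) < 2 ^ p :=
    fun w hw => (hσ _ (hlen w hw).1).1 (hlen w hw).2
  refine ⟨fun w hw => ?_, fun w hw v hv h => ?_, fun i hi => ?_⟩
  · have h1 := val_lt (w.take r)
    rw [(hlen w hw).1] at h1
    have h2 := Nat.mul_le_mul_right (2 ^ p) (Nat.succ_le_of_lt h1)
    have h3 := hlt w hw
    rw [Nat.succ_mul] at h2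
    rw [Set.mem_Iio, pow_add]
    beta_reduce
    omega
  · have hw' := hlen w hw
    have hv' := hlen v hv
    dsimp only at h
    have h1 := le_antisymm (block_le (hlt v hv) h.le) (block_le (hlt w hw) h.ge)
    have h2 := val_injective (hw'.1.trans hv'.1.symm) h1
    rw [h2] at h
    have h3 := (hσ _ hv'.1).2.1 hw'.2 hv'.2 (by simpa using h)
    rw [← List.take_append_drop r w, h2, h3, List.take_append_drop]
  · rw [Set.mem_Iio, pow_add] at hi
    obtain ⟨c, hc, hcv⟩ := exists_val_eq r (i := i / 2 ^ p) (Nat.div_lt_of_lt_mul (by rwa [mul_comm]))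
    obtain ⟨y, hy, hyv⟩ := (hσ c hc).2.2 (show i % 2 ^ p ∈ Set.Iio (2 ^ p) from
      Nat.mod_lt _ (by positivity))
    refine ⟨c ++ y, by simp [hc, show y.length = p from hy], ?_⟩
    simp only [← hc, List.take_left, List.drop_left]
    rw [hcv, hyv, Nat.div_add_mod']

end ClusterComputing

namespace ClusterComputing

set_option linter.unusedSectionVars false

open PT

/-! ### Bottom and top elements from unique certificates -/

/-- If the bottom and the top of the order and the successor predicate can be computed from a
certificate that is unique, then the certificates can be made part of the paths. -/
theorem mem_cluSharpP_of_certificate {f : List Bool → ℕ} {p r : ℕ → ℕ} (hp : IsPolynomial p)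
    (hr : IsPolynomial r) (hpr : PT (id : List Bool → List Bool) id fun x => zeros (r x.length))
    {M : NTM} (hM : M.IsPolyTime) (hMp : M.IsBalanced p) {V : List Bool × List Bool → Bool}
    (hV : PT (prodEnc id id) bitEnc V) {S E : List Bool × List Bool → List Bool}
    (hS : PT (prodEnc id id) id S) (hE : PT (prodEnc id id) id E)
    {adj : List Bool → List Bool → List Bool → Bool}
    (hadj : PT (prodEnc id (prodEnc id id)) bitEnc fun t => adj t.1 t.2.1 t.2.2)
    (h : ∀ x, ∃ c₀, c₀.length = r x.length ∧
      (∀ c, c.length = r x.length → (V (x, c) = true ↔ c = c₀)) ∧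
      ∃ ρ, IsRank (p x.length) ρ ∧
      ((S (x, c₀)).length = p x.length ∧ ρ (S (x, c₀)) = 0) ∧
      ((E (x, c₀)).length = p x.length ∧ ρ (E (x, c₀)) + 1 = 2 ^ p x.length) ∧
      -- Excluding pairs that end in the bottom turns a circular adjacency into a linear one and
      -- does not change a linear one, so the lemma serves both cases.
      (∀ y z, y.length = p x.length → z.length = p x.length →
        (adj x y z = true ∧ z ≠ S (x, c₀) ↔ ρ z = ρ y + 1)) ∧
      (f x ≠ 0 → Block M x (p x.length) ρ) ∧ (M.acc x).encard = f x) :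
    f ∈ CLUSharpP := by
  classical
  obtain ⟨succ, hsucc, hpsucc⟩ := exists_pt_succ (A := Bool ⊕ (Bool ⊕ Bool))
    (ea := prodEnc (id : List Bool → List Bool) (prodEnc (id : List Bool → List Bool)
      (id : List Bool → List Bool)))
  have hpp := hMp.pt hM
  have hq := zeros_add hpr hpp
  -- the cut of a path into the certificate and a path of the given machine
  have htake : PT (prodEnc (id : List Bool → List Bool) (id : List Bool → List Bool)) id
      fun t => t.2.take (r t.1.length) := by
    simpa using take (hpr.comp fst) (snd (ea := (id : List Bool → List Bool)))
  have hdrop : PT (prodEnc (id : List Bool → List Bool) (id : List Bool → List Bool)) id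
      fun t => t.2.drop (r t.1.length) := by
    simpa using drop (hpr.comp fst) (snd (ea := (id : List Bool → List Bool)))
  -- The new machine accepts `c ++ y` if `c` is the valid certificate and `y` is an accepting path
  -- of `M`.
  obtain ⟨N, hN, hNacc⟩ := exists_ntm (R := fun t => V (t.1, t.2.take (r t.1.length)) &&
    decide (t.2.drop (r t.1.length) ∈ M.acc t.1)) hq
    ((hV.comp (fst.pair htake)).and ((M.pt_acc hM).comp (fst.pair hdrop)))
  simp only [List.length_replicate, Bool.and_eq_true, decide_eq_true_eq] at hNacc
  -- the bottom and the top
  have hedge : ∀ (b : Bool) {F : List Bool × List Bool → List Bool}, PT (prodEnc id id) id F →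
      PT (id : List Bool → List Bool) id fun x => List.replicate (r x.length) b ++
        if V (x, List.replicate (r x.length) b) then F (x, List.replicate (r x.length) b)
        else List.replicate (p x.length) b := by
    intro b F hF
    have h1 : PT (id : List Bool → List Bool) id fun x => List.replicate (r x.length) b := by
      simpa using map (fun _ => b) hpr
    have h2 : PT (id : List Bool → List Bool) id fun x => List.replicate (p x.length) b := by
      simpa using map (fun _ => b) hpp
    exact h1.append (cond (hV.comp (refl.pair h1)) (hF.comp (refl.pair h1)) h2)
  -- the successor predicate
  let adj' : List Bool → List Bool → List Bool → Bool := fun x w v =>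
    (w.take (r x.length) == v.take (r x.length) &&
      if V (x, w.take (r x.length)) then
        adj x (w.drop (r x.length)) (v.drop (r x.length)) &&
          !(v.drop (r x.length) == S (x, w.take (r x.length)))
      else succ (w.drop (r x.length)) (v.drop (r x.length))) ||
    (succ (w.take (r x.length)) (v.take (r x.length)) &&
      (w.drop (r x.length) == if V (x, w.take (r x.length)) then E (x, w.take (r x.length))
        else List.replicate (p x.length) true) &&
      (v.drop (r x.length) == if V (x, v.take (r x.length)) then S (x, v.take (r x.length))
        else List.replicate (p x.length) false))
  have hadj' : PT (prodEnc id (prodEnc id id)) bitEnc fun t => adj' t.1 t.2.1 t.2.2 := by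
    have hx : PT (prodEnc (id : List Bool → List Bool) (prodEnc (id : List Bool → List Bool)
      (id : List Bool → List Bool))) id fun t => t.1 := fst
    have hw : PT (prodEnc (id : List Bool → List Bool) (prodEnc (id : List Bool → List Bool)
      (id : List Bool → List Bool))) (prodEnc id id) fun t => (t.1, t.2.1) :=
      fst.pair (fst.comp snd)
    have hv : PT (prodEnc (id : List Bool → List Bool) (prodEnc (id : List Bool → List Bool)
      (id : List Bool → List Bool))) (prodEnc id id) fun t => (t.1, t.2.2) :=
      fst.pair (snd.comp snd)
    have hwt := htake.comp hw
    have hwd := hdrop.comp hw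
    have hvt := htake.comp hv
    have hvd := hdrop.comp hv
    have h1 : PT (prodEnc (id : List Bool → List Bool) (prodEnc (id : List Bool → List Bool)
      (id : List Bool → List Bool))) id fun t => List.replicate (p t.1.length) true := by
      simpa using map (fun _ => true) (hpp.comp hx)
    exact (((beq hwt hvt).and (cond (hV.comp (hx.pair hwt))
      ((hadj.comp (hx.pair (hwd.pair hvd))).and (beq hvd (hS.comp (hx.pair hwt))).not)
      (hpsucc hwd hvd))).or (((hpsucc hwt hvt).and (beq hwd (cond (hV.comp (hx.pair hwt))
        (hE.comp (hx.pair hwt)) h1))).and (beq hvd (cond (hV.comp (hx.pair hvt))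
        (hS.comp (hx.pair hvt)) (hpp.comp hx)))))
  refine mem_cluSharpP (hr.add hp) hN (fun x => by simp [(hNacc x).1])
    (hedge false hS) (hedge true hE) hadj' fun x => ?_
  obtain ⟨c₀, hc₀, hVx, ρ, hρ, ⟨hS₀, hρS⟩, ⟨hE₀, hρE⟩, hadjx, hblock, hcard⟩ := h x
  clear hedge hadj' hpsucc htake hdrop hq hpp hadj hS hE hV hpr h hr hp
  set P := p x.length
  set n := r x.length
  -- The order inside block `c`. An invalid `c` says nothing about `ρ`, but its block can be ordered
  -- lexicographically, so `hbot` and `htop` identify both ends of every block.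
  let σ : List Bool → List Bool → ℕ := fun c => if V (x, c) then ρ else val
  have hσ : ∀ c, c.length = n → IsRank P (σ c) := by
    intro c _
    by_cases hc : V (x, c) = true
    · simpa only [σ, if_pos hc] using hρ
    · simpa only [σ, if_neg hc] using isRank_val P
  have hσ₀ : σ c₀ = ρ := if_pos ((hVx c₀ hc₀).2 rfl)
  have hbot : ∀ c y, c.length = n → y.length = P →
      (y = (if V (x, c) then S (x, c) else List.replicate P false) ↔ σ c y = 0) := by
    intro c y hc hy
    by_cases hV : V (x, c) = true
    · obtain rfl := (hVx c hc).1 hV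
      rw [if_pos hV, hσ₀, ← hρS, hρ.eq_iff hy hS₀]
    · simp only [σ, if_neg hV]
      rw [← val_zeros P, (isRank_val P).eq_iff hy (by simp)]
  have htop : ∀ c y, c.length = n → y.length = P →
      (y = (if V (x, c) then E (x, c) else List.replicate P true) ↔ σ c y + 1 = 2 ^ P) := by
    intro c y hc hy
    by_cases hV : V (x, c) = true
    · obtain rfl := (hVx c hc).1 hV
      rw [if_pos hV, hσ₀, ← hρE, add_left_inj, hρ.eq_iff hy hE₀]
    · simp only [σ, if_neg hV]
      rw [← val_ones P, add_left_inj, (isRank_val P).eq_iff hy (by simp)]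
  have hacc : ∀ w, w ∈ N.acc x ↔ ∃ y ∈ M.acc x, w = c₀ ++ y := by
    intro w
    rw [(hNacc x).2]
    constructor
    · rintro ⟨hw, hV, hy⟩
      refine ⟨_, hy, ?_⟩
      rw [← (hVx _ (by simp [hw, n])).1 hV, List.take_append_drop]
    · rintro ⟨y, hy, rfl⟩
      have hyP : y.length = P := by
        obtain ⟨k, c, hrun, hc, -⟩ := id hy
        have : y ∈ M.paths x := ⟨k, c, hrun, hc⟩
        rwa [hMp x] at this
      have h1 : (c₀ ++ y).take n = c₀ := by rw [← hc₀, List.take_left]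
      have h2 : (c₀ ++ y).drop n = y := by rw [← hc₀, List.drop_left]
      exact ⟨by simp [hc₀, hyP, n, P], by rw [h1]; exact (hVx c₀ hc₀).2 rfl, by rwa [h2]⟩
  refine ⟨_, isRank_blocks hσ, ?_, ?_, ?_, ?_, ?_⟩
  · have h1 : (if V (x, List.replicate n false) then S (x, List.replicate n false)
        else List.replicate P false).length = P := by
      split_ifs with hV
      · rw [(hVx _ (by simp)).1 hV, hS₀]
      · simp
    refine ⟨by rw [List.length_append, h1, List.length_replicate], ?_⟩
    have h2 := (hbot _ _ (List.length_replicate (n := n) (a := false)) h1).1 rfl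
    rw [List.take_left' (by simp), List.drop_left' (by simp), val_zeros, h2, zero_mul]
  · have h1 : (if V (x, List.replicate n true) then E (x, List.replicate n true)
        else List.replicate P true).length = P := by
      split_ifs with hV
      · rw [(hVx _ (by simp)).1 hV, hE₀]
      · simp
    refine ⟨by rw [List.length_append, h1, List.length_replicate], ?_⟩
    have h2 := (htop _ _ (List.length_replicate (n := n) (a := true)) h1).1 rfl
    rw [List.take_left' (by simp), List.drop_left' (by simp), add_assoc, h2, pow_add,
      ← val_ones n]
    ring
  · intro w v hw hv
    have hw1 : (w.take n).length = n := by simp [hw, n]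
    have hv1 : (v.take n).length = n := by simp [hv, n]
    have hw2 : (w.drop n).length = P := by simp [hw, n, P]
    have hv2 : (v.drop n).length = P := by simp [hv, n, P]
    rw [block_succ_iff ((hσ _ hw1).1 hw2) ((hσ _ hv1).1 hv2)]
    simp only [adj', show r x.length = n from rfl, Bool.or_eq_true, Bool.and_eq_true, beq_iff_eq]
    rw [hsucc _ _ (hw1.trans hv1.symm), hbot _ _ hv1 hv2, htop _ _ hw1 hw2, and_assoc,
      show val (w.take n) = val (v.take n) ↔ w.take n = v.take n from
        (isRank_val n).eq_iff hw1 hv1]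
    -- Transitions between blocks are settled by `hbot` and `htop`; adjacency inside one block
    -- remains.
    refine or_congr_left (and_congr_right fun hc => ?_)
    rw [← hc]
    by_cases hV : V (x, w.take n) = true
    · obtain hc' := (hVx _ hw1).1 hV
      rw [if_pos hV, hc', hσ₀, ← hadjx _ _ hw2 hv2]
      simp
    · simp only [σ, if_neg hV]
      exact hsucc _ _ (hw2.trans hv2.symm)
  · intro h0
    obtain ⟨l, u, hl, hu, hlu⟩ := hblock h0
    refine ⟨c₀ ++ l, c₀ ++ u, by simp [hc₀, hl, n, P], by simp [hc₀, hu, n, P], ?_⟩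
    ext w
    rw [hacc, hlu]
    simp only [List.take_left' hc₀, List.drop_left' hc₀, hσ₀]
    constructor
    · rintro ⟨y, ⟨hy, h1, h2⟩, rfl⟩
      refine ⟨by simp [hc₀, hy, n, P], ?_⟩
      rw [List.take_left' hc₀, List.drop_left' hc₀, hσ₀]
      exact ⟨by omega, by omega⟩
    · rintro ⟨hw, h1, h2⟩
      have hw1 : (w.take n).length = n := by simp [hw, n]
      have hw2 : (w.drop n).length = P := by simp [hw, n, P]
      -- A path between two strings of the block of `c₀` belongs to this block.
      have h3 := val_injective (hc₀.trans hw1.symm) (le_antisymm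
        (block_le ((hσ _ hw1).1 hw2) h1) (block_le (hρ.1 hu) h2))
      rw [← h3, hσ₀] at h1 h2
      refine ⟨w.drop n, ⟨hw2, by omega, by omega⟩, ?_⟩
      rw [h3, List.take_append_drop]
  · rw [← hcard, ← (List.append_right_injective c₀).encard_image (M.acc x)]
    congr 1
    ext w
    rw [hacc]
    exact ⟨fun ⟨y, hy, e⟩ => ⟨y, hy, e.symm⟩, fun ⟨y, hy, e⟩ => ⟨y, hy, e.symm⟩⟩

end ClusterComputing

namespace ClusterComputing

set_option linter.unusedSectionVars false

open PT

/-! ### Unrestricted orders -/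

/-- A pair must be coded as one string to speak of membership in UP. The added test on the length of
the second component makes witnesses unique for all strings, not only for proper codes. -/
theorem exists_refutation_of_pair (hUP : UP = coUP) {p : ℕ → ℕ}
    (hp : PT (id : List Bool → List Bool) id fun x => zeros (p x.length))
    {B : List Bool → List Bool → List Bool → Bool}
    (hB : PT (prodEnc id (prodEnc id id)) bitEnc fun t => B t.1 t.2.1 t.2.2)
    (huniq : ∀ x y, y.length = p x.length →
      {z | z.length = p x.length ∧ B x y z = true}.Subsingleton) :
    ∃ (m : Polynomial ℕ) (W : List Bool → List Bool → List Bool → Bool),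
      PT (prodEnc id (prodEnc id id)) bitEnc (fun t => W t.1 t.2.1 t.2.2) ∧
      ∀ x y, y.length = p x.length →
        {w | w.length = m.eval (2 * (x.length + p x.length)) ∧ W x y w = true}.Subsingleton ∧
        ((∃ w, w.length = m.eval (2 * (x.length + p x.length)) ∧ W x y w = true) ↔
          ¬ ∃ z, z.length = p x.length ∧ B x y z = true) := by
  have hx := PT.decode false
  have hy := PT.decode true
  have hlen := hp.comp hx
  obtain ⟨m, W, hW, h⟩ := exists_refutation hUP hlen
    (R := fun t => zeros (decode true t.1).length == zeros (p (decode false t.1).length) &&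
      B (decode false t.1) (decode true t.1) t.2)
    ((beq (zeros_length (hy.comp fst)) (hlen.comp fst)).and
      (hB.comp ((hx.comp fst).pair ((hy.comp fst).pair snd)))) (by
    rintro s z ⟨hz, hz'⟩ v ⟨hv, hv'⟩
    simp only [Bool.and_eq_true, beq_iff_eq] at hz' hv'
    have := congrArg List.length hz'.1
    simp only [List.length_replicate] at hz hv this
    exact huniq _ _ this ⟨hz, hz'.2⟩ ⟨hv, hv'.2⟩)
  refine ⟨m, fun x y w => W (code x y, w), hW.comp ((pair_code fst (fst.comp snd)).pair
    (snd.comp snd)), fun x y hy => ?_⟩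
  have := h (code x y)
  simpa [length_code, decode_false_code, decode_true_code, hy] using this

theorem exists_append_of_length {α : Type} {c : List α} {a b : ℕ} (h : c.length = a + b) :
    ∃ u v, c = u ++ v ∧ u.length = a ∧ v.length = b :=
  ⟨c.take a, c.drop a, (List.take_append_drop a c).symm, by simp [h], by simp [h]⟩

/-- The certificate consists of the top, the bottom, a refutation of a predecessor of the bottom,
and one of a successor of the top. The ends are determined by the order and the refutations are
unique, so there is exactly one valid certificate. -/
theorem free_subset_cluSharpP (hUP : UP = coUP) : CLUSharpPFree ⊆ CLUSharpP := by
  intro f hf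
  obtain ⟨p, hp, M, hM, hMp, adj, hadj, h⟩ := exists_rank_of_mem_free hf
  have hpp := hMp.pt hM
  choose ρ hρ hadjx hblock hcard using h
  -- With the arguments exchanged, `W₀` refutes predecessors; `W₁` refutes successors.
  obtain ⟨m₀, W₀, hW₀, hm₀⟩ := exists_refutation_of_pair hUP hpp
    (B := fun x y z => adj x z y) (hadj.comp (fst.pair ((snd.comp snd).pair (fst.comp snd)))) (by
      rintro x y hy z ⟨hz, hz'⟩ v ⟨hv, hv'⟩
      rw [hadjx x _ _ hz hy] at hz'
      rw [hadjx x _ _ hv hy] at hv'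
      exact ((hρ x).eq_iff hz hv).1 (by omega))
  obtain ⟨m₁, W₁, hW₁, hm₁⟩ := exists_refutation_of_pair hUP hpp (B := adj) hadj (by
      rintro x y hy z ⟨hz, hz'⟩ v ⟨hv, hv'⟩
      rw [hadjx x _ _ hy hz] at hz'
      rw [hadjx x _ _ hy hv] at hv'
      exact ((hρ x).eq_iff hz hv).1 (by omega))
  have hn : IsPolynomial fun n => 2 * (n + p n) := by
    obtain ⟨P, hP⟩ := hp
    exact ⟨2 * (.X + P), fun n => by simp [hP]⟩
  have hpn : PT (id : List Bool → List Bool) id fun x => zeros (2 * (x.length + p x.length)) :=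
    zeros_mul (const (zeros 2)) (zeros_add (zeros_length refl) hpp)
  have hpm₀ := zeros_eval m₀ hpn
  have hpm₁ := zeros_eval m₁ hpn
  have hE : PT (prodEnc (id : List Bool → List Bool) (id : List Bool → List Bool)) id
      fun t => t.2.take (p t.1.length) := by
    simpa using take (hpp.comp fst) (snd (ea := (id : List Bool → List Bool)))
  have hE' : PT (prodEnc (id : List Bool → List Bool) (id : List Bool → List Bool)) id
      fun t => t.2.drop (p t.1.length) := by
    simpa using drop (hpp.comp fst) (snd (ea := (id : List Bool → List Bool)))
  have hS := hE.comp (fst.pair hE')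
  have hS' := hE'.comp (fst.pair hE')
  have hw₀ : PT (prodEnc (id : List Bool → List Bool) (id : List Bool → List Bool)) id
      fun t => ((t.2.drop (p t.1.length)).drop (p t.1.length)).take
        (m₀.eval (2 * (t.1.length + p t.1.length))) := by
    simpa using take (hpm₀.comp fst) hS'
  have hw₁ : PT (prodEnc (id : List Bool → List Bool) (id : List Bool → List Bool)) id
      fun t => ((t.2.drop (p t.1.length)).drop (p t.1.length)).drop
        (m₀.eval (2 * (t.1.length + p t.1.length))) := by
    simpa using drop (hpm₀.comp fst) hS'
  refine mem_cluSharpP_of_certificate hp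
    (hp.add (hp.add (((isPolynomial_eval m₀).comp hn).add ((isPolynomial_eval m₁).comp hn))))
    (zeros_add hpp (zeros_add hpp (zeros_add hpm₀ hpm₁))) hM hMp
    ((hW₀.comp (fst.pair (hS.pair hw₀))).and (hW₁.comp (fst.pair (hE.pair hw₁)))) hS hE hadj
    fun x => ?_
  obtain ⟨s₀, hs₀, hs₀'⟩ := (hρ x).2.2 (show 0 ∈ Set.Iio _ by simp)
  obtain ⟨e₀, he₀, he₀'⟩ := (hρ x).2.2 (show 2 ^ p x.length - 1 ∈ Set.Iio _ by simp)
  rw [Set.mem_ofPred_eq] at hs₀ he₀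
  have hpos : 0 < 2 ^ p x.length := by positivity
  have hpred : ∀ s, s.length = p x.length →
      ((¬ ∃ z, z.length = p x.length ∧ adj x z s = true) ↔ s = s₀) := by
    intro s hs
    rw [← (hρ x).eq_iff hs hs₀, hs₀']
    constructor
    · intro hno
      by_contra h0
      have := (hρ x).1 hs
      rw [Set.mem_Iio] at this
      obtain ⟨z, hz, hz'⟩ := (hρ x).2.2 (show ρ x s - 1 ∈ Set.Iio _ by rw [Set.mem_Iio]; omega)
      exact hno ⟨z, hz, (hadjx x _ _ hz hs).2 (by omega)⟩
    · rintro h0 ⟨z, hz, hz'⟩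
      rw [hadjx x _ _ hz hs] at hz'
      omega
  have hsucc : ∀ e, e.length = p x.length →
      ((¬ ∃ z, z.length = p x.length ∧ adj x e z = true) ↔ e = e₀) := by
    intro e he
    have hlt := (hρ x).1 he
    rw [Set.mem_Iio] at hlt
    rw [← (hρ x).eq_iff he he₀, he₀']
    constructor
    · intro hno
      by_contra h0
      obtain ⟨z, hz, hz'⟩ := (hρ x).2.2 (show ρ x e + 1 ∈ Set.Iio _ by rw [Set.mem_Iio]; omega)
      exact hno ⟨z, hz, (hadjx x _ _ he hz).2 (by omega)⟩
    · rintro h0 ⟨z, hz, hz'⟩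
      have := (hρ x).1 hz
      rw [hadjx x _ _ he hz] at hz'
      rw [Set.mem_Iio] at this
      omega
  obtain ⟨w₀, hlw₀, hw₀'⟩ := (hm₀ x s₀ hs₀).2.2 ((hpred s₀ hs₀).2 rfl)
  obtain ⟨w₁, hlw₁, hw₁'⟩ := (hm₁ x e₀ he₀).2.2 ((hsucc e₀ he₀).2 rfl)
  refine ⟨e₀ ++ (s₀ ++ (w₀ ++ w₁)), by simp [he₀, hs₀, hlw₀, hlw₁], fun c hc => ?_, ρ x, hρ x,
    ?_, ?_, fun y z hy hz => ?_, hblock x, hcard x⟩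
  · obtain ⟨e, c, rfl, he, hc⟩ := exists_append_of_length hc
    obtain ⟨s, c, rfl, hs, hc⟩ := exists_append_of_length hc
    obtain ⟨w, v, rfl, hw, hv⟩ := exists_append_of_length hc
    simp only [List.take_left' he, List.drop_left' he, List.take_left' hs, List.drop_left' hs,
      List.take_left' hw, List.drop_left' hw, Bool.and_eq_true]
    constructor
    · rintro ⟨h1, h2⟩
      obtain rfl := (hpred s hs).1 ((hm₀ x s hs).2.1 ⟨w, hw, h1⟩)
      obtain rfl := (hsucc e he).1 ((hm₁ x e he).2.1 ⟨v, hv, h2⟩)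
      rw [(hm₀ x s hs).1 ⟨hw, h1⟩ ⟨hlw₀, hw₀'⟩, (hm₁ x e he).1 ⟨hv, h2⟩ ⟨hlw₁, hw₁'⟩]
    · intro h1
      obtain ⟨rfl, h2⟩ := List.append_inj h1 (he.trans he₀.symm)
      obtain ⟨rfl, h3⟩ := List.append_inj h2 (hs.trans hs₀.symm)
      obtain ⟨rfl, rfl⟩ := List.append_inj h3 (hw.trans hlw₀.symm)
      exact ⟨hw₀', hw₁'⟩
  · simp only [List.drop_left' he₀, List.take_left' hs₀]
    exact ⟨hs₀, hs₀'⟩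
  · simp only [List.take_left' he₀]
    exact ⟨he₀, by omega⟩
  · simp only [List.drop_left' he₀, List.take_left' hs₀]
    rw [hadjx x _ _ hy hz]
    -- In a linear order no string precedes the bottom, so the exclusion of `S` is vacuous.
    refine and_iff_left_of_imp ?_
    rintro h1 rfl
    omega

end ClusterComputing

namespace ClusterComputing

set_option linter.unusedSectionVars false

open PT

/-! ### Circular orders -/

/-- Subtraction of `ρ s` modulo `2 ^ n`, which puts `s` at position `0`. -/
theorem IsRank.exists_rotate {n : ℕ} {ρ : List Bool → ℕ} (hρ : IsRank n ρ) {s : List Bool}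
    (hs : s.length = n) : ∃ τ, IsRank n τ ∧
      ∀ w, τ w = if ρ s ≤ ρ w then ρ w - ρ s else ρ w + 2 ^ n - ρ s := by
  have hs' := hρ.1 hs
  rw [Set.mem_Iio] at hs'
  refine ⟨_, ⟨fun w hw => ?_, fun w hw v hv h => ?_, fun i hi => ?_⟩, fun w => rfl⟩
  · have := hρ.1 hw
    rw [Set.mem_Iio] at this ⊢
    split_ifs <;> omega
  · have h1 := hρ.1 hw
    have h2 := hρ.1 hv
    rw [Set.mem_Iio] at h1 h2
    beta_reduce at h
    exact hρ.2.1 hw hv (by split_ifs at h <;> omega)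
  · rw [Set.mem_Iio] at hi
    by_cases h : i + ρ s < 2 ^ n
    · obtain ⟨w, hw, hw'⟩ := hρ.2.2 (show i + ρ s ∈ Set.Iio _ from h)
      exact ⟨w, hw, by beta_reduce; rw [hw']; split_ifs <;> omega⟩
    · obtain ⟨w, hw, hw'⟩ := hρ.2.2 (show i + ρ s - 2 ^ n ∈ Set.Iio _ by rw [Set.mem_Iio]; omega)
      exact ⟨w, hw, by beta_reduce; rw [hw']; split_ifs <;> omega⟩

/-- In the circular order, `z` comes immediately after `y`. -/
def Next (n : ℕ) (ρ : List Bool → ℕ) (y z : List Bool) : Prop :=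
  ρ z = ρ y + 1 ∨ ρ y + 1 = 2 ^ n ∧ ρ z = 0

/-! ### Cutting a circle at the beginning of a block. -/

section Circular

variable {n : ℕ} {ρ : List Bool → ℕ}

theorem Next.left_unique (hρ : IsRank n ρ) {k l k' : List Bool} (hk : k.length = n) (hk' : k'.length = n)
    (h : Next n ρ k l) (h' : Next n ρ k' l) : k = k' := by
  have h1 := hρ.1 hk
  have h2 := hρ.1 hk'
  rw [Set.mem_Iio] at h1 h2
  unfold Next at h h'
  exact (hρ.eq_iff hk hk').1 (by omega)

theorem exists_next (hρ : IsRank n ρ) {l : List Bool} (hl : l.length = n) : ∃ k, k.length = n ∧ Next n ρ k l := by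
  have h1 := hρ.1 hl
  rw [Set.mem_Iio] at h1
  by_cases h0 : ρ l = 0
  · obtain ⟨k, hk, hk'⟩ := hρ.2.2 (show 2 ^ n - 1 ∈ Set.Iio _ by simp)
    exact ⟨k, hk, .inr ⟨by omega, h0⟩⟩
  · obtain ⟨k, hk, hk'⟩ := hρ.2.2 (show ρ l - 1 ∈ Set.Iio _ by rw [Set.mem_Iio]; omega)
    exact ⟨k, hk, .inl (by omega)⟩

variable {M : NTM} {x : List Bool}

/-- If `s` were not the first element of the interval, its circular predecessor `k` would have
position `ρ s - 1` and still lie inside. -/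
theorem Block.eq_of_next (hρ : IsRank n ρ) {l u k s : List Bool}
    (h : M.acc x = {w | w.length = n ∧ ρ l ≤ ρ w ∧ ρ w ≤ ρ u}) (hu : u.length = n)
    (hk : k.length = n) (hks : Next n ρ k s)
    (hk' : k ∉ M.acc x) (hs' : s ∈ M.acc x) : ρ s = ρ l := by
  rw [h, Set.mem_ofPred_eq] at hk' hs'
  have h1 := hρ.1 hk
  have h2 := hρ.1 hu
  rw [Set.mem_Iio] at h1 h2
  unfold Next at hks
  by_contra hne
  exact hk' ⟨hk, by omega, by omega⟩

/-- This is the uniqueness that puts the existence of a boundary into UP. -/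
theorem Block.boundary_unique (hρ : IsRank n ρ) (h : Block M x n ρ) {k l k' l' : List Bool}
    (hk : k.length = n) (hk' : k'.length = n) (hl : l.length = n) (hl' : l'.length = n)
    (hkl : Next n ρ k l) (hkl' : Next n ρ k' l') (hka : k ∉ M.acc x) (hka' : k' ∉ M.acc x)
    (hla : l ∈ M.acc x) (hla' : l' ∈ M.acc x) : k = k' ∧ l = l' := by
  obtain ⟨a, u, -, hu, hau⟩ := h
  have h1 := eq_of_next hρ hau hu hk hkl hka hla
  have h2 := eq_of_next hρ hau hu hk' hkl' hka' hla'
  obtain rfl := (hρ.eq_iff hl hl').1 (h1.trans h2.symm)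
  exact ⟨hkl.left_unique hρ hk hk' hkl', rfl⟩

/-- If the order is cut at the beginning of the block, or there is no such beginning, then the
block is still a block after the cut. -/
theorem Block.rotate (hρ : IsRank n ρ) (h : Block M x n ρ) (hne : (M.acc x).Nonempty) {e s : List Bool}
    (he : e.length = n) (hs : s.length = n) (hes : Next n ρ e s)
    (hcut : e ∉ M.acc x ∧ s ∈ M.acc x ∨
      ∀ k l, k.length = n → l.length = n → Next n ρ k l → l ∈ M.acc x → k ∈ M.acc x)
    {τ : List Bool → ℕ}
    (hτ : ∀ w, τ w = if ρ s ≤ ρ w then ρ w - ρ s else ρ w + 2 ^ n - ρ s) : Block M x n τ := by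
  obtain ⟨l, u, hl, hu, hlu⟩ := h
  have hlt : ∀ w : List Bool, w.length = n → ρ w < 2 ^ n := fun w hw => hρ.1 hw
  rcases hcut with ⟨hea, hsa⟩ | hcut
  -- The cut is at the lower end of the interval, which is merely shifted down to start at `0`.
  · have h1 := eq_of_next hρ hlu hu he hes hea hsa
    have h2 := hsa
    rw [hlu, Set.mem_ofPred_eq] at h2
    refine ⟨l, u, hl, hu, ?_⟩
    rw [hlu]
    ext w
    simp only [Set.mem_ofPred_eq, hτ]
    refine and_congr_right fun hw => ?_
    have := hlt w hw
    have := hlt u hu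
    split_ifs <;> omega
  · obtain ⟨v, hv⟩ := hne
    rw [hlu, Set.mem_ofPred_eq] at hv
    obtain ⟨k, hk, hkl⟩ := exists_next hρ hl
    -- The predecessor of the lower end lies in the interval only if the lower end has position `0`
    -- and the upper end is last. So everything is accepted, and the ends `s` and `e` of the new
    -- order bound the block.
    have hka := hcut k l hk hl hkl (by rw [hlu]; exact ⟨hl, by omega, by omega⟩)
    rw [hlu, Set.mem_ofPred_eq] at hka
    refine ⟨s, e, hs, he, ?_⟩
    rw [hlu]
    ext w
    simp only [Set.mem_ofPred_eq, hτ]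
    refine and_congr_right fun hw => ?_
    have := hlt w hw
    have := hlt u hu
    have := hlt e he
    have := hlt s hs
    unfold Next at hkl hes
    split_ifs <;> omega

end Circular

/-- A certificate consists of the strings before and after the cut and a witness justifying the cut.
Rotating the numbering to this cut gives a linear order in which the cluster is still an interval.
-/
theorem circular_subset_cluSharpP (hUP : UP = coUP) : CLUSharpPCircular ⊆ CLUSharpP := by
  classical
  intro f hf
  obtain ⟨p, hp, M, hM, hMp, adj, hadj, h⟩ := exists_rank_of_mem_circular hf
  have hpp := hMp.pt hM
  choose ρ hρ hadjx hblock hcard using h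
  have hne : ∀ x, (M.acc x).Nonempty → f x ≠ 0 := by
    intro x hx h0
    have := hcard x
    rw [h0, Nat.cast_zero, Set.encard_eq_zero] at this
    exact hx.ne_empty this
  let D : List Bool × List Bool → Bool := fun t => decide (t.2 ∈ M.acc t.1)
  have hD : PT (prodEnc id id) bitEnc D := M.pt_acc hM
  have hE : PT (prodEnc (id : List Bool → List Bool) (id : List Bool → List Bool)) id
      fun t => t.2.take (p t.1.length) := by
    simpa using take (hpp.comp fst) (snd (ea := (id : List Bool → List Bool)))
  have hE' : PT (prodEnc (id : List Bool → List Bool) (id : List Bool → List Bool)) id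
      fun t => t.2.drop (p t.1.length) := by
    simpa using drop (hpp.comp fst) (snd (ea := (id : List Bool → List Bool)))
  have hS := hE.comp (fst.pair hE')
  have hS' := hE'.comp (fst.pair hE')
  -- the boundaries
  obtain ⟨m, W, hW, hm⟩ := exists_refutation hUP (zeros_add hpp hpp)
    (R := fun t => adj t.1 (t.2.take (p t.1.length)) (t.2.drop (p t.1.length)) &&
      (!D (t.1, t.2.take (p t.1.length)) && D (t.1, t.2.drop (p t.1.length))))
    ((hadj.comp (fst.pair (hE.pair hE'))).and
      ((hD.comp (fst.pair hE)).not.and (hD.comp (fst.pair hE')))) (by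
    rintro x z ⟨hz, hz'⟩ v ⟨hv, hv'⟩
    rw [List.length_replicate] at hz hv
    obtain ⟨k, l, rfl, hk, hl⟩ := exists_append_of_length hz
    obtain ⟨k', l', rfl, hk', hl'⟩ := exists_append_of_length hv
    simp only [List.take_left' hk, List.drop_left' hk, List.take_left' hk', List.drop_left' hk',
      Bool.and_eq_true, Bool.not_eq_true', D, decide_eq_true_eq, decide_eq_false_iff_not]
      at hz' hv'
    rw [hadjx x _ _ hk hl] at hz'
    rw [hadjx x _ _ hk' hl'] at hv'
    obtain ⟨rfl, rfl⟩ := Block.boundary_unique (hρ x) (hblock x (hne x ⟨l, hz'.2.2⟩)) hk hk' hl hl'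
      hz'.1 hv'.1 hz'.2.1 hv'.2.1 hz'.2.2 hv'.2.2
    rfl)
  have hpm : PT (id : List Bool → List Bool) id fun x => zeros (m.eval x.length) :=
    zeros_eval m (zeros_length refl)
  refine mem_cluSharpP_of_certificate hp (hp.add (hp.add (isPolynomial_eval m)))
    (zeros_add hpp (zeros_add hpp hpm)) hM hMp
    -- A valid certificate `e`, `s`, `w` has `s` next to `e`, and either `e`, `s` is a boundary, or
    -- `s` is zero and `w` refutes all boundaries. In the first case `w` must be zero, so that the
    -- free slot does not spoil uniqueness; the two cases exclude each other.
    ((hadj.comp (fst.pair (hE.pair hS))).and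
      ((((hD.comp (fst.pair hE)).not.and (hD.comp (fst.pair hS))).and
        (beq hS' (zeros_length hS'))).or
      ((beq hS (zeros_length hS)).and (hW.comp (fst.pair hS'))))) hS hE hadj fun x => ?_
  have hm' := hm x
  simp only [List.length_replicate] at hm'
  have hcert : ∃ e₀ s₀ w₀ : List Bool, e₀.length = p x.length ∧ s₀.length = p x.length ∧
      w₀.length = m.eval x.length ∧ Next (p x.length) (ρ x) e₀ s₀ ∧
      (e₀ ∉ M.acc x ∧ s₀ ∈ M.acc x ∨ ∀ k l, k.length = p x.length → l.length = p x.length →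
        Next (p x.length) (ρ x) k l → l ∈ M.acc x → k ∈ M.acc x) ∧
      ∀ e s w : List Bool, e.length = p x.length → s.length = p x.length →
        w.length = m.eval x.length →
        (Next (p x.length) (ρ x) e s ∧ ((e ∉ M.acc x ∧ s ∈ M.acc x) ∧ w = zeros w.length ∨
          s = zeros s.length ∧ W (x, w) = true) ↔ e = e₀ ∧ s = s₀ ∧ w = w₀) := by
    by_cases hb : ∃ k l, k.length = p x.length ∧ l.length = p x.length ∧
        Next (p x.length) (ρ x) k l ∧ k ∉ M.acc x ∧ l ∈ M.acc x
    · obtain ⟨k, l, hk, hl, hkl, hka, hla⟩ := hb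
      have hno : ∀ w : List Bool, w.length = m.eval x.length → ¬ W (x, w) = true := by
        intro w hw hW
        refine hm'.2.1 ⟨w, hw, hW⟩ ⟨k ++ l, by simp [hk, hl], ?_⟩
        simp only [List.take_left' hk, List.drop_left' hk, Bool.and_eq_true, Bool.not_eq_true', D,
          decide_eq_true_eq, decide_eq_false_iff_not]
        exact ⟨(hadjx x _ _ hk hl).2 hkl, hka, hla⟩
      refine ⟨k, l, zeros (m.eval x.length), hk, hl, by simp, hkl, .inl ⟨hka, hla⟩,
        fun e s w he hs hw => ?_⟩
      rw [hw]
      constructor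
      · rintro ⟨hes, ⟨⟨hea, hsa⟩, hw'⟩ | ⟨-, hW⟩⟩
        · have := Block.boundary_unique (hρ x) (hblock x (hne x ⟨l, hla⟩)) he hk hs hl hes hkl
            hea hka hsa hla
          exact ⟨this.1, this.2, hw'⟩
        · exact absurd hW (hno w hw)
      · rintro ⟨rfl, rfl, hw'⟩
        exact ⟨hkl, .inl ⟨⟨hka, hla⟩, hw'⟩⟩
    -- Without a boundary the place of the cut is immaterial; in front of the zero string it is
    -- fixed by a computable choice.
    · obtain ⟨e₀, he₀, hes₀⟩ := exists_next (hρ x) (l := zeros (p x.length)) (by simp)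
      obtain ⟨w₀, hlw₀, hw₀⟩ := hm'.2.2 (by
        rintro ⟨z, hz, hz'⟩
        obtain ⟨k, l, rfl, hk, hl⟩ := exists_append_of_length hz
        simp only [List.take_left' hk, List.drop_left' hk, Bool.and_eq_true, Bool.not_eq_true', D,
          decide_eq_true_eq, decide_eq_false_iff_not] at hz'
        exact hb ⟨k, l, hk, hl, (hadjx x _ _ hk hl).1 hz'.1, hz'.2⟩)
      refine ⟨e₀, zeros (p x.length), w₀, he₀, by simp, hlw₀, hes₀, .inr fun k l hk hl hkl hla => ?_,
        fun e s w he hs hw => ?_⟩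
      · by_contra hka
        exact hb ⟨k, l, hk, hl, hkl, hka, hla⟩
      · constructor
        · rintro ⟨hes, ⟨⟨hea, hsa⟩, -⟩ | ⟨hs', hW⟩⟩
          · exact absurd ⟨e, s, he, hs, hes, hea, hsa⟩ hb
          · rw [hs] at hs'
            subst hs'
            exact ⟨hes.left_unique (hρ x) he he₀ hes₀, rfl, hm'.1 ⟨hw, hW⟩ ⟨hlw₀, hw₀⟩⟩
        · rintro ⟨rfl, rfl, rfl⟩
          exact ⟨hes₀, .inr ⟨by simp, hw₀⟩⟩
  obtain ⟨e₀, s₀, w₀, he₀, hs₀, hlw₀, hes, hcut, hV⟩ := hcert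
  obtain ⟨τ, hτ, hτ'⟩ := (hρ x).exists_rotate hs₀
  have hlt : ∀ w : List Bool, w.length = p x.length → ρ x w < 2 ^ p x.length :=
    fun w hw => (hρ x).1 hw
  refine ⟨e₀ ++ (s₀ ++ w₀), by simp [he₀, hs₀, hlw₀], fun c hc => ?_, τ, hτ,
    ?_, ?_, fun y z hy hz => ?_, fun h0 => ?_, hcard x⟩
  · obtain ⟨e, c, rfl, he, hc⟩ := exists_append_of_length hc
    obtain ⟨s, w, rfl, hs, hw⟩ := exists_append_of_length hc
    simp only [List.take_left' he, List.drop_left' he, List.take_left' hs, List.drop_left' hs,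
      Bool.and_eq_true, Bool.or_eq_true, Bool.not_eq_true', D, decide_eq_true_eq,
      decide_eq_false_iff_not, beq_iff_eq]
    rw [hadjx x _ _ he hs]
    refine (hV e s w he hs hw).trans ⟨?_, fun h1 => ?_⟩
    · rintro ⟨rfl, rfl, rfl⟩
      rfl
    · obtain ⟨h2, h3⟩ := List.append_inj h1 (he.trans he₀.symm)
      exact ⟨h2, List.append_inj h3 (hs.trans hs₀.symm)⟩
  · simp only [List.drop_left' he₀, List.take_left' hs₀]
    exact ⟨hs₀, by simp [hτ']⟩
  · simp only [List.take_left' he₀]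
    refine ⟨he₀, ?_⟩
    have := hlt _ he₀
    unfold Next at hes
    rw [hτ']
    split_ifs <;> omega
  · simp only [List.drop_left' he₀, List.take_left' hs₀]
    -- The only circularly adjacent pair that the rotated linear order lacks is the one ending in
    -- `s₀`.
    rw [hadjx x _ _ hy hz, ne_eq, ← (hρ x).eq_iff hz hs₀, hτ', hτ']
    have := hlt _ hy
    have := hlt _ hz
    have := hlt _ hs₀
    split_ifs <;> omega
  · have hne' : (M.acc x).Nonempty := by
      rw [Set.nonempty_iff_ne_empty]
      intro h1
      have := hcard x
      rw [h1, Set.encard_empty] at this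
      exact h0 (by exact_mod_cast this.symm)
    exact (hblock x h0).rotate (hρ x) hne' he₀ hs₀ hes hcut hτ'

end ClusterComputing

theorem theoremt (hUP : ClusterComputing.UP = ClusterComputing.coUP) :
    ClusterComputing.CLUSharpP = ClusterComputing.CLUSharpPFree ∧
      ClusterComputing.CLUSharpPFree = ClusterComputing.CLUSharpPCircular := by
  have h₁ := ClusterComputing.cluSharpP_subset_free.antisymm
    (ClusterComputing.free_subset_cluSharpP hUP)
  have h₂ := ClusterComputing.cluSharpP_subset_circular.antisymm
    (ClusterComputing.circular_subset_cluSharpP hUP)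
  exact ⟨h₁, h₁.symm.trans h₂⟩
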